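/- Let $P>0$, $n_0\in\mathbb R$, let $\phi^0,\psi^0\in C^2(\mathbb R)$ be $P$-periodic and $\mu=\mu(e,p)\in C^1(\mathbb R^2)$, and put $$e=\tfrac12|v|^2-\phi^0(x),\qquad p=v_2-\psi^0(x)\qquad (x\in\mathbb R,\ v=(v_1,v_2)\in\mathbb R^2).$$ Assume that $f^0=\mu(e,p)$ is an equilibrium of the nonrelativistic $1\frac12$D Vlasov-Maxwell system with fields $E_1^0=-\partial_x\phi^0$, $E_2^0=0$, $B^0=\partial_x\psi^0$, that is, $\mu(e,p)$ and $v_2\mu(e,p)$ are integrable in $v$ and $$\partial_x^2\phi^0=n_0-\int\mu(e,p)\,dv,\qquad \partial_x^2\psi^0=\int v_2\,\mu(e,p)\,dv .$$ Assume, at the values $(e,p)$ that are attained on phase space, that $\mu\ge0$, $\mu_e=\partial\mu/\partial e<0$ and $|\mu_e|+|\mu_p|\le c(1+|e|)^{-\alpha/2}$ for some $c$ and some $\alpha>2$, and that $\int(|v|^2|\mu_e|+|v_2||\mu_p|)\,dv$ is bounded uniformly in $x$ (this is automatic if $\alpha>4$). All functions of $x$ are $P$-periodic, and integrals in $x$ are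 over one period. Let $L^2_P,H^1_P,H^2_P$ be the periodic Lebesgue and Sobolev spaces, $L^2_w$ the weighted $L^2$ space in $(x,v)$ with weight $w(x,v)$, and $D=v_1\partial_x+\partial_x\phi^0\,\partial_{v_1}+\partial_x\psi^0\,(v_1\partial_{v_2}-v_2\partial_{v_1})$ the transport operator, acting in the sense of distributions with maximal domain in $L^2_{|\mu_e|}$. Let $\mathcal P$ be the orthogonal projection of $L^2_{|\mu_e|}$ onto $\ker D$. Let $X_{ev}$, $X_{od}$ be the spaces of the functions in $L^2_{1/|\mu_e|}$ that are even, respectively odd, in $v_1$; let $X=X_{ev}\times L^2_P\times H^1_P$ and $Y=X_{od}\times L^2_P$. Define $L:X\to X^*$ by $$\langle L(g,E_1,\psi),(\tilde g,\tilde E_1,\tilde\psi)\rangle=\iint\frac{g\tilde g}{|\mu_e|}\,dv\,dx+\int E_1\tilde E_1\,dx+\int\psi'\tilde\psi'\,dx-\int\Big(\int v_2\mu_p\,dv\Big)\psi\tilde\psi\,dx ,$$ and let $B:Y^*\supset D(B)\to X$, with its maximal domain, be $$B(h,E)=\Big(\mu_eDh+\mu_ev_2E,\ -\int\mu_ev_1h\,dv,\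 -E\Big),$$ where $X_{od}^*$ is identified with the functions in $L^2_{|\mu_e|}$ that are odd in $v_1$, through the pairing $\iint fh\,dx\,dv$. Let $$\mathcal A_1^0h=-\partial_x^2h-\Big(\int\mu_e\,dv\Big)h+\int\mu_e\,\mathcal P h\,dv,\qquad \mathcal A_2^0h=-\partial_x^2h-\Big(\int v_2\mu_p\,dv\Big)h-\int\mu_ev_2\,\mathcal P(v_2h)\,dv$$ from $H^2_P$ to $L^2_P$, and $$\mathcal B^0h=\Big(\int\mu_p\,dv\Big)h+\int\mu_e\,\mathcal P(v_2h)\,dv,\qquad(\mathcal B^0)^*h=\Big(\int\mu_p\,dv\Big)h+\int v_2\mu_e\,\mathcal P h\,dv$$ from $L^2_P$ to $L^2_P$. Then for every $\psi\in H^2_P$ there is exactly one $\phi\in H^2_P$ with mean zero such that $\mathcal A_1^0\phi=\mathcal B^0\psi$. With $(\mathcal A_1^0)^{-1}\mathcal B^0\psi:=\phi$, the operator $$\mathcal L^0=(\mathcal B^0)^*(\mathcal A_1^0)^{-1}\mathcal B^0+\mathcal A_2^0:\ H^2_P\to L^2_P$$ is therefore well defined, and $$n^-\big(L|_{\overline{R(B)}}\big)=n^-(\mathcal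 L^0),\qquad \dim\ker L|_{\overline{R(B)}}=\dim\ker\mathcal L^0 .$$ Here $n^-(L|_{\overline{R(B)}})$ is the maximal dimension of a subspace of $\overline{R(B)}\subset X$ on which $\langle L\cdot,\cdot\rangle$ is negative away from $0$; $\ker L|_{\overline{R(B)}}$ is the set of $u\in\overline{R(B)}$ with $\langle Lu,w\rangle=0$ for all $w\in\overline{R(B)}$; and $n^-(\mathcal L^0)$ is the number of negative eigenvalues of $\mathcal L^0$, counted with multiplicity, which is also the maximal dimension of a subspace of $H^2_P$ on which $(\mathcal L^0\cdot,\cdot)_{L^2}$ is negative away from $0$. -/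

import Mathlib

open MeasureTheory Set
open scoped ENNReal

noncomputable section

namespace VlasovMaxwell

/-! ### Indices of quadratic forms -/

/-- The negative index `n⁻(q|_V)`: the maximal dimension of a subspace of `V` on which `q` is
negative away from `0` (with value `⊤` if these dimensions are unbounded). -/
def negIndex {E : Type*} [AddCommGroup E] [Module ℝ E] (V : Submodule ℝ E) (q : E → ℝ) : ℕ∞ :=
  ⨆ S : {S : Submodule ℝ E // S ≤ V ∧ ∀ u ∈ S, u ≠ 0 → q u < 0},
    Cardinal.toENat (Module.rank ℝ S.1)

/-- The kernel of the restriction to `V` of the bilinear form `b`. -/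
def formKer {E : Type*} [AddCommGroup E] [Module ℝ E] (V : Submodule ℝ E)
    (b : E →ₗ[ℝ] E →ₗ[ℝ] ℝ) : Submodule ℝ E where
  carrier := {u | u ∈ V ∧ ∀ w ∈ V, b u w = 0}
  zero_mem' := ⟨V.zero_mem, fun w _ => by simp⟩
  add_mem' := fun ha hb => ⟨V.add_mem ha.1 hb.1, fun w hw => by simp [ha.2 w hw, hb.2 w hw]⟩
  smul_mem' := fun c _ ha => ⟨V.smul_mem c ha.1, fun w hw => by simp [ha.2 w hw]⟩

/-! ### The equilibrium

Points of phase space are `(x, v) = (x, (v₁, v₂)) : ℝ × ℝ × ℝ`. -/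

/-- The particle energy `e = |v|² / 2 - φ⁰(x)`. -/
def energy (φ₀ : ℝ → ℝ) (x : ℝ) (v : ℝ × ℝ) : ℝ := (v.1 ^ 2 + v.2 ^ 2) / 2 - φ₀ x

/-- The angular momentum `p = v₂ - ψ⁰(x)`. -/
def momentum (ψ₀ : ℝ → ℝ) (x : ℝ) (v : ℝ × ℝ) : ℝ := v.2 - ψ₀ x

/-- The partial derivative `μ_e` of `μ = μ(e, p)`, at the values of `e` and `p` in `(x, v)`. -/
def partialE (μ : ℝ × ℝ → ℝ) (φ₀ ψ₀ : ℝ → ℝ) (x : ℝ) (v : ℝ × ℝ) : ℝ :=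
  fderiv ℝ μ (energy φ₀ x v, momentum ψ₀ x v) (1, 0)

/-- The partial derivative `μ_p` of `μ = μ(e, p)`, at the values of `e` and `p` in `(x, v)`. -/
def partialP (μ : ℝ × ℝ → ℝ) (φ₀ ψ₀ : ℝ → ℝ) (x : ℝ) (v : ℝ × ℝ) : ℝ :=
  fderiv ℝ μ (energy φ₀ x v, momentum ψ₀ x v) (0, 1)

/-- A `P`-periodic equilibrium `f⁰ = μ(e, p)`, `E₁⁰ = -∂ₓφ⁰`, `E₂⁰ = 0`, `B⁰ = ∂ₓψ⁰` of the
(nonrelativistic) 1½D Vlasov-Maxwell system with constant ion background `n₀`. The conditions on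
`μ` are required only at the values `(e, p)` that are attained on phase space. -/
structure Equilibrium where
  /-- the period -/
  P : ℝ
  P_pos : 0 < P
  /-- the ion background density -/
  n₀ : ℝ
  /-- the electron distribution, as a function of `(e, p)` -/
  μ : ℝ × ℝ → ℝ
  /-- the electric potential -/
  φ₀ : ℝ → ℝ
  /-- the magnetic potential -/
  ψ₀ : ℝ → ℝ
  φ₀_contDiff : ContDiff ℝ 2 φ₀
  ψ₀_contDiff : ContDiff ℝ 2 ψ₀
  φ₀_periodic : Function.Periodic φ₀ P
  ψ₀_periodic : Function.Periodic ψ₀ P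
  μ_contDiff : ContDiff ℝ 1 μ
  μ_nonneg : ∀ x v, 0 ≤ μ (energy φ₀ x v, momentum ψ₀ x v)
  μe_neg : ∀ x v, partialE μ φ₀ ψ₀ x v < 0
  /-- `|μ_e| + |μ_p| ≤ c (1 + |e|)^(-α/2)` for some `α > 2` -/
  decay : ∃ c α : ℝ, 2 < α ∧ ∀ x v, |partialE μ φ₀ ψ₀ x v| + |partialP μ φ₀ ψ₀ x v|
    ≤ c * (1 + |energy φ₀ x v|) ^ (-(α / 2))
  /-- `∫ (|v|² |μ_e| + |v₂| |μ_p|) dv` is finite, uniformly in `x` (automatic if `α > 4`) -/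
  moment : ∃ C : ℝ, ∀ x, ∫⁻ v : ℝ × ℝ, ENNReal.ofReal
    ((v.1 ^ 2 + v.2 ^ 2) * |partialE μ φ₀ ψ₀ x v| + |v.2| * |partialP μ φ₀ ψ₀ x v|)
      ≤ ENNReal.ofReal C
  density_integrable : ∀ x, Integrable fun v => μ (energy φ₀ x v, momentum ψ₀ x v)
  current_integrable : ∀ x, Integrable fun v : ℝ × ℝ =>
    v.2 * μ (energy φ₀ x v, momentum ψ₀ x v)
  /-- `∂ₓ² φ⁰ = n₀ - ∫ μ(e, p) dv` -/
  φ₀_eq : ∀ x, deriv (deriv φ₀) x = n₀ - ∫ v, μ (energy φ₀ x v, momentum ψ₀ x v)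
  /-- `∂ₓ² ψ⁰ = ∫ v₂ μ(e, p) dv` -/
  ψ₀_eq : ∀ x, deriv (deriv ψ₀) x = ∫ v : ℝ × ℝ, v.2 * μ (energy φ₀ x v, momentum ψ₀ x v)

namespace Equilibrium

variable (F : Equilibrium)

/-- `μ_e` as a function of `(x, v)`. -/
def μe (x : ℝ) (v : ℝ × ℝ) : ℝ := partialE F.μ F.φ₀ F.ψ₀ x v

/-- `μ_p` as a function of `(x, v)`. -/
def μp (x : ℝ) (v : ℝ × ℝ) : ℝ := partialP F.μ F.φ₀ F.ψ₀ x v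

lemma μe_lt (x : ℝ) (v : ℝ × ℝ) : F.μe x v < 0 := F.μe_neg x v

lemma continuous_ep : Continuous fun z : ℝ × ℝ × ℝ =>
    (energy F.φ₀ z.1 z.2, momentum F.ψ₀ z.1 z.2) := by
  have h1 := F.φ₀_contDiff.continuous
  have h2 := F.ψ₀_contDiff.continuous
  unfold energy momentum
  fun_prop

lemma continuous_μe : Continuous fun z : ℝ × ℝ × ℝ => F.μe z.1 z.2 := by
  have h := (F.μ_contDiff.continuous_fderiv (by norm_num)).comp F.continuous_ep
  exact h.clm_apply continuous_const

lemma continuous_μp : Continuous fun z : ℝ × ℝ × ℝ => F.μp z.1 z.2 := by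
  have h := (F.μ_contDiff.continuous_fderiv (by norm_num)).comp F.continuous_ep
  exact h.clm_apply continuous_const

lemma exists_decay_bound : ∃ K : ℝ≥0∞, K < ⊤ ∧ ∀ x,
    ∫⁻ v : ℝ × ℝ, ENNReal.ofReal (|F.μe x v| + |F.μp x v|) ≤ K := by
  obtain ⟨c, α, hα, h⟩ := F.decay
  obtain ⟨M, hM⟩ : ∃ M : ℝ, ∀ x, |F.φ₀ x| ≤ M := by
    obtain ⟨M, hM⟩ := (F.φ₀_periodic.isBounded_of_continuous F.P_pos.ne'
      F.φ₀_contDiff.continuous).exists_norm_le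
    exact ⟨M, fun x => hM _ ⟨x, rfl⟩⟩
  have hM0 : 0 ≤ M := (abs_nonneg _).trans (hM 0)
  have hc : 0 ≤ c := by
    by_contra hc
    have h1 := h 0 0
    have h2 : (0 : ℝ) < (1 + |energy F.φ₀ 0 0|) ^ (-(α / 2)) := by positivity
    nlinarith [abs_nonneg (partialE F.μ F.φ₀ F.ψ₀ 0 0),
      abs_nonneg (partialP F.μ F.φ₀ F.ψ₀ 0 0), mul_pos (neg_pos.2 (not_le.1 hc)) h2]
  set g : ℝ × ℝ → ℝ := fun v =>
    c * ((2 * M + 2) ^ (α / 2) * (1 + ‖v‖ ^ 2) ^ (-α / 2)) with hg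
  have hgi : Integrable g := by
    refine (Integrable.const_mul ?_ _).const_mul _
    exact integrable_rpow_neg_one_add_norm_sq (by simpa using hα)
  refine ⟨∫⁻ v, ENNReal.ofReal (g v), hgi.lintegral_lt_top, fun x => ?_⟩
  refine lintegral_mono fun v => ENNReal.ofReal_le_ofReal ((h x v).trans ?_)
  rw [hg]
  refine mul_le_mul_of_nonneg_left ?_ hc
  have hv : ‖v‖ ^ 2 ≤ v.1 ^ 2 + v.2 ^ 2 := by
    rw [Prod.norm_def]
    rcases max_cases ‖v.1‖ ‖v.2‖ with h | h <;> rw [h.1, Real.norm_eq_abs, sq_abs] <;>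
      nlinarith [sq_nonneg v.1, sq_nonneg v.2]
  have he : 1 + ‖v‖ ^ 2 ≤ (2 * M + 2) * (1 + |energy F.φ₀ x v|) := by
    have h1 := le_abs_self (energy F.φ₀ x v)
    have h2 := (abs_le.1 (hM x)).2
    have h3 : v.1 ^ 2 + v.2 ^ 2 = 2 * (energy F.φ₀ x v + F.φ₀ x) := by unfold energy; ring
    nlinarith [abs_nonneg (energy F.φ₀ x v), mul_nonneg hM0 (abs_nonneg (energy F.φ₀ x v))]
  have h4 : (1 + ‖v‖ ^ 2) / (2 * M + 2) ≤ 1 + |energy F.φ₀ x v| := by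
    rw [div_le_iff₀ (by positivity)]; linarith
  calc (1 + |energy F.φ₀ x v|) ^ (-(α / 2))
      ≤ ((1 + ‖v‖ ^ 2) / (2 * M + 2)) ^ (-(α / 2)) :=
        Real.rpow_le_rpow_of_nonpos (by positivity) h4 (by linarith)
    _ = (2 * M + 2) ^ (α / 2) * (1 + ‖v‖ ^ 2) ^ (-α / 2) := by
        rw [Real.div_rpow (by positivity) (by positivity), Real.rpow_neg (by positivity) (α / 2)
          (x := 2 * M + 2), neg_div]
        field_simp

/-- A common bound for the integrals over `v` that occur below. -/
lemma exists_bound : ∃ K : ℝ≥0∞, K < ⊤ ∧ ∀ x,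
    ∫⁻ v : ℝ × ℝ, ENNReal.ofReal (|F.μe x v| * (1 + v.1 ^ 2 + v.2 ^ 2)
      + |F.μp x v| * (1 + |v.2|)) ≤ K := by
  obtain ⟨K, hK, h⟩ := F.exists_decay_bound
  obtain ⟨C, hC⟩ := F.moment
  refine ⟨K + ENNReal.ofReal C, by simp [hK], fun x => ?_⟩
  have hm : Measurable fun v : ℝ × ℝ => ENNReal.ofReal (|F.μe x v| + |F.μp x v|) := by
    have h1 := F.continuous_μe.comp (Continuous.prodMk_right x)
    have h2 := F.continuous_μp.comp (Continuous.prodMk_right x)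
    exact (ENNReal.continuous_ofReal.comp (h1.abs.add h2.abs)).measurable
  refine le_trans (le_of_eq ?_) (add_le_add (h x) (hC x))
  rw [← lintegral_add_left hm]
  refine lintegral_congr fun v => ?_
  rw [← ENNReal.ofReal_add (by positivity) (by positivity)]
  congr 1
  simp only [μe, μp]
  ring

/-! ### Lebesgue spaces -/

/-- Lebesgue measure on one period `(0, P]`. -/
abbrev perMeas : Measure ℝ := volume.restrict (Ioc 0 F.P)

/-- Lebesgue measure on one period of phase space. -/
abbrev base : Measure (ℝ × ℝ × ℝ) := F.perMeas.prod volume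

/-- The measure `|μ_e| dx dv` on one period of phase space. -/
def measW : Measure (ℝ × ℝ × ℝ) :=
  F.base.withDensity fun z => ENNReal.ofReal |F.μe z.1 z.2|

/-- The measure `|μ_e|⁻¹ dx dv` on one period of phase space. -/
def measInv : Measure (ℝ × ℝ × ℝ) :=
  F.base.withDensity fun z => ENNReal.ofReal |F.μe z.1 z.2|⁻¹

/-- `L²_P`, the `P`-periodic `L²` functions of `x`. -/
abbrev L2P : Type := Lp ℝ 2 F.perMeas

/-- `L²_{|μ_e|}`. -/
abbrev L2W : Type := Lp ℝ 2 F.measW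

/-- `L²_{1/|μ_e|}`. -/
abbrev L2Inv : Type := Lp ℝ 2 F.measInv

lemma measurable_wt : Measurable fun z : ℝ × ℝ × ℝ => ENNReal.ofReal |F.μe z.1 z.2| :=
  (ENNReal.continuous_ofReal.comp F.continuous_μe.abs).measurable

lemma measurable_wtInv : Measurable fun z : ℝ × ℝ × ℝ => ENNReal.ofReal |F.μe z.1 z.2|⁻¹ :=
  (F.continuous_μe.abs.measurable.inv).ennreal_ofReal

lemma lintegral_measW {f : ℝ × ℝ × ℝ → ℝ≥0∞} (hf : Measurable f) :
    ∫⁻ z, f z ∂F.measW = ∫⁻ z, ENNReal.ofReal |F.μe z.1 z.2| * f z ∂F.base :=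
  lintegral_withDensity_eq_lintegral_mul _ F.measurable_wt hf

lemma lintegral_measInv {f : ℝ × ℝ × ℝ → ℝ≥0∞} (hf : Measurable f) :
    ∫⁻ z, f z ∂F.measInv = ∫⁻ z, ENNReal.ofReal |F.μe z.1 z.2|⁻¹ * f z ∂F.base :=
  lintegral_withDensity_eq_lintegral_mul _ F.measurable_wtInv hf

lemma integrable_measW_iff {f : ℝ × ℝ × ℝ → ℝ} : Integrable f F.measW ↔
    Integrable (fun z => |F.μe z.1 z.2| * f z) F.base := by
  unfold measW
  rw [integrable_withDensity_iff_integrable_smul' F.measurable_wt (by simp)]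
  simp [ENNReal.toReal_ofReal]

lemma integral_measW (f : ℝ × ℝ × ℝ → ℝ) :
    ∫ z, f z ∂F.measW = ∫ z, |F.μe z.1 z.2| * f z ∂F.base := by
  unfold measW
  rw [integral_withDensity_eq_integral_toReal_smul F.measurable_wt (by simp)]
  simp [ENNReal.toReal_ofReal]

lemma base_ac_measW : F.base ≪ F.measW :=
  withDensity_absolutelyContinuous' F.measurable_wt.aemeasurable
    (.of_forall fun z => by simpa using (F.μe_lt z.1 z.2).ne)

lemma measW_ac_base : F.measW ≪ F.base := withDensity_absolutelyContinuous _ _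

lemma measInv_ac_base : F.measInv ≪ F.base := withDensity_absolutelyContinuous _ _

lemma measInv_ac_measW : F.measInv ≪ F.measW := F.measInv_ac_base.trans F.base_ac_measW

lemma memLp_two_iff {β : Type*} [MeasurableSpace β] {m : Measure β} {f : β → ℝ} :
    MemLp f 2 m ↔ AEStronglyMeasurable f m ∧ ∫⁻ z, ‖f z‖ₑ ^ 2 ∂m < ⊤ := by
  unfold MemLp
  rw [eLpNorm_lt_top_iff_lintegral_rpow_enorm_lt_top (by norm_num) (by norm_num)]
  simp

/-- The linear map between `L²` spaces that is given by an operation `T` on functions. -/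
def l2Map {β γ : Type*} [MeasurableSpace β] [MeasurableSpace γ] {m : Measure β} {m' : Measure γ}
    (T : (β → ℝ) → γ → ℝ) (hT : ∀ f : Lp ℝ 2 m, MemLp (T f) 2 m')
    (hadd : ∀ f g : Lp ℝ 2 m, T ⇑(f + g) =ᵐ[m'] T f + T g)
    (hsmul : ∀ (c : ℝ) (f : Lp ℝ 2 m), T ⇑(c • f) =ᵐ[m'] c • T f) :
    Lp ℝ 2 m →ₗ[ℝ] Lp ℝ 2 m' where
  toFun f := (hT f).toLp (T f)
  map_add' f g := by
    rw [← MemLp.toLp_add]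
    exact MemLp.toLp_congr _ _ (hadd f g)
  map_smul' c f := by
    rw [RingHom.id_apply, ← MemLp.toLp_const_smul]
    exact MemLp.toLp_congr _ _ (hsmul c f)

/-- Multiplication by the bounded function `a` in `L²_P`. -/
def mulOp (a : ℝ → ℝ) (ha : Measurable a) (hb : ∃ C : ℝ, ∀ x, |a x| ≤ C) :
    F.L2P →ₗ[ℝ] F.L2P :=
  l2Map (fun f x => a x * f x)
    (fun f => by
      obtain ⟨C, hC⟩ := hb
      refine (Lp.memLp f).of_le_mul (c := C)
        (ha.aestronglyMeasurable.mul (Lp.aestronglyMeasurable f)) (.of_forall fun x => ?_)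
      rw [norm_mul]
      exact mul_le_mul_of_nonneg_right (hC x) (norm_nonneg _))
    (fun f g => by
      filter_upwards [Lp.coeFn_add f g] with x hx
      simp only [hx, Pi.add_apply, mul_add])
    (fun c f => by
      filter_upwards [Lp.coeFn_smul c f] with x hx
      simp only [hx, Pi.smul_apply, smul_eq_mul, mul_left_comm])

/-- Multiplication by `μ_e`, an isometry from `L²_{|μ_e|}` to `L²_{1/|μ_e|}`. -/
def mulμe : F.L2W →ₗ[ℝ] F.L2Inv :=
  l2Map (fun h z => F.μe z.1 z.2 * h z)
    (fun h => by
      have hh := memLp_two_iff.1 (Lp.memLp h)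
      have hm : Measurable fun z : ℝ × ℝ × ℝ => F.μe z.1 z.2 := F.continuous_μe.measurable
      have hs : Measurable h := (Lp.stronglyMeasurable h).measurable
      refine memLp_two_iff.2 ⟨(hm.mul hs).aestronglyMeasurable, ?_⟩
      refine lt_of_eq_of_lt ?_ hh.2
      have hms : Measurable fun z : ℝ × ℝ × ℝ => F.μe z.1 z.2 * h z := hm.mul hs
      rw [F.lintegral_measInv (hms.enorm.pow_const 2),
        F.lintegral_measW (hs.enorm.pow_const 2)]
      refine lintegral_congr fun z => ?_
      have h0 : F.μe z.1 z.2 ≠ 0 := (F.μe_lt z.1 z.2).ne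
      simp only [enorm_mul, mul_pow, ← mul_assoc]
      congr 1
      rw [Real.enorm_eq_ofReal_abs, ← ENNReal.ofReal_pow (abs_nonneg _),
        ← ENNReal.ofReal_mul (by positivity)]
      congr 1
      field_simp)
    (fun f g => by
      filter_upwards [F.measInv_ac_measW.ae_le (Lp.coeFn_add f g)] with z hz
      simp only [hz, Pi.add_apply, mul_add])
    (fun c f => by
      filter_upwards [F.measInv_ac_measW.ae_le (Lp.coeFn_smul c f)] with z hz
      simp only [hz, Pi.smul_apply, smul_eq_mul, mul_left_comm])

/-- Weights `q(v)` of at most linear growth, such as `1`, `v₁`, `v₂`. -/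
structure IsWeight (q : ℝ × ℝ → ℝ) : Prop where
  measurable : Measurable q
  sq_le : ∀ v, q v ^ 2 ≤ 1 + v.1 ^ 2 + v.2 ^ 2

lemma isWeight_one : IsWeight fun _ => 1 :=
  ⟨measurable_const, fun v => by nlinarith [sq_nonneg v.1, sq_nonneg v.2]⟩

lemma isWeight_fst : IsWeight fun v => v.1 :=
  ⟨measurable_fst, fun v => by nlinarith [sq_nonneg v.1, sq_nonneg v.2]⟩

lemma isWeight_snd : IsWeight fun v => v.2 :=
  ⟨measurable_snd, fun v => by nlinarith [sq_nonneg v.1, sq_nonneg v.2]⟩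

lemma exists_weight_bound {q : ℝ × ℝ → ℝ} (hq : IsWeight q) : ∃ K : ℝ≥0∞, K < ⊤ ∧ ∀ x,
    ∫⁻ v : ℝ × ℝ, ENNReal.ofReal |F.μe x v| * ‖q v‖ₑ ^ 2 ≤ K := by
  obtain ⟨K, hK, h⟩ := F.exists_bound
  refine ⟨K, hK, fun x => (lintegral_mono fun v => ?_).trans (h x)⟩
  rw [Real.enorm_eq_ofReal_abs, ← ENNReal.ofReal_pow (abs_nonneg _), sq_abs,
    ← ENNReal.ofReal_mul (abs_nonneg _)]
  refine ENNReal.ofReal_le_ofReal ?_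
  have := mul_le_mul_of_nonneg_left (hq.sq_le v) (abs_nonneg (F.μe x v))
  have : 0 ≤ |F.μp x v| * (1 + |v.2|) := by positivity
  linarith

lemma memLp_lift {q : ℝ × ℝ → ℝ} (hq : IsWeight q) {h : ℝ → ℝ} (hm : Measurable h)
    (hh : MemLp h 2 F.perMeas) : MemLp (fun z : ℝ × ℝ × ℝ => q z.2 * h z.1) 2 F.measW := by
  obtain ⟨K, hK, hb⟩ := F.exists_weight_bound hq
  have hM : Measurable fun z : ℝ × ℝ × ℝ => q z.2 * h z.1 :=
    (hq.measurable.comp measurable_snd).mul (hm.comp measurable_fst)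
  refine memLp_two_iff.2 ⟨hM.aestronglyMeasurable, ?_⟩
  rw [F.lintegral_measW (hM.enorm.pow_const 2),
    lintegral_prod _ (by
      exact (F.measurable_wt.mul (hM.enorm.pow_const 2)).aemeasurable)]
  have h2 := (memLp_two_iff.1 hh).2
  calc ∫⁻ x, (∫⁻ v, ENNReal.ofReal |F.μe x v| * ‖q v * h x‖ₑ ^ 2) ∂F.perMeas
      ≤ ∫⁻ x, K * ‖h x‖ₑ ^ 2 ∂F.perMeas := by
        refine lintegral_mono fun x => ?_
        have : ∀ v, ENNReal.ofReal |F.μe x v| * ‖q v * h x‖ₑ ^ 2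
            = ENNReal.ofReal |F.μe x v| * ‖q v‖ₑ ^ 2 * ‖h x‖ₑ ^ 2 := fun v => by
          rw [enorm_mul, mul_pow, mul_assoc]
        simp only [this]
        rw [lintegral_mul_const' _ _ (by simp)]
        exact mul_le_mul_left (hb x) _
    _ < ⊤ := by
        rw [lintegral_const_mul' _ _ hK.ne]
        exact ENNReal.mul_lt_top hK h2

/-- The map `h ↦ q(v) h(x)` from `L²_P` to `L²_{|μ_e|}`. -/
def lift (q : ℝ × ℝ → ℝ) (hq : IsWeight q) : F.L2P →ₗ[ℝ] F.L2W :=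
  have hae {f g : ℝ → ℝ} (h : f =ᵐ[F.perMeas] g) :
      (fun z : ℝ × ℝ × ℝ => f z.1) =ᵐ[F.measW] fun z => g z.1 :=
    F.measW_ac_base.ae_le (Measure.quasiMeasurePreserving_fst.ae_eq_comp h)
  l2Map (fun h z => q z.2 * h z.1)
    (fun h => F.memLp_lift hq (Lp.stronglyMeasurable h).measurable (Lp.memLp h))
    (fun f g => by
      filter_upwards [hae (Lp.coeFn_add f g)] with z hz
      simp only [hz, Pi.add_apply, mul_add])
    (fun c f => by
      filter_upwards [hae (Lp.coeFn_smul c f)] with z hz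
      simp only [hz, Pi.smul_apply, smul_eq_mul, mul_left_comm])

instance : IsFiniteMeasure F.measW := by
  have h := (memLp_two_iff.1 (F.memLp_lift isWeight_one measurable_const
    (memLp_const (1 : ℝ)))).2
  constructor
  simpa using h

lemma memLp_weight {q : ℝ × ℝ → ℝ} (hq : IsWeight q) :
    MemLp (fun z : ℝ × ℝ × ℝ => q z.2) 2 F.measW := by
  simpa using F.memLp_lift hq measurable_const (memLp_const (1 : ℝ))

lemma integrable_weight {q : ℝ × ℝ → ℝ} (hq : IsWeight q) (w : F.L2W) :
    Integrable (fun z : ℝ × ℝ × ℝ => F.μe z.1 z.2 * q z.2 * w z) F.base := by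
  have h1 := (F.memLp_weight hq).integrable_mul (Lp.memLp w)
  rw [F.integrable_measW_iff] at h1
  refine h1.neg.congr (.of_forall fun z => ?_)
  simp only [Pi.neg_apply, Pi.mul_apply, abs_of_neg (F.μe_lt z.1 z.2), neg_mul, neg_neg,
    mul_assoc]

lemma enorm_avg_sq_le {q : ℝ × ℝ → ℝ} (hq : IsWeight q) {K : ℝ≥0∞} {x : ℝ}
    (hb : ∫⁻ v : ℝ × ℝ, ENNReal.ofReal |F.μe x v| * ‖q v‖ₑ ^ 2 ≤ K) {f : ℝ × ℝ → ℝ}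
    (hf : Measurable f) : ‖∫ v, F.μe x v * q v * f v‖ₑ ^ 2
      ≤ K * ∫⁻ v, ENNReal.ofReal |F.μe x v| * ‖f v‖ₑ ^ 2 := by
  set η : Measure (ℝ × ℝ) := volume.withDensity fun v => ENNReal.ofReal |F.μe x v| with hη
  have hwt : Measurable fun v => ENNReal.ofReal |F.μe x v| :=
    (F.continuous_μe.comp (Continuous.prodMk_right x)).abs.measurable.ennreal_ofReal
  have hqm : AEMeasurable (fun v => ‖q v‖ₑ) η := hq.measurable.enorm.aemeasurable
  have hfm : AEMeasurable (fun v => ‖f v‖ₑ) η := hf.enorm.aemeasurable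
  have hH := ENNReal.lintegral_mul_le_Lp_mul_Lq η Real.HolderConjugate.two_two hqm hfm
  have e1 : ∫⁻ v, ‖F.μe x v * q v * f v‖ₑ
      = ∫⁻ v, ((fun v => ‖q v‖ₑ) * fun v => ‖f v‖ₑ) v ∂η := by
    rw [hη, lintegral_withDensity_eq_lintegral_mul _ hwt (hq.measurable.enorm.mul hf.enorm)]
    refine lintegral_congr fun v => ?_
    simp only [Pi.mul_apply, enorm_mul, Real.enorm_eq_ofReal_abs (F.μe x v), mul_assoc]
  have e2 : ∀ f : ℝ × ℝ → ℝ, Measurable f → ∫⁻ v, ‖f v‖ₑ ^ (2 : ℝ) ∂η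
      = ∫⁻ v, ENNReal.ofReal |F.μe x v| * ‖f v‖ₑ ^ 2 := fun f hf => by
    simp only [ENNReal.rpow_two]
    rw [hη, lintegral_withDensity_eq_lintegral_mul _ hwt (hf.enorm.pow_const 2)]
    rfl
  rw [e2 _ hq.measurable, e2 _ hf, ← e1] at hH
  have hsq : ∀ a : ℝ≥0∞, (a ^ (1 / (2 : ℝ))) ^ 2 = a := fun a => by
    rw [← ENNReal.rpow_two, ← ENNReal.rpow_mul]
    norm_num
  calc ‖∫ v, F.μe x v * q v * f v‖ₑ ^ 2
      ≤ (∫⁻ v, ‖F.μe x v * q v * f v‖ₑ) ^ 2 :=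
        pow_le_pow_left₀ zero_le (enorm_integral_le_lintegral_enorm _) 2
    _ ≤ _ := pow_le_pow_left₀ zero_le hH 2
    _ = _ := by rw [mul_pow, hsq, hsq]
    _ ≤ _ := mul_le_mul_left hb _

lemma memLp_avg {q : ℝ × ℝ → ℝ} (hq : IsWeight q) (w : F.L2W) :
    MemLp (fun x => ∫ v, F.μe x v * q v * w (x, v)) 2 F.perMeas := by
  obtain ⟨K, hK, hb⟩ := F.exists_weight_bound hq
  have hw : Measurable w := (Lp.stronglyMeasurable w).measurable
  have hM : Measurable fun z : ℝ × ℝ × ℝ => F.μe z.1 z.2 * q z.2 * w z :=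
    (F.continuous_μe.measurable.mul (hq.measurable.comp measurable_snd)).mul hw
  refine memLp_two_iff.2
    ⟨(hM.stronglyMeasurable.integral_prod_right (ν := volume)).aestronglyMeasurable, ?_⟩
  have h2 := (memLp_two_iff.1 (Lp.memLp w)).2
  rw [F.lintegral_measW (hw.enorm.pow_const 2),
    lintegral_prod _ (by
      exact (F.measurable_wt.mul (hw.enorm.pow_const 2)).aemeasurable)] at h2
  refine lt_of_le_of_lt (lintegral_mono fun x =>
    F.enorm_avg_sq_le hq (hb x) (hw.comp measurable_prodMk_left)) ?_
  rw [lintegral_const_mul' _ _ hK.ne]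
  exact ENNReal.mul_lt_top hK h2

/-- The map `w ↦ ∫ μ_e q w dv` from `L²_{|μ_e|}` to `L²_P`. -/
def avg (q : ℝ × ℝ → ℝ) (hq : IsWeight q) : F.L2W →ₗ[ℝ] F.L2P :=
  l2Map (fun w x => ∫ v, F.μe x v * q v * w (x, v))
    (F.memLp_avg hq)
    (fun f g => by
      filter_upwards [Measure.ae_ae_of_ae_prod (F.base_ac_measW.ae_le (Lp.coeFn_add f g)),
        (F.integrable_weight hq f).prod_right_ae, (F.integrable_weight hq g).prod_right_ae]
        with x hx hf hg
      rw [Pi.add_apply, ← integral_add hf hg]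
      refine integral_congr_ae ?_
      filter_upwards [hx] with v hv
      simp only [hv, Pi.add_apply, mul_add])
    (fun c f => by
      filter_upwards [Measure.ae_ae_of_ae_prod (F.base_ac_measW.ae_le (Lp.coeFn_smul c f))]
        with x hx
      rw [Pi.smul_apply, smul_eq_mul, ← integral_const_mul]
      refine integral_congr_ae ?_
      filter_upwards [hx] with v hv
      simp only [hv, Pi.smul_apply, smul_eq_mul, mul_left_comm])

/-! ### The coefficients `∫ μ_e dv`, `∫ μ_p dv`, `∫ v₂ μ_p dv` -/

/-- `∫ μ_e dv` -/
def intμe (x : ℝ) : ℝ := ∫ v, F.μe x v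

/-- `∫ μ_p dv` -/
def intμp (x : ℝ) : ℝ := ∫ v, F.μp x v

/-- `∫ v₂ μ_p dv` -/
def intv₂μp (x : ℝ) : ℝ := ∫ v : ℝ × ℝ, v.2 * F.μp x v

lemma bounded_integral {r : ℝ → ℝ × ℝ → ℝ} (hr : ∀ x v, |r x v| ≤
    |F.μe x v| * (1 + v.1 ^ 2 + v.2 ^ 2) + |F.μp x v| * (1 + |v.2|)) :
    ∃ C : ℝ, ∀ x, |∫ v, r x v| ≤ C := by
  obtain ⟨K, hK, h⟩ := F.exists_bound
  refine ⟨K.toReal, fun x => ?_⟩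
  have h1 : ‖∫ v, r x v‖ₑ ≤ K := (enorm_integral_le_lintegral_enorm _).trans
    ((lintegral_mono fun v => by
      rw [Real.enorm_eq_ofReal_abs]
      exact ENNReal.ofReal_le_ofReal (hr x v)).trans (h x))
  rw [Real.enorm_eq_ofReal_abs] at h1
  exact (ENNReal.ofReal_le_iff_le_toReal hK.ne).1 h1

lemma measurable_intμe : Measurable F.intμe :=
  (F.continuous_μe.stronglyMeasurable.integral_prod_right (ν := volume)).measurable

lemma measurable_intμp : Measurable F.intμp :=
  (F.continuous_μp.stronglyMeasurable.integral_prod_right (ν := volume)).measurable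

lemma measurable_intv₂μp : Measurable F.intv₂μp :=
  ((continuous_snd.snd.mul F.continuous_μp).stronglyMeasurable.integral_prod_right
    (ν := volume)).measurable

lemma bounded_intμe : ∃ C : ℝ, ∀ x, |F.intμe x| ≤ C :=
  F.bounded_integral fun x v => by
    nlinarith [abs_nonneg (F.μe x v), abs_nonneg (F.μp x v), abs_nonneg v.2,
      mul_nonneg (abs_nonneg (F.μe x v)) (add_nonneg (sq_nonneg v.1) (sq_nonneg v.2)),
      mul_nonneg (abs_nonneg (F.μp x v)) (abs_nonneg v.2)]

lemma bounded_intμp : ∃ C : ℝ, ∀ x, |F.intμp x| ≤ C :=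
  F.bounded_integral fun x v => by
    nlinarith [abs_nonneg (F.μe x v), abs_nonneg (F.μp x v), abs_nonneg v.2,
      mul_nonneg (abs_nonneg (F.μe x v)) (add_nonneg (sq_nonneg v.1) (sq_nonneg v.2)),
      mul_nonneg (abs_nonneg (F.μp x v)) (abs_nonneg v.2)]

lemma bounded_intv₂μp : ∃ C : ℝ, ∀ x, |F.intv₂μp x| ≤ C :=
  F.bounded_integral fun x v => by
    rw [abs_mul]
    nlinarith [abs_nonneg (F.μe x v), abs_nonneg (F.μp x v), abs_nonneg v.2,
      mul_nonneg (abs_nonneg (F.μe x v)) (add_nonneg (sq_nonneg v.1) (sq_nonneg v.2)),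
      mul_nonneg (abs_nonneg (F.μp x v)) (abs_nonneg v.2)]

/-! ### Periodic Sobolev spaces -/

/-- `w ∈ L²_P` is the weak derivative of `ψ ∈ L²_P` as a `P`-periodic function. -/
def IsWeakDeriv (ψ w : F.L2P) : Prop :=
  ∀ χ : ℝ → ℝ, ContDiff ℝ (⊤ : ℕ∞) χ → Function.Periodic χ F.P →
    ∫ x, ψ x * deriv χ x ∂F.perMeas = -∫ x, w x * χ x ∂F.perMeas

lemma integrable_mul_continuous (f : F.L2P) {κ : ℝ → ℝ} (hκ : Continuous κ) :
    Integrable (fun x => f x * κ x) F.perMeas := by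
  obtain ⟨C, hC⟩ := (isCompact_Icc (a := (0 : ℝ)) (b := F.P)).exists_bound_of_continuousOn
    hκ.continuousOn
  refine ((Lp.memLp f).integrable (by norm_num)).mul_bdd (c := C)
    hκ.aestronglyMeasurable ?_
  exact (ae_restrict_mem measurableSet_Ioc).mono fun x hx => hC x (Ioc_subset_Icc_self hx)

lemma integral_add_mul (f g : F.L2P) {κ : ℝ → ℝ} (hκ : Continuous κ) :
    ∫ x, (f + g : F.L2P) x * κ x ∂F.perMeas
      = ∫ x, f x * κ x ∂F.perMeas + ∫ x, g x * κ x ∂F.perMeas := by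
  rw [← integral_add (F.integrable_mul_continuous f hκ) (F.integrable_mul_continuous g hκ)]
  refine integral_congr_ae ?_
  filter_upwards [Lp.coeFn_add f g] with x hx
  simp only [hx, Pi.add_apply, add_mul]

lemma integral_smul_mul (c : ℝ) (f : F.L2P) (κ : ℝ → ℝ) :
    ∫ x, (c • f : F.L2P) x * κ x ∂F.perMeas = c * ∫ x, f x * κ x ∂F.perMeas := by
  rw [← integral_const_mul]
  refine integral_congr_ae ?_
  filter_upwards [Lp.coeFn_smul c f] with x hx
  simp only [hx, Pi.smul_apply, smul_eq_mul, mul_assoc]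

lemma integral_zero_mul (κ : ℝ → ℝ) : ∫ x, (0 : F.L2P) x * κ x ∂F.perMeas = 0 := by
  simpa using F.integral_smul_mul 0 0 κ

lemma IsWeakDeriv.zero : F.IsWeakDeriv 0 0 := fun χ _ _ => by
  rw [F.integral_zero_mul, F.integral_zero_mul, neg_zero]

variable {F} in
lemma IsWeakDeriv.add {ψ w ψ' w' : F.L2P} (h : F.IsWeakDeriv ψ w) (h' : F.IsWeakDeriv ψ' w') :
    F.IsWeakDeriv (ψ + ψ') (w + w') := fun χ hχ hp => by
  rw [F.integral_add_mul _ _ (hχ.continuous_deriv (by simp)),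
    F.integral_add_mul _ _ hχ.continuous, h χ hχ hp, h' χ hχ hp]
  ring

variable {F} in
lemma IsWeakDeriv.smul {ψ w : F.L2P} (c : ℝ) (h : F.IsWeakDeriv ψ w) :
    F.IsWeakDeriv (c • ψ) (c • w) := fun χ hχ hp => by
  rw [F.integral_smul_mul, F.integral_smul_mul, h χ hχ hp]
  ring

/-- `H¹_P`, as the space of the pairs `(ψ, ψ')` in `L²_P × L²_P`. The norm is equivalent to the
usual one, so the topology is that of `H¹`. -/
def H1P : Submodule ℝ (F.L2P × F.L2P) where
  carrier := {u | F.IsWeakDeriv u.1 u.2}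
  zero_mem' := IsWeakDeriv.zero F
  add_mem' := fun h h' => IsWeakDeriv.add h h'
  smul_mem' := fun c _ h => IsWeakDeriv.smul c h

/-- `H²_P`, as the space of the triples `(ψ, ψ', ψ'')` in `L²_P × L²_P × L²_P`. -/
def H2P : Submodule ℝ (F.L2P × F.L2P × F.L2P) where
  carrier := {u | F.IsWeakDeriv u.1 u.2.1 ∧ F.IsWeakDeriv u.2.1 u.2.2}
  zero_mem' := ⟨IsWeakDeriv.zero F, IsWeakDeriv.zero F⟩
  add_mem' := fun h h' => ⟨IsWeakDeriv.add h.1 h'.1, IsWeakDeriv.add h.2 h'.2⟩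
  smul_mem' := fun c _ h => ⟨IsWeakDeriv.smul c h.1, IsWeakDeriv.smul c h.2⟩

/-- The inclusion `H²_P → L²_P`. -/
def toL2 : F.H2P →ₗ[ℝ] F.L2P := LinearMap.fst ℝ _ _ ∘ₗ F.H2P.subtype

/-- The second derivative `H²_P → L²_P`. -/
def deriv2 : F.H2P →ₗ[ℝ] F.L2P :=
  LinearMap.snd ℝ _ _ ∘ₗ LinearMap.snd ℝ _ _ ∘ₗ F.H2P.subtype

/-! ### The transport operator -/

/-- Test functions on phase space: smooth, `P`-periodic in `x`, of bounded support in `v`. -/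
structure IsTest (χ : ℝ × ℝ × ℝ → ℝ) : Prop where
  contDiff : ContDiff ℝ (⊤ : ℕ∞) χ
  periodic : ∀ x v, χ (x + F.P, v) = χ (x, v)
  support : ∃ R : ℝ, ∀ x v, R < ‖v‖ → χ (x, v) = 0

/-- The action `D χ = v₁ ∂ₓ χ + ∂ₓφ⁰ ∂_{v₁} χ + ∂ₓψ⁰ (v₁ ∂_{v₂} χ - v₂ ∂_{v₁} χ)` of the transport
operator on differentiable functions. -/
def transport (χ : ℝ × ℝ × ℝ → ℝ) (z : ℝ × ℝ × ℝ) : ℝ :=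
  z.2.1 * fderiv ℝ χ z (1, 0, 0) + deriv F.φ₀ z.1 * fderiv ℝ χ z (0, 1, 0)
    + deriv F.ψ₀ z.1 * (z.2.1 * fderiv ℝ χ z (0, 0, 1) - z.2.2 * fderiv ℝ χ z (0, 1, 0))

/-- `D h = w` in the sense of distributions (the vector field of `D` has divergence zero). -/
def IsTransport (h w : F.L2W) : Prop :=
  ∀ χ : ℝ × ℝ × ℝ → ℝ, F.IsTest χ →
    ∫ z, h z * F.transport χ z ∂F.base = -∫ z, w z * χ z ∂F.base

/-- Pairing with a continuous function of bounded support in `v` is continuous on `L²_{|μ_e|}`. -/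
lemma exists_inner_eq {κ : ℝ × ℝ × ℝ → ℝ} (hκ : Continuous κ)
    (hs : ∃ R : ℝ, ∀ x v, R < ‖v‖ → κ (x, v) = 0) :
    ∃ k : F.L2W, ∀ h : F.L2W, ∫ z, h z * κ z ∂F.base = inner ℝ k h := by
  obtain ⟨R, hR⟩ := hs
  have hc : Continuous fun z : ℝ × ℝ × ℝ => κ z / |F.μe z.1 z.2| :=
    hκ.div F.continuous_μe.abs fun z => abs_ne_zero.2 (F.μe_lt z.1 z.2).ne
  obtain ⟨C, hC⟩ := ((isCompact_Icc (a := (0 : ℝ)) (b := F.P)).prod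
    (isCompact_closedBall (0 : ℝ × ℝ) R)).exists_bound_of_continuousOn hc.continuousOn
  have hx : ∀ᵐ z ∂F.base, z.1 ∈ Ioc 0 F.P :=
    Measure.quasiMeasurePreserving_fst.ae (ae_restrict_mem measurableSet_Ioc)
  have hk : MemLp (fun z : ℝ × ℝ × ℝ => κ z / |F.μe z.1 z.2|) 2 F.measW := by
    refine MemLp.of_bound hc.aestronglyMeasurable (max C 0) ?_
    filter_upwards [F.measW_ac_base.ae_le hx] with z hz
    by_cases hv : ‖z.2‖ ≤ R
    · exact (hC z ⟨Ioc_subset_Icc_self hz, by simpa using hv⟩).trans (le_max_left _ _)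
    · have h0 : κ z = 0 := hR z.1 z.2 (not_le.1 hv)
      simp [h0]
  refine ⟨hk.toLp _, fun h => ?_⟩
  rw [L2.inner_def]
  have e : ∀ᵐ z ∂F.measW, inner ℝ (hk.toLp _ z) (h z) = h z * (κ z / |F.μe z.1 z.2|) := by
    filter_upwards [hk.coeFn_toLp] with z hz
    rw [hz, real_inner_eq_re_inner, RCLike.inner_apply]
    simp
  rw [integral_congr_ae e, F.integral_measW]
  refine integral_congr_ae (.of_forall fun z => ?_)
  have h0 : |F.μe z.1 z.2| ≠ 0 := abs_ne_zero.2 (F.μe_lt z.1 z.2).ne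
  field_simp

lemma continuous_transport {χ : ℝ × ℝ × ℝ → ℝ} (hχ : F.IsTest χ) :
    Continuous (F.transport χ) := by
  have h1 : Continuous (deriv F.φ₀) := F.φ₀_contDiff.continuous_deriv (by norm_num)
  have h2 : Continuous (deriv F.ψ₀) := F.ψ₀_contDiff.continuous_deriv (by norm_num)
  have h3 : Continuous (fderiv ℝ χ) := hχ.contDiff.continuous_fderiv (by simp)
  have h4 : ∀ a, Continuous fun z => fderiv ℝ χ z a := fun a => h3.clm_apply continuous_const
  unfold transport
  have := h4 (1, 0, 0)
  have := h4 (0, 1, 0)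
  have := h4 (0, 0, 1)
  fun_prop

lemma support_transport {χ : ℝ × ℝ × ℝ → ℝ} (hχ : F.IsTest χ) :
    ∃ R : ℝ, ∀ x v, R < ‖v‖ → F.transport χ (x, v) = 0 := by
  obtain ⟨R, hR⟩ := hχ.support
  refine ⟨R, fun x v hv => ?_⟩
  have h : χ =ᶠ[nhds (x, v)] fun _ => 0 := by
    have : ∀ᶠ z : ℝ × ℝ × ℝ in nhds (x, v), R < ‖z.2‖ :=
      (continuous_snd.norm.continuousAt (x := (x, v))).eventually_const_lt hv
    exact this.mono fun z hz => hR z.1 z.2 hz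
  have h' : fderiv ℝ χ (x, v) = 0 := by rw [h.fderiv_eq]; simp
  simp [transport, h']

lemma exists_isTransport_iff : ∃ (k : {χ // F.IsTest χ} → F.L2W × F.L2W), ∀ h w,
    F.IsTransport h w ↔ ∀ χ, inner ℝ (k χ).1 h = -inner ℝ (k χ).2 w := by
  choose k hk using fun χ : {χ // F.IsTest χ} =>
    F.exists_inner_eq (F.continuous_transport χ.2) (F.support_transport χ.2)
  choose l hl using fun χ : {χ // F.IsTest χ} =>
    F.exists_inner_eq χ.2.contDiff.continuous χ.2.support
  refine ⟨fun χ => (k χ, l χ), fun h w => ?_⟩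
  simp only [IsTransport, Subtype.forall, ← hk, ← hl]

/-- The graph `{(h, D h)}` of the transport operator `D` in `L²_{|μ_e|}`, with its maximal domain
`{h ∈ L²_{|μ_e|} | D h ∈ L²_{|μ_e|}}`. -/
def transportGraph : Submodule ℝ (F.L2W × F.L2W) where
  carrier := {u | F.IsTransport u.1 u.2}
  zero_mem' := by
    obtain ⟨k, hk⟩ := F.exists_isTransport_iff
    exact (hk _ _).2 fun χ => by simp
  add_mem' := fun {a b} ha hb => by
    obtain ⟨k, hk⟩ := F.exists_isTransport_iff
    refine (hk _ _).2 fun χ => ?_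
    simp only [Prod.fst_add, Prod.snd_add, inner_add_right, (hk _ _).1 ha χ, (hk _ _).1 hb χ]
    ring
  smul_mem' := fun c a ha => by
    obtain ⟨k, hk⟩ := F.exists_isTransport_iff
    refine (hk _ _).2 fun χ => ?_
    simp only [Prod.smul_fst, Prod.smul_snd, real_inner_smul_right, (hk _ _).1 ha χ]
    ring

/-- `ker D ⊆ L²_{|μ_e|}` -/
def kerD : Submodule ℝ F.L2W := F.transportGraph.comap (LinearMap.inl ℝ F.L2W F.L2W)

lemma isClosed_kerD : IsClosed (F.kerD : Set F.L2W) := by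
  obtain ⟨k, hk⟩ := F.exists_isTransport_iff
  have : (F.kerD : Set F.L2W) = ⋂ χ, {h | inner ℝ (k χ).1 h = 0} := by
    ext h
    rw [mem_iInter]
    refine (hk h 0).trans (forall_congr' fun χ => ?_)
    simp
  rw [this]
  exact isClosed_iInter fun χ => isClosed_eq (by fun_prop) continuous_const

instance : CompleteSpace F.kerD := F.isClosed_kerD.completeSpace_coe

/-- The orthogonal projection `𝒫` of `L²_{|μ_e|}` onto `ker D`. -/
def proj : F.L2W →ₗ[ℝ] F.L2W := (F.kerD.starProjection : F.L2W →L[ℝ] F.L2W)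

/-! ### The operators `L` and `B` -/

/-- `X_ev`, the elements of `L²_{1/|μ_e|}` that are even in `v₁`. -/
def Xev : Submodule ℝ F.L2Inv where
  carrier := {g | ∃ r : ℝ × ℝ × ℝ → ℝ, (∀ x v₁ v₂, r (x, -v₁, v₂) = r (x, v₁, v₂)) ∧
    g =ᵐ[F.measInv] r}
  zero_mem' := ⟨0, fun _ _ _ => rfl, Lp.coeFn_zero _ _ _⟩
  add_mem' := by
    rintro f g ⟨r, hr, h⟩ ⟨s, hs, h'⟩
    exact ⟨r + s, fun x v₁ v₂ => by simp [hr, hs], (Lp.coeFn_add f g).trans (h.add h')⟩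
  smul_mem' := by
    rintro c f ⟨r, hr, h⟩
    exact ⟨c • r, fun x v₁ v₂ => by simp [hr], (Lp.coeFn_smul c f).trans (h.const_smul c)⟩

/-- The elements of `L²_{|μ_e|}` that are odd in `v₁`. Through the pairing `∫∫ f h dx dv`, this is
the dual space of `X_od`, the space of the elements of `L²_{1/|μ_e|}` that are odd in `v₁`. -/
def XodDual : Submodule ℝ F.L2W where
  carrier := {g | ∃ r : ℝ × ℝ × ℝ → ℝ, (∀ x v₁ v₂, r (x, -v₁, v₂) = -r (x, v₁, v₂)) ∧
    g =ᵐ[F.measW] r}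
  zero_mem' := ⟨0, fun _ _ _ => by simp, Lp.coeFn_zero _ _ _⟩
  add_mem' := by
    rintro f g ⟨r, hr, h⟩ ⟨s, hs, h'⟩
    exact ⟨r + s, fun x v₁ v₂ => by simp [hr, hs]; ring, (Lp.coeFn_add f g).trans (h.add h')⟩
  smul_mem' := by
    rintro c f ⟨r, hr, h⟩
    exact ⟨c • r, fun x v₁ v₂ => by simp [hr], (Lp.coeFn_smul c f).trans (h.const_smul c)⟩

/-- `X = X_ev × L²_P × H¹_P`, with elements `u = (g_ev, E₁, ψ)`. -/
abbrev X : Type := F.Xev × F.L2P × F.H1P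

/-- `Y* = X_od* × L²_P`, the dual space of `Y = X_od × L²_P`. -/
abbrev YDual : Type := F.XodDual × F.L2P

/-- The component `g_ev`, as an element of `L²_{1/|μ_e|}`. -/
def gComp : F.X →ₗ[ℝ] F.L2Inv := F.Xev.subtype ∘ₗ LinearMap.fst ℝ _ _

/-- The component `E₁`. -/
def EComp : F.X →ₗ[ℝ] F.L2P := LinearMap.fst ℝ _ _ ∘ₗ LinearMap.snd ℝ _ _

/-- The component `ψ`, as an element of `L²_P`. -/
def ψComp : F.X →ₗ[ℝ] F.L2P :=
  LinearMap.fst ℝ _ _ ∘ₗ F.H1P.subtype ∘ₗ LinearMap.snd ℝ _ _ ∘ₗ LinearMap.snd ℝ _ _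

/-- The derivative `ψ'` of the component `ψ`. -/
def ψComp' : F.X →ₗ[ℝ] F.L2P :=
  LinearMap.snd ℝ _ _ ∘ₗ F.H1P.subtype ∘ₗ LinearMap.snd ℝ _ _ ∘ₗ LinearMap.snd ℝ _ _

/-- The symmetric form `⟨L u, w⟩ = ∫∫ |μ_e|⁻¹ g_ev(u) g_ev(w) dv dx + ∫ E₁(u) E₁(w) dx
+ ∫ ψ(u)' ψ(w)' dx - ∫ (∫ v₂ μ_p dv) ψ(u) ψ(w) dx` on `X`, where
`L = diag(-1/μ_e, I, -d²/dx² - ∫ v₂ μ_p dv) : X → X*`. -/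
def formL : F.X →ₗ[ℝ] F.X →ₗ[ℝ] ℝ :=
  (innerₗ F.L2Inv).compl₁₂ F.gComp F.gComp + (innerₗ F.L2P).compl₁₂ F.EComp F.EComp
    + (innerₗ F.L2P).compl₁₂ F.ψComp' F.ψComp'
    - (innerₗ F.L2P).compl₁₂
      (F.mulOp F.intv₂μp F.measurable_intv₂μp F.bounded_intv₂μp ∘ₗ F.ψComp) F.ψComp

/-- The graph of `B : Y* ⊇ D(B) → X`,
`B (h, E) = (μ_e D h + μ_e v₂ E, -∫ μ_e v₁ h dv, -E)`, with its maximal domain. -/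
def graphB : Submodule ℝ (F.YDual × F.X) where
  carrier := {z | ∃ w : F.L2W, ((z.1.1 : F.L2W), w) ∈ F.transportGraph ∧
    F.gComp z.2 = F.mulμe w + F.mulμe (F.lift (fun v => v.2) isWeight_snd z.1.2) ∧
    F.EComp z.2 = -F.avg (fun v => v.1) isWeight_fst z.1.1 ∧
    F.ψComp z.2 = -z.1.2}
  zero_mem' := ⟨0, F.transportGraph.zero_mem, by simp⟩
  add_mem' := by
    rintro a b ⟨w, h1, h2, h3, h4⟩ ⟨w', h1', h2', h3', h4'⟩
    refine ⟨w + w', F.transportGraph.add_mem h1 h1', ?_, ?_, ?_⟩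
    · simp only [Prod.snd_add, Prod.fst_add, map_add, h2, h2']; abel
    · simp only [Prod.snd_add, Prod.fst_add, map_add, h3, h3', Submodule.coe_add]; abel
    · simp only [Prod.snd_add, Prod.fst_add, map_add, h4, h4']; abel
  smul_mem' := by
    rintro c a ⟨w, h1, h2, h3, h4⟩
    refine ⟨c • w, F.transportGraph.smul_mem c h1, ?_, ?_, ?_⟩
    · simp only [Prod.smul_snd, Prod.smul_fst, map_smul, h2, smul_add]
    · simp only [Prod.smul_snd, Prod.smul_fst, map_smul, h3, Submodule.coe_smul, smul_neg]
    · simp only [Prod.smul_snd, Prod.smul_fst, map_smul, h4, smul_neg]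

/-- The closure in `X` of the range `R(B)`. -/
def closureRangeB : Submodule ℝ F.X :=
  (F.graphB.map (LinearMap.snd ℝ F.YDual F.X)).topologicalClosure

/-! ### The operators on functions of `x` -/

/-- `𝒜₁⁰ h = -∂ₓ² h - (∫ μ_e dv) h + ∫ μ_e 𝒫 h dv` -/
def A1 : F.H2P →ₗ[ℝ] F.L2P :=
  -F.deriv2 - F.mulOp F.intμe F.measurable_intμe F.bounded_intμe ∘ₗ F.toL2
    + F.avg (fun _ => 1) isWeight_one ∘ₗ F.proj ∘ₗ F.lift (fun _ => 1) isWeight_one ∘ₗ F.toL2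

/-- `𝒜₂⁰ h = -∂ₓ² h - (∫ v₂ μ_p dv) h - ∫ μ_e v₂ 𝒫(v₂ h) dv` -/
def A2 : F.H2P →ₗ[ℝ] F.L2P :=
  -F.deriv2 - F.mulOp F.intv₂μp F.measurable_intv₂μp F.bounded_intv₂μp ∘ₗ F.toL2
    - F.avg (fun v => v.2) isWeight_snd ∘ₗ F.proj ∘ₗ F.lift (fun v => v.2) isWeight_snd ∘ₗ F.toL2

/-- `ℬ⁰ h = (∫ μ_p dv) h + ∫ μ_e 𝒫(v₂ h) dv` -/
def B0 : F.L2P →ₗ[ℝ] F.L2P :=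
  F.mulOp F.intμp F.measurable_intμp F.bounded_intμp
    + F.avg (fun _ => 1) isWeight_one ∘ₗ F.proj ∘ₗ F.lift (fun v => v.2) isWeight_snd

/-- `(ℬ⁰)* h = (∫ μ_p dv) h + ∫ v₂ μ_e 𝒫 h dv` -/
def B0star : F.L2P →ₗ[ℝ] F.L2P :=
  F.mulOp F.intμp F.measurable_intμp F.bounded_intμp
    + F.avg (fun v => v.2) isWeight_snd ∘ₗ F.proj ∘ₗ F.lift (fun _ => 1) isWeight_one

/-- The integral over one period. -/
def perInt : F.L2P →ₗ[ℝ] ℝ where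
  toFun f := ∫ x, f x ∂F.perMeas
  map_add' f g := by
    simpa using F.integral_add_mul f g (κ := fun _ => 1) continuous_const
  map_smul' c f := by
    simpa using F.integral_smul_mul c f (fun _ => 1)

/-- `φ = (𝒜₁⁰)⁻¹ k`. The kernel of `𝒜₁⁰` consists of the constants, and the inverse is that of
`𝒜₁⁰` on the functions of mean zero. -/
def IsA1Inv (k : F.L2P) (φ : F.H2P) : Prop := F.perInt (F.toL2 φ) = 0 ∧ F.A1 φ = k

/-- The graph of `ℒ⁰ = (ℬ⁰)* (𝒜₁⁰)⁻¹ ℬ⁰ + 𝒜₂⁰ : H²_P → L²_P`. -/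
def graphL0 : Submodule ℝ (F.H2P × F.L2P) where
  carrier := {z | ∃ φ : F.H2P, F.IsA1Inv (F.B0 (F.toL2 z.1)) φ ∧
    z.2 = F.B0star (F.toL2 φ) + F.A2 z.1}
  zero_mem' := ⟨0, ⟨by simp, by simp⟩, by simp⟩
  add_mem' := by
    rintro a b ⟨φ, ⟨h1, h2⟩, h3⟩ ⟨φ', ⟨h1', h2'⟩, h3'⟩
    refine ⟨φ + φ', ⟨?_, ?_⟩, ?_⟩
    · simp only [map_add, h1, h1', add_zero]
    · simp only [map_add, h2, h2', Prod.fst_add]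
    · simp only [Prod.snd_add, Prod.fst_add, map_add, h3, h3']; abel
  smul_mem' := by
    rintro c a ⟨φ, ⟨h1, h2⟩, h3⟩
    refine ⟨c • φ, ⟨?_, ?_⟩, ?_⟩
    · simp only [map_smul, h1, smul_zero]
    · simp only [map_smul, h2, Prod.smul_fst]
    · simp only [Prod.smul_snd, Prod.smul_fst, map_smul, h3, smul_add]

/-- The eigenspace `ker (ℒ⁰ - lam) ⊆ H²_P`. -/
def eigenspaceL0 (lam : ℝ) : Submodule ℝ F.H2P :=
  F.graphL0.comap (LinearMap.id.prod (lam • F.toL2))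

/-- The number of negative eigenvalues of `ℒ⁰`, counted with their multiplicities: the dimension
of the (direct) sum of the eigenspaces. -/
def negEigenvalueCount : ℕ∞ :=
  Cardinal.toENat (Module.rank ℝ (⨆ lam : {t : ℝ // t < 0}, F.eigenspaceL0 lam : Submodule ℝ F.H2P))

end Equilibrium

end VlasovMaxwell

end

/-! The proof eliminates everything except `ψ` from the form `⟨Lu, u⟩` and then compares the reduced
form on `H¹_P` with the spectrum of `ℒ⁰`.

The range of `B`. For `u = (g, E₁, ψ)` put `γ = g / μ_e` and `δ = γ + v₂ ψ`. If `u = B(h, E)`, then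
`δ = D h`, so `𝒫 δ = 0`, and integrating `D h` over velocities gives the continuity equation `∂ₓE₁ =
-∫ μ_e δ dv`. Both conditions are closed, and together they describe the closure of the range
exactly (`closureRangeB_eq`). The nontrivial inclusion is a duality argument. If `(k, e)`
annihilates all pairs `(D h, -∫ μ_e v₁ h dv)` with `h` odd and `D h` even, then the even part `k'`
of `k` satisfies `D k' = v₁ e`. Subtracting a primitive of `e - mean e` leaves a constant multiple
of `v₁` in the range of `D`. That constant is zero because `ker D` contains a function with the sign
of `v₁` (`exists_invariant`, `eq_zero_of_smul_mem_transportGraph`). Hence `k'` is a primitive of `e`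
plus an element of `ker D`, and it pairs correctly with the two conditions.

All this rests on the skew-adjointness of `D` with its maximal domain (`mem_transportGraph_iff`).
Symmetry is a Friedrichs commutator argument: variables are doubled with a periodic kernel, whose
derivative is of size `r` while the vector field varies by `O(1/r)` on its support, so the
commutators are uniformly bounded by Schur's test and tend to zero because they do so on test
functions. The weight `|μ_e|` and the cutoffs in energy are functions of the invariants `(e, p)`;
they commute with `D` even when they are only continuous, so no error terms arise from them.

Reduction. For given `ψ` the form is minimized on the closed range by `γ = -𝒫(v₂ψ) - (1 - 𝒫)φ`, `E₁
= -φ'` with `φ = (𝒜₁⁰)⁻¹ℬ⁰ψ`, and the minimum is the form of `ℒ⁰` at `ψ`. `formL_eq` says that `L`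
is this reduced form plus the squared norms of the deviations of `γ` and `E₁` from the minimizer.
Therefore `L` and the reduced form have equal negative index (`negIndex_formL`) and kernels of equal
dimension (`rank_formKer`). The identity `∫ μ_p dv = -∫ v₂ μ_e dv` makes `ℬ⁰` fit: it replaces `𝒫`
by `1 - 𝒫`. Solvability and uniqueness for `𝒜₁⁰` on functions of mean zero come from Lax-Milgram,
since `𝒜₁⁰ ≥ -∂ₓ²`.

Spectral theory. The coordinate `f = ψ' + mean ψ` identifies `H¹_P` with `L²_P`. It turns the
reduced form into a bounded symmetric operator `redOp` and the inclusion into `L²_P` into a compact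
injective operator `primitive`. The form is coercive up to a multiple of `‖primitive f‖²`, so its
negative index is the dimension of the span of the generalized eigenvectors with negative eigenvalue
(`negIndex_opForm_eq`). Weak eigenvectors are in `H²_P`, hence these are the eigenfunctions of `ℒ⁰`
(`map_eigenspaceL0`). -/

noncomputable section

namespace VlasovMaxwell

/-! ### Negative indices -/

section NegIndex

variable {E E' : Type*} [AddCommGroup E] [Module ℝ E] [AddCommGroup E'] [Module ℝ E']

lemma le_negIndex {V S : Submodule ℝ E} {q : E → ℝ} (hS : S ≤ V)
    (hq : ∀ u ∈ S, u ≠ 0 → q u < 0) : Cardinal.toENat (Module.rank ℝ S) ≤ negIndex V q :=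
  le_iSup (fun S : {S : Submodule ℝ E // S ≤ V ∧ ∀ u ∈ S, u ≠ 0 → q u < 0} =>
    Cardinal.toENat (Module.rank ℝ S.1)) ⟨S, hS, hq⟩

/-- The two spaces may live in different universes; after `toENat` the cardinal lifts disappear. -/
lemma toENat_rank_map_of_injOn (f : E →ₗ[ℝ] E') (S : Submodule ℝ E)
    (hf : ∀ u ∈ S, f u = 0 → u = 0) :
    Cardinal.toENat (Module.rank ℝ (S.map f)) = Cardinal.toENat (Module.rank ℝ S) := by
  have hinj : Function.Injective (f.domRestrict S) := by
    rw [← LinearMap.ker_eq_bot, LinearMap.ker_eq_bot']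
    exact fun u hu => Subtype.ext (hf u u.2 hu)
  have e := LinearEquiv.ofInjective _ hinj
  have hr : LinearMap.range (f.domRestrict S) = S.map f := by
    rw [LinearMap.domRestrict, LinearMap.range_comp, Submodule.range_subtype]
  rw [← hr]
  have := e.lift_rank_eq
  have h2 := congrArg Cardinal.toENat this
  rwa [Cardinal.toENat_lift, Cardinal.toENat_lift, eq_comm] at h2

/-- A subspace on which `q` is negative meets the kernel of `f` only in `0`, so `f` maps it
injectively, and its image is negative for `q'`. Comparison of indices in either direction only
needs such a map. -/
lemma negIndex_le_negIndex {V : Submodule ℝ E} {V' : Submodule ℝ E'} {q : E → ℝ} {q' : E' → ℝ}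
    (f : E →ₗ[ℝ] E') (hf : ∀ u ∈ V, f u ∈ V') (hq : ∀ u ∈ V, q' (f u) ≤ q u)
    (h0 : ∀ u ∈ V, f u = 0 → 0 ≤ q u) : negIndex V q ≤ negIndex V' q' := by
  refine iSup_le fun ⟨S, hSV, hS⟩ => ?_
  rw [← toENat_rank_map_of_injOn f S fun u hu hfu => by
    by_contra hne
    exact (hS u hu hne).not_ge (h0 u (hSV hu) hfu)]
  refine le_negIndex ?_ ?_
  · rintro _ ⟨u, hu, rfl⟩
    exact hf u (hSV hu)
  · rintro _ ⟨u, hu, rfl⟩ hne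
    exact (hq u (hSV hu)).trans_lt (hS u hu fun h => hne (by simp [h]))

end NegIndex

/-! ### Sums of generalized eigenspaces of a pair of symmetric forms -/

section Pencil

variable {E : Type*} [AddCommGroup E] [Module ℝ E]

/-- The vectors `f` with `b f = lam • s f`. -/
def pencilEigenspace (b s : E →ₗ[ℝ] E →ₗ[ℝ] ℝ) (lam : ℝ) : Submodule ℝ E :=
  LinearMap.ker (b - lam • s)

lemma mem_pencilEigenspace {b s : E →ₗ[ℝ] E →ₗ[ℝ] ℝ} {lam : ℝ} {f : E} :
    f ∈ pencilEigenspace b s lam ↔ ∀ g, b f g = lam * s f g := by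
  simp only [pencilEigenspace, LinearMap.mem_ker, LinearMap.sub_apply, LinearMap.smul_apply,
    LinearMap.ext_iff, sub_eq_zero, smul_eq_mul]

/-- Symmetry of both forms makes eigenvectors with different `lam` orthogonal for `s`, hence for
`b`, so both forms are diagonal on the sum. No positivity of `s` is needed. -/
lemma exists_pencil_decomposition {b s : E →ₗ[ℝ] E →ₗ[ℝ] ℝ} (hb : ∀ f g, b f g = b g f)
    (hs : ∀ f g, s f g = s g f) {ι : Type*} {lam : ι → ℝ} (hlam : Function.Injective lam) {f : E}
    (hf : f ∈ ⨆ i, pencilEigenspace b s (lam i)) :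
    ∃ (t : Finset ι) (v : ι → E), f = ∑ i ∈ t, v i ∧
      (∀ i, v i ∈ pencilEigenspace b s (lam i)) ∧
      b f f = ∑ i ∈ t, lam i * s (v i) (v i) ∧ s f f = ∑ i ∈ t, s (v i) (v i) := by
  classical
  obtain ⟨v, hv, rfl⟩ := (Submodule.mem_iSup_iff_exists_finsupp _ _).1 hf
  have hv' := fun i => mem_pencilEigenspace.1 (hv i)
  have horth : ∀ i j, i ≠ j → s (v i) (v j) = 0 := fun i j hij => by
    have h1 := hv' i (v j)
    have h2 := hv' j (v i)
    rw [hb, h1, hs (v j)] at h2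
    have h3 : (lam i - lam j) * s (v i) (v j) = 0 := by linarith
    exact (mul_eq_zero.1 h3).resolve_left (sub_ne_zero.2 fun h => hij (hlam h))
  refine ⟨v.support, v, rfl, hv, ?_, ?_⟩
  · simp only [Finsupp.sum, map_sum, LinearMap.sum_apply]
    refine Finset.sum_congr rfl fun i hi => ?_
    rw [Finset.sum_eq_single i, hv' i]
    · intro j _ hj
      rw [hv' j, horth j i hj, mul_zero]
    · exact fun h => (h hi).elim
  · simp only [Finsupp.sum, map_sum, LinearMap.sum_apply]
    refine Finset.sum_congr rfl fun i hi => ?_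
    rw [Finset.sum_eq_single i]
    · intro j _ hj
      rw [horth j i hj]
    · exact fun h => (h hi).elim

end Pencil

/-! ### Operators on Hilbert spaces -/

section Hilbert

variable {E F : Type*} [NormedAddCommGroup E] [InnerProductSpace ℝ E] [CompleteSpace E]
  [NormedAddCommGroup F] [InnerProductSpace ℝ F] [CompleteSpace F]

/-- Hellinger-Toeplitz: the adjoint relation exhibits the graph as an intersection of closed sets,
and the closed graph theorem applies. -/
lemma continuous_of_formal_adjoint (T : E →ₗ[ℝ] F) (S : F → E)
    (h : ∀ x y, inner ℝ (T x) y = inner ℝ x (S y)) : Continuous T := by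
  refine T.continuous_of_isClosed_graph ?_
  have : (T.graph : Set (E × F)) = ⋂ y, {p | inner ℝ p.2 y = inner ℝ p.1 (S y)} := by
    ext ⟨x, z⟩
    simp only [SetLike.mem_coe, LinearMap.mem_graph_iff, mem_iInter, mem_ofPred_eq]
    exact ⟨fun hz y => by rw [hz, h], fun hz => ext_inner_right ℝ fun y => by rw [hz, h]⟩
  rw [this]
  exact isClosed_iInter fun y => isClosed_eq (by fun_prop) (by fun_prop)

/-- Lax-Milgram, with coercivity constant `1`. -/
lemma exists_inverse_of_le_inner (A : E →L[ℝ] E) (hA : ∀ f, ‖f‖ ^ 2 ≤ inner ℝ (A f) f) :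
    ∃ e : E ≃L[ℝ] E, ∀ f, e f = A f := by
  have hco : IsCoercive ((innerSL ℝ).comp A) := by
    refine ⟨1, one_pos, fun u => ?_⟩
    have := hA u
    simp only [ContinuousLinearMap.comp_apply, innerSL_apply_apply]
    nlinarith
  refine ⟨hco.continuousLinearEquivOfBilin, fun f => ext_inner_right ℝ fun g => ?_⟩
  rw [hco.continuousLinearEquivOfBilin_apply]
  simp

/-- A compact symmetric operator without eigenvalues above `c` is bounded above by `c`. -/
lemma inner_le_of_compact (T : E →L[ℝ] E) (hT : IsCompactOperator T)
    (hs : (T : E →ₗ[ℝ] E).IsSymmetric) (c : ℝ) (h : ∀ (μ : ℝ) (f : E), T f = μ • f → f ≠ 0 → μ ≤ c)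
    (f : E) : inner ℝ (T f) f ≤ c * ‖f‖ ^ 2 := by
  have hd : Dense ((⨆ μ, Module.End.eigenspace (T : E →ₗ[ℝ] E) μ : Submodule ℝ E) : Set E) := by
    rw [Submodule.dense_iff_topologicalClosure_eq_top,
      Submodule.topologicalClosure_eq_top_iff]
    exact ContinuousLinearMap.orthogonalComplement_iSup_eigenspaces_eq_bot hT hs
  -- The inequality is a closed condition, so it suffices to check it on the dense sum of the
  -- eigenspaces.
  have hcl : IsClosed {f : E | inner ℝ (T f) f ≤ c * ‖f‖ ^ 2} :=
    isClosed_le (by fun_prop) (by fun_prop)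
  refine hcl.closure_subset_iff.2 ?_ (hd f)
  intro f hf
  -- Eigenspaces of `T` are those of the pencil `(⟨T·,·⟩, ⟨·,·⟩)`, so the diagonalization of pencils
  -- applies.
  have heq : ∀ μ : ℝ, Module.End.eigenspace (T : E →ₗ[ℝ] E) μ
      = pencilEigenspace (innerₗ E ∘ₗ (T : E →ₗ[ℝ] E)) (innerₗ E) μ := fun μ => by
    ext f
    rw [Module.End.mem_eigenspace_iff, mem_pencilEigenspace]
    refine ⟨fun h g => ?_, fun h => ext_inner_right ℝ fun g => ?_⟩
    · simp only [LinearMap.comp_apply, h, innerₗ_apply_apply, real_inner_smul_left]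
    · rw [real_inner_smul_left]
      exact h g
  have hf' : f ∈ ⨆ μ : ℝ, pencilEigenspace (innerₗ E ∘ₗ (T : E →ₗ[ℝ] E)) (innerₗ E) (id μ) := by
    simp only [heq] at hf
    exact hf
  obtain ⟨t, v, -, hv, h1, h2⟩ := exists_pencil_decomposition
    (fun f g => by
      simp only [LinearMap.comp_apply, innerₗ_apply_apply]
      rw [real_inner_comm]
      exact (hs g f).symm)
    (fun f g => by simp only [innerₗ_apply_apply, real_inner_comm]) Function.injective_id hf'
  simp only [LinearMap.comp_apply, innerₗ_apply_apply, real_inner_self_eq_norm_sq, id_eq,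
    ContinuousLinearMap.coe_coe] at h1 h2
  rw [mem_ofPred_eq, h1, h2, Finset.mul_sum]
  refine Finset.sum_le_sum fun μ _ => ?_
  by_cases h0 : v μ = 0
  · simp [h0]
  · refine mul_le_mul_of_nonneg_right (h μ (v μ) ?_ h0) (sq_nonneg _)
    have := hv μ
    rwa [id_eq, ← heq, Module.End.mem_eigenspace_iff] at this

end Hilbert

/-! ### Forms that are coercive modulo a compact injection -/

section Form

variable {E : Type*} [NormedAddCommGroup E] [InnerProductSpace ℝ E] {A J : E →L[ℝ] E}

/-- The form `⟨A f, g⟩`. -/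
def opForm (A : E →L[ℝ] E) : E →ₗ[ℝ] E →ₗ[ℝ] ℝ := innerₗ E ∘ₗ (A : E →ₗ[ℝ] E)

@[simp] lemma opForm_apply (A : E →L[ℝ] E) (f g : E) : opForm A f g = inner ℝ (A f) g := rfl

/-- The sum of the spaces of `f` with `A f = lam • J† J f`, over all `lam < 0`. -/
def negPencilSpace (A J : E →L[ℝ] E) : Submodule ℝ E :=
  ⨆ lam : {t : ℝ // t < 0}, pencilEigenspace (opForm A) ((innerₗ E).compl₁₂ (J : E →ₗ[ℝ] E) J) lam

/-- The form is diagonal with entries `lam ‖J v‖²`, `lam < 0`; it can only vanish if every `J v`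
does, which injectivity excludes. -/
lemma inner_neg_of_mem_negPencilSpace (hA : (A : E →ₗ[ℝ] E).IsSymmetric)
    (hJ : Function.Injective J) {f : E} (hf : f ∈ negPencilSpace A J) (hne : f ≠ 0) :
    inner ℝ (A f) f < 0 := by
  obtain ⟨t, v, hsum, -, h1, -⟩ := exists_pencil_decomposition
    (fun f g => by
      simp only [opForm_apply]
      rw [real_inner_comm]
      exact (hA g f).symm)
    (fun f g => by simp only [LinearMap.compl₁₂_apply, innerₗ_apply_apply, real_inner_comm])
    Subtype.val_injective hf
  simp only [opForm_apply, LinearMap.compl₁₂_apply, innerₗ_apply_apply,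
    real_inner_self_eq_norm_sq, ContinuousLinearMap.coe_coe] at h1
  rw [h1]
  have hle : ∀ i ∈ t, (i : ℝ) * ‖J (v i)‖ ^ 2 ≤ 0 := fun i _ =>
    mul_nonpos_of_nonpos_of_nonneg i.2.le (sq_nonneg _)
  refine lt_of_le_of_ne (Finset.sum_nonpos hle) fun h => hne ?_
  rw [hsum]
  refine Finset.sum_eq_zero fun i hi => ?_
  have := (Finset.sum_eq_zero_iff_of_nonpos hle).1 h i hi
  have : J (v i) = 0 := by
    rcases mul_eq_zero.1 this with h | h
    · exact absurd h i.2.ne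
    · simpa using h
  exact hJ (by simp [this])

variable [CompleteSpace E] {M : ℝ}

/-- The operator `e = A + M J†J` is at least `1`, hence invertible, and `T = J e⁻¹ J†` is compact
and symmetric. Eigenvalues of `T` above `1/M` correspond to negative `lam` through `μ = 1/(lam +
M)`, so `T ≤ 1/M` on the complement of their images under `J`. Positivity of `e` at `f - M e⁻¹J†J f`
turns this bound into the claim. -/
lemma inner_nonneg_of_orthogonal_negPencilSpace (hA : (A : E →ₗ[ℝ] E).IsSymmetric)
    (hJ : IsCompactOperator J) (hM : 0 < M)
    (hAM : ∀ f, ‖f‖ ^ 2 ≤ inner ℝ (A f) f + M * ‖J f‖ ^ 2) {f : E}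
    (hf : ∀ g ∈ negPencilSpace A J, inner ℝ (J f) (J g) = 0) : 0 ≤ inner ℝ (A f) f := by
  have hadj : ∀ f g, inner ℝ (J.adjoint f) g = inner ℝ f (J g) :=
    fun f g => J.adjoint_inner_left g f
  obtain ⟨e, he⟩ := exists_inverse_of_le_inner (A + M • (J.adjoint.comp J)) fun f => by
    refine (hAM f).trans_eq ?_
    simp [inner_add_left, real_inner_smul_left, hadj]
  have he' : ∀ f g, inner ℝ (e f) g = inner ℝ (A f) g + M * inner ℝ (J f) (J g) := fun f g => by
    simp [he, inner_add_left, real_inner_smul_left, hadj]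
  have hesymm : ∀ f g, inner ℝ (e f) g = inner ℝ f (e g) := fun f g => by
    rw [real_inner_comm _ f, he', he', real_inner_comm (J f), ← real_inner_comm (A g)]
    congr 1
    exact hA f g
  set R : E →L[ℝ] E := (e.symm : E →L[ℝ] E).comp J.adjoint with hR
  have heR : ∀ x, e (R x) = J.adjoint x := fun x => by simp [hR]
  set T : E →L[ℝ] E := J.comp R with hT
  have hTc : IsCompactOperator T := hJ.comp_clm R
  have hTs : (T : E →ₗ[ℝ] E).IsSymmetric := fun x y => by
    have h1 : inner ℝ (T x) y = inner ℝ (R x) (e (R y)) := by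
      rw [heR, real_inner_comm _ (R x), hadj, real_inner_comm]; rfl
    have h2 : inner ℝ x (T y) = inner ℝ (e (R x)) (R y) := by
      rw [heR, hadj]; rfl
    exact h1.trans ((hesymm _ _).symm.trans h2.symm)
  -- the closed subspace orthogonal to the negative directions
  set U : Submodule ℝ E := ((negPencilSpace A J).map (J : E →ₗ[ℝ] E))ᗮ with hU
  have hmemU : ∀ x, x ∈ U ↔ ∀ g ∈ negPencilSpace A J, inner ℝ x (J g) = 0 := fun x => by
    rw [hU, Submodule.mem_orthogonal']
    exact ⟨fun h g hg => h _ ⟨g, hg, rfl⟩, by rintro h _ ⟨g, hg, rfl⟩; exact h g hg⟩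
  -- Adding `M J†J` to both sides shifts the eigenvalue: `A g = lam J†J g` becomes `e g = (lam + M)
  -- J†J g`.
  have hpen : ∀ (g : E) (lam : ℝ), g ∈ pencilEigenspace (opForm A)
      ((innerₗ E).compl₁₂ (J : E →ₗ[ℝ] E) J) lam ↔ e g = (lam + M) • J.adjoint (J g) :=
    fun g lam => by
      rw [mem_pencilEigenspace]
      refine ⟨fun h => ext_inner_right ℝ fun k => ?_, fun h k => ?_⟩
      · have := h k
        simp only [opForm_apply, LinearMap.compl₁₂_apply, innerₗ_apply_apply,
          ContinuousLinearMap.coe_coe] at this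
        rw [he', this, real_inner_smul_left, hadj]; ring
      · have := congrArg (fun y => inner ℝ y k) h
        simp only [he', real_inner_smul_left, hadj] at this
        simp only [opForm_apply, LinearMap.compl₁₂_apply, innerₗ_apply_apply,
          ContinuousLinearMap.coe_coe]
        linarith
  have hTinv : ∀ x ∈ U, T x ∈ U := fun x hx => by
    rw [hmemU] at hx ⊢
    have : (negPencilSpace A J) ≤ LinearMap.ker (innerₗ E (T x) ∘ₗ (J : E →ₗ[ℝ] E)) := by
      refine iSup_le fun lam g hg => ?_
      have hg' : g ∈ negPencilSpace A J :=
        le_iSup (fun lam : {t : ℝ // t < 0} => pencilEigenspace (opForm A)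
          ((innerₗ E).compl₁₂ (J : E →ₗ[ℝ] E) J) lam) lam hg
      have h1 := (hpen g lam).1 hg
      have h2 : (lam + M) • R (J g) = g := e.injective (by rw [map_smul, heR, h1])
      simp only [LinearMap.mem_ker, LinearMap.comp_apply, innerₗ_apply_apply,
        ContinuousLinearMap.coe_coe]
      have h3 : inner ℝ (T x) (J g) = inner ℝ x (J (R (J g))) := hTs x (J g)
      rw [h3]
      have h4 := hx g hg'
      rw [← h2, map_smul, real_inner_smul_right] at h4
      -- In the degenerate case `lam + M = 0` the eigenvector `g = (lam + M) R (J g)` is itself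
      -- zero.
      rcases mul_eq_zero.1 h4 with h5 | h5
      · have : g = 0 := by rw [← h2, h5, zero_smul]
        simp [this]
      · exact h5
    exact fun g hg => this hg
  have : CompleteSpace U := (Submodule.isClosed_orthogonal _).completeSpace_coe
  -- An eigenvector `x ∈ U` of `T` with `μ > 1/M` would make `R x` a pencil eigenvector with `lam =
  -- 1/μ - M < 0`. Its image `J (R x) = μ x` would then be orthogonal to `x`.
  have hTU := inner_le_of_compact (T.restrict (p := U) (q := U) hTinv) (hTc.restrict' hTinv)
    (hTs.restrict_invariant hTinv) M⁻¹ fun μ x hx hx0 => by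
      by_contra! hμ
      have hμ0 : 0 < μ := (inv_pos.2 hM).trans hμ
      have hx1 : T x = μ • (x : E) := congrArg Subtype.val hx
      set g := R x with hg
      have hgmem : g ∈ pencilEigenspace (opForm A)
          ((innerₗ E).compl₁₂ (J : E →ₗ[ℝ] E) J) (μ⁻¹ - M) := by
        rw [hpen, heR, sub_add_cancel]
        have : J g = μ • (x : E) := hx1
        rw [this, map_smul, smul_smul, inv_mul_cancel₀ hμ0.ne', one_smul]
      have hneg : μ⁻¹ - M < 0 := by
        rw [sub_neg]
        exact inv_lt_of_inv_lt₀ hM hμ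
      have hgN : g ∈ negPencilSpace A J :=
        le_iSup (fun lam : {t : ℝ // t < 0} => pencilEigenspace (opForm A)
          ((innerₗ E).compl₁₂ (J : E →ₗ[ℝ] E) J) lam) ⟨_, hneg⟩ hgmem
      have h1 := (hmemU x).1 x.2 g hgN
      have : J g = μ • (x : E) := hx1
      rw [this, real_inner_smul_right, real_inner_self_eq_norm_sq] at h1
      rcases mul_eq_zero.1 h1 with h | h
      · exact hμ0.ne' h
      · exact hx0 (by simpa using h)
  -- conclusion
  have hJf : J f ∈ U := (hmemU _).2 hf
  set k := R (J f) with hk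
  have h1 : inner ℝ (T (J f)) (J f) ≤ M⁻¹ * ‖J f‖ ^ 2 := hTU ⟨J f, hJf⟩
  have h2 : inner ℝ (e k) f = ‖J f‖ ^ 2 := by
    rw [heR, hadj, real_inner_self_eq_norm_sq]
  have h3 : inner ℝ (e k) k = inner ℝ (T (J f)) (J f) := by
    rw [heR, hadj, real_inner_comm]; rfl
  have h4 : ∀ f, 0 ≤ inner ℝ (e f) f := fun f => by
    rw [he', real_inner_self_eq_norm_sq]
    exact (sq_nonneg _).trans (hAM f)
  -- discriminant of the nonnegative form at `f - M • k`
  have h5 := h4 (f - M • k)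
  rw [map_sub, map_smul, inner_sub_left, inner_sub_right, inner_sub_right, real_inner_smul_left,
    real_inner_smul_left, real_inner_smul_right, real_inner_smul_right, hesymm f k,
    real_inner_comm _ f, h2, h3, he' f f, real_inner_self_eq_norm_sq] at h5
  have h6 : M * (M * inner ℝ (T (J f)) (J f)) ≤ M * ‖J f‖ ^ 2 := by
    refine mul_le_mul_of_nonneg_left ?_ hM.le
    calc M * inner ℝ (T (J f)) (J f) ≤ M * (M⁻¹ * ‖J f‖ ^ 2) := mul_le_mul_of_nonneg_left h1 hM.le
      _ = _ := by field_simp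
  linarith

/-- On a negative subspace, `u ↦` the projection of `J u` onto the image of `negPencilSpace A J` is
injective: a vector in its kernel satisfies the orthogonality hypothesis of
`inner_nonneg_of_orthogonal_negPencilSpace`. If `negPencilSpace A J` has infinite dimension, the
upper bound is trivial. -/
lemma negIndex_opForm_eq (hA : (A : E →ₗ[ℝ] E).IsSymmetric)
    (hJ : IsCompactOperator J) (hJi : Function.Injective J) (hM : 0 < M)
    (hAM : ∀ f, ‖f‖ ^ 2 ≤ inner ℝ (A f) f + M * ‖J f‖ ^ 2) :
    negIndex ⊤ (fun f => inner ℝ (A f) f)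
      = Cardinal.toENat (Module.rank ℝ (negPencilSpace A J)) := by
  refine le_antisymm ?_ (le_negIndex le_top fun u hu hne =>
    inner_neg_of_mem_negPencilSpace hA hJi hu hne)
  refine iSup_le fun ⟨S, _, hS⟩ => ?_
  by_cases hfin : Module.rank ℝ (negPencilSpace A J) < Cardinal.aleph0
  · have hfd : FiniteDimensional ℝ (negPencilSpace A J) := Module.rank_lt_aleph0_iff.1 hfin
    set W := (negPencilSpace A J).map (J : E →ₗ[ℝ] E) with hW
    have : FiniteDimensional ℝ W := inferInstance
    rw [← toENat_rank_map_of_injOn ((W.starProjection).toLinearMap ∘ₗ (J : E →ₗ[ℝ] E)) S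
      (fun u hu h0 => ?_), ← toENat_rank_map_of_injOn (J : E →ₗ[ℝ] E) (negPencilSpace A J)
      (fun u _ h0 => hJi (by simpa using h0))]
    · refine OrderHomClass.mono Cardinal.toENat (Submodule.rank_mono ?_)
      rintro _ ⟨u, -, rfl⟩
      exact Submodule.starProjection_apply_mem W _
    · by_contra hne
      refine (hS u hu hne).not_ge (inner_nonneg_of_orthogonal_negPencilSpace hA hJ hM hAM ?_)
      intro g hg
      have h1 : J u ∈ Wᗮ := by
        rw [← Submodule.starProjection_apply_eq_zero_iff]
        exact h0
      exact (Submodule.mem_orthogonal' _ _).1 h1 _ ⟨g, hg, rfl⟩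
  · have : Cardinal.toENat (Module.rank ℝ (negPencilSpace A J)) = ⊤ :=
      Cardinal.toENat_eq_top.2 (not_lt.1 hfin)
    rw [this]
    exact le_top

end Form
end VlasovMaxwell

namespace VlasovMaxwell
namespace Equilibrium

/-! ### Inner products and pointwise formulas -/

lemma inner_Lp_eq {β : Type*} [MeasurableSpace β] {m : Measure β} (f g : Lp ℝ 2 m) :
    inner ℝ f g = ∫ z, f z * g z ∂m := by
  rw [L2.inner_def]
  refine integral_congr_ae (.of_forall fun z => ?_)
  simp [mul_comm]

lemma l2Map_coeFn {β γ : Type*} [MeasurableSpace β] [MeasurableSpace γ] {m : Measure β}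
    {m' : Measure γ} (T : (β → ℝ) → γ → ℝ) (hT : ∀ f : Lp ℝ 2 m, MemLp (T f) 2 m')
    (hadd : ∀ f g : Lp ℝ 2 m, T ⇑(f + g) =ᵐ[m'] T f + T g)
    (hsmul : ∀ (c : ℝ) (f : Lp ℝ 2 m), T ⇑(c • f) =ᵐ[m'] c • T f) (f : Lp ℝ 2 m) :
    l2Map T hT hadd hsmul f =ᵐ[m'] T f :=
  (hT f).coeFn_toLp

variable (F : Equilibrium)

lemma inner_L2W (f g : F.L2W) :
    inner ℝ f g = ∫ z, |F.μe z.1 z.2| * (f z * g z) ∂F.base := by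
  rw [inner_Lp_eq, F.integral_measW]

lemma integral_measInv (f : ℝ × ℝ × ℝ → ℝ) :
    ∫ z, f z ∂F.measInv = ∫ z, |F.μe z.1 z.2|⁻¹ * f z ∂F.base := by
  unfold measInv
  rw [integral_withDensity_eq_integral_toReal_smul F.measurable_wtInv (by simp)]
  simp [ENNReal.toReal_ofReal]

lemma base_ac_measInv : F.base ≪ F.measInv :=
  withDensity_absolutelyContinuous' F.measurable_wtInv.aemeasurable
    (.of_forall fun z => by simpa using (F.μe_lt z.1 z.2).ne)

lemma inner_L2Inv (f g : F.L2Inv) :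
    inner ℝ f g = ∫ z, |F.μe z.1 z.2|⁻¹ * (f z * g z) ∂F.base := by
  rw [inner_Lp_eq, F.integral_measInv]

lemma mulOp_coeFn (a : ℝ → ℝ) (ha : Measurable a) (hb : ∃ C : ℝ, ∀ x, |a x| ≤ C) (f : F.L2P) :
    F.mulOp a ha hb f =ᵐ[F.perMeas] fun x => a x * f x :=
  l2Map_coeFn _ _ _ _ _

lemma lift_coeFn (q : ℝ × ℝ → ℝ) (hq : IsWeight q) (f : F.L2P) :
    F.lift q hq f =ᵐ[F.measW] fun z => q z.2 * f z.1 :=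
  l2Map_coeFn _ _ _ _ _

lemma avg_coeFn (q : ℝ × ℝ → ℝ) (hq : IsWeight q) (w : F.L2W) :
    F.avg q hq w =ᵐ[F.perMeas] fun x => ∫ v, F.μe x v * q v * w (x, v) :=
  l2Map_coeFn _ _ _ _ _

lemma mulμe_coeFn (h : F.L2W) : F.mulμe h =ᵐ[F.measInv] fun z => F.μe z.1 z.2 * h z :=
  l2Map_coeFn _ _ _ _ _

lemma inner_mulOp (a : ℝ → ℝ) (ha : Measurable a) (hb : ∃ C : ℝ, ∀ x, |a x| ≤ C) (f g : F.L2P) :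
    inner ℝ (F.mulOp a ha hb f) g = inner ℝ f (F.mulOp a ha hb g) := by
  rw [inner_Lp_eq, inner_Lp_eq]
  refine integral_congr_ae ?_
  filter_upwards [F.mulOp_coeFn a ha hb f, F.mulOp_coeFn a ha hb g] with x h1 h2
  rw [h1, h2]; ring

/-- Fubini; the minus sign is that of `μ_e = -|μ_e|`. Up to this sign `avg` and `lift` are adjoint
to each other, which also gives their continuity. -/
lemma inner_avg (q : ℝ × ℝ → ℝ) (hq : IsWeight q) (w : F.L2W) (f : F.L2P) :
    inner ℝ (F.avg q hq w) f = -inner ℝ w (F.lift q hq f) := by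
  have hl := F.base_ac_measW.ae_le (F.lift_coeFn q hq f)
  have hae : (fun z => |F.μe z.1 z.2| * (w z * F.lift q hq f z))
      =ᵐ[F.base] fun z => -(F.μe z.1 z.2 * q z.2 * w z * f z.1) := by
    filter_upwards [hl] with z hz
    rw [hz, abs_of_neg (F.μe_lt z.1 z.2)]; ring
  have hint : Integrable (fun z => |F.μe z.1 z.2| * (w z * F.lift q hq f z)) F.base := by
    rw [← F.integrable_measW_iff (f := fun z => w z * F.lift q hq f z)]
    exact (Lp.memLp w).integrable_mul (Lp.memLp _)
  rw [F.inner_L2W, integral_congr_ae hae, integral_neg, neg_neg, integral_prod]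
  · rw [inner_Lp_eq]
    refine integral_congr_ae ?_
    filter_upwards [F.avg_coeFn q hq w] with x hx
    rw [hx, integral_mul_const]
  · exact (hint.congr hae).neg.congr (.of_forall fun z => by simp)

lemma inner_mulμe (f g : F.L2W) : inner ℝ (F.mulμe f) (F.mulμe g) = inner ℝ f g := by
  rw [F.inner_L2Inv, F.inner_L2W]
  refine integral_congr_ae ?_
  filter_upwards [F.base_ac_measInv.ae_le (F.mulμe_coeFn f),
    F.base_ac_measInv.ae_le (F.mulμe_coeFn g)] with z h1 h2
  have h0 := F.μe_lt z.1 z.2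
  rw [h1, h2, abs_of_neg h0]
  field_simp

lemma exists_mulμe_eq (g : F.L2Inv) : ∃ h : F.L2W, F.mulμe h = g := by
  have hs : Measurable g := (Lp.stronglyMeasurable g).measurable
  have hm : Measurable fun z : ℝ × ℝ × ℝ => F.μe z.1 z.2 := F.continuous_μe.measurable
  have hd : Measurable fun z => g z / F.μe z.1 z.2 := hs.div hm
  have hmem : MemLp (fun z => g z / F.μe z.1 z.2) 2 F.measW := by
    refine memLp_two_iff.2 ⟨hd.aestronglyMeasurable, ?_⟩
    refine lt_of_eq_of_lt ?_ (memLp_two_iff.1 (Lp.memLp g)).2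
    rw [F.lintegral_measInv (hs.enorm.pow_const 2), F.lintegral_measW (hd.enorm.pow_const 2)]
    refine lintegral_congr fun z => ?_
    have h0 : F.μe z.1 z.2 ≠ 0 := (F.μe_lt z.1 z.2).ne
    simp only [div_eq_mul_inv, enorm_mul, mul_pow, mul_comm (‖g z‖ₑ ^ 2), ← mul_assoc]
    congr 1
    rw [Real.enorm_eq_ofReal_abs, ← ENNReal.ofReal_pow (abs_nonneg _),
      ← ENNReal.ofReal_mul (by positivity)]
    congr 1
    rw [abs_inv]
    field_simp
  refine ⟨hmem.toLp _, Lp.ext ?_⟩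
  filter_upwards [F.mulμe_coeFn (hmem.toLp _), F.measInv_ac_measW.ae_le hmem.coeFn_toLp]
    with z h1 h2
  rw [h1, h2, mul_div_cancel₀ _ (F.μe_lt z.1 z.2).ne]

/-- Multiplication by `μ_e`, as an isometry from `L²_{|μ_e|}` onto `L²_{1/|μ_e|}`. -/
def mulμeEquiv : F.L2W ≃ₗᵢ[ℝ] F.L2Inv :=
  LinearIsometryEquiv.ofSurjective (F.mulμe.isometryOfInner F.inner_mulμe) F.exists_mulμe_eq

lemma mulμeEquiv_apply (h : F.L2W) : F.mulμeEquiv h = F.mulμe h := rfl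

lemma continuous_lift (q : ℝ × ℝ → ℝ) (hq : IsWeight q) : Continuous (F.lift q hq) :=
  continuous_of_formal_adjoint _ (fun w => -F.avg q hq w) fun x y => by
    rw [inner_neg_right, real_inner_comm, real_inner_comm (F.avg q hq y), F.inner_avg, neg_neg]

lemma continuous_avg (q : ℝ × ℝ → ℝ) (hq : IsWeight q) : Continuous (F.avg q hq) :=
  continuous_of_formal_adjoint _ (fun w => -F.lift q hq w) fun x y => by
    rw [inner_neg_right, F.inner_avg]

/-! ### The moments `∫ μ_e dv` and `∫ v₂ μ_e dv` -/

lemma avg_lift (q r : ℝ × ℝ → ℝ) (hq : IsWeight q) (hr : IsWeight r) (f : F.L2P) :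
    F.avg q hq (F.lift r hr f) =ᵐ[F.perMeas] fun x => (∫ v, F.μe x v * q v * r v) * f x := by
  filter_upwards [F.avg_coeFn q hq (F.lift r hr f),
    Measure.ae_ae_of_ae_prod (F.base_ac_measW.ae_le (F.lift_coeFn r hr f))] with x h1 h2
  rw [h1, ← integral_mul_const]
  refine integral_congr_ae ?_
  filter_upwards [h2] with v hv
  rw [hv]; ring

lemma avg_one_lift_one (f : F.L2P) :
    F.avg (fun _ => 1) isWeight_one (F.lift (fun _ => 1) isWeight_one f)
      = F.mulOp F.intμe F.measurable_intμe F.bounded_intμe f := by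
  refine Lp.ext ?_
  filter_upwards [F.avg_lift _ _ isWeight_one isWeight_one f,
    F.mulOp_coeFn _ F.measurable_intμe F.bounded_intμe f] with x h1 h2
  rw [h1, h2]
  simp [intμe]

lemma integrable_μe_snd (x : ℝ) : Integrable fun v : ℝ × ℝ => F.μe x v * v.2 := by
  obtain ⟨K, hK, h⟩ := F.exists_bound
  have hc : Continuous fun v : ℝ × ℝ => F.μe x v * v.2 :=
    (F.continuous_μe.comp (Continuous.prodMk_right x)).mul continuous_snd
  refine ⟨hc.aestronglyMeasurable, lt_of_le_of_lt (lintegral_mono fun v => ?_)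
    ((h x).trans_lt hK)⟩
  rw [Real.enorm_eq_ofReal_abs, abs_mul]
  refine ENNReal.ofReal_le_ofReal ?_
  have h1 : |v.2| ≤ 1 + v.1 ^ 2 + v.2 ^ 2 := by
    rw [← sq_abs v.2]; nlinarith [sq_nonneg v.1, sq_nonneg (|v.2| - 1), abs_nonneg v.2]
  have h2 : 0 ≤ |F.μp x v| * (1 + |v.2|) := by positivity
  nlinarith [mul_le_mul_of_nonneg_left h1 (abs_nonneg (F.μe x v))]

lemma integrable_μp (x : ℝ) : Integrable fun v : ℝ × ℝ => F.μp x v := by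
  obtain ⟨K, hK, h⟩ := F.exists_bound
  have hc : Continuous fun v : ℝ × ℝ => F.μp x v :=
    F.continuous_μp.comp (Continuous.prodMk_right x)
  refine ⟨hc.aestronglyMeasurable, lt_of_le_of_lt (lintegral_mono fun v => ?_)
    ((h x).trans_lt hK)⟩
  rw [Real.enorm_eq_ofReal_abs]
  refine ENNReal.ofReal_le_ofReal ?_
  have h1 : 0 ≤ |F.μe x v| * (1 + v.1 ^ 2 + v.2 ^ 2) := by positivity
  have h2 : 0 ≤ |F.μp x v| * |v.2| := by positivity
  nlinarith

/-- Chain rule with `∂e/∂v₂ = v₂` and `∂p/∂v₂ = 1`. -/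
lemma hasDerivAt_μ_snd (x v₁ v₂ : ℝ) :
    HasDerivAt (fun t => F.μ (energy F.φ₀ x (v₁, t), momentum F.ψ₀ x (v₁, t)))
      (F.μe x (v₁, v₂) * v₂ + F.μp x (v₁, v₂)) v₂ := by
  have h1 : HasDerivAt (fun t => energy F.φ₀ x (v₁, t)) v₂ v₂ := by
    unfold energy
    have := (((hasDerivAt_id v₂).pow 2).const_add (v₁ ^ 2)).div_const 2 |>.sub_const (F.φ₀ x)
    convert! this using 1
    simp
  have h2 : HasDerivAt (fun t => momentum F.ψ₀ x (v₁, t)) 1 v₂ := by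
    unfold momentum
    exact (hasDerivAt_id v₂).sub_const (F.ψ₀ x)
  have h3 := (F.μ_contDiff.differentiable (by norm_num)
    (energy F.φ₀ x (v₁, v₂), momentum F.ψ₀ x (v₁, v₂))).hasFDerivAt
  have h4 := h3.comp_hasDerivAt v₂ (h1.prodMk h2)
  convert! h4 using 1
  have : ((v₂, 1) : ℝ × ℝ) = v₂ • (1, 0) + (1 : ℝ) • (0, 1) := by simp
  rw [this, map_add, map_smul, map_smul]
  simp [μe, μp, partialE, partialP, mul_comm]

/-- The integral of `∂_{v₂} μ(e, p) = v₂ μ_e + μ_p` vanishes on almost every line in the direction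
of `v₂`, because `μ(e, p)` and this derivative are integrable there. -/
lemma intμp_eq (x : ℝ) : F.intμp x = -∫ v : ℝ × ℝ, F.μe x v * v.2 := by
  have hi : Integrable fun v : ℝ × ℝ => F.μe x v * v.2 + F.μp x v :=
    (F.integrable_μe_snd x).add (F.integrable_μp x)
  have h0 : ∫ v : ℝ × ℝ, (F.μe x v * v.2 + F.μp x v) = 0 := by
    rw [Measure.volume_eq_prod] at hi ⊢
    have hd := F.density_integrable x
    rw [Measure.volume_eq_prod] at hd
    rw [integral_prod _ hi]
    refine integral_eq_zero_of_ae ?_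
    filter_upwards [hi.prod_right_ae, hd.prod_right_ae] with v₁ h1 h2
    exact integral_eq_zero_of_hasDerivAt_of_integrable (fun v₂ => F.hasDerivAt_μ_snd x v₁ v₂) h1 h2
  rw [integral_add (F.integrable_μe_snd x) (F.integrable_μp x)] at h0
  rw [intμp]
  linarith

/-- This lets the multiplication term of `ℬ⁰` be absorbed into the projection term, so that only `1
- 𝒫` occurs. -/
lemma avg_one_lift_snd (f : F.L2P) :
    F.avg (fun _ => 1) isWeight_one (F.lift (fun v => v.2) isWeight_snd f)
      = -F.mulOp F.intμp F.measurable_intμp F.bounded_intμp f := by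
  refine Lp.ext ?_
  filter_upwards [F.avg_lift _ _ isWeight_one isWeight_snd f,
    F.mulOp_coeFn _ F.measurable_intμp F.bounded_intμp f,
    Lp.coeFn_neg (F.mulOp F.intμp F.measurable_intμp F.bounded_intμp f)] with x h1 h2 h3
  rw [h1, h3, Pi.neg_apply, h2, F.intμp_eq]
  simp

lemma avg_snd_lift_one (f : F.L2P) :
    F.avg (fun v => v.2) isWeight_snd (F.lift (fun _ => 1) isWeight_one f)
      = -F.mulOp F.intμp F.measurable_intμp F.bounded_intμp f := by
  refine Lp.ext ?_
  filter_upwards [F.avg_lift _ _ isWeight_snd isWeight_one f,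
    F.mulOp_coeFn _ F.measurable_intμp F.bounded_intμp f,
    Lp.coeFn_neg (F.mulOp F.intμp F.measurable_intμp F.bounded_intμp f)] with x h1 h2 h3
  rw [h1, h3, Pi.neg_apply, h2, F.intμp_eq]
  simp

/-! ### The reflection `v₁ ↦ -v₁` -/

/-- The reflection `(x, v₁, v₂) ↦ (x, -v₁, v₂)`. -/
def flip (z : ℝ × ℝ × ℝ) : ℝ × ℝ × ℝ := (z.1, -z.2.1, z.2.2)

@[simp] lemma flip_flip (z : ℝ × ℝ × ℝ) : flip (flip z) = z := by simp [flip]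

lemma measurable_flip : Measurable flip := by unfold flip; fun_prop

lemma measurePreserving_flip_base : MeasurePreserving flip F.base F.base := by
  have h1 : MeasurePreserving (fun v : ℝ × ℝ => (-v.1, v.2)) volume volume :=
    (Measure.measurePreserving_neg (volume : Measure ℝ)).prod
      (MeasurePreserving.id (volume : Measure ℝ))
  exact (MeasurePreserving.id F.perMeas).prod h1

@[simp] lemma μe_flip (z : ℝ × ℝ × ℝ) : F.μe (flip z).1 (flip z).2 = F.μe z.1 z.2 := by
  simp [μe, partialE, flip, energy, momentum]

/-- The reflection as a measurable equivalence. -/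
def flipEquiv : ℝ × ℝ × ℝ ≃ᵐ ℝ × ℝ × ℝ where
  toFun := flip
  invFun := flip
  left_inv := flip_flip
  right_inv := flip_flip
  measurable_toFun := measurable_flip
  measurable_invFun := measurable_flip

lemma integral_comp_flip (f : ℝ × ℝ × ℝ → ℝ) :
    ∫ z, f (flip z) ∂F.base = ∫ z, f z ∂F.base :=
  F.measurePreserving_flip_base.integral_comp flipEquiv.measurableEmbedding f

lemma measurePreserving_flip : MeasurePreserving flip F.measW F.measW := by
  refine ⟨measurable_flip, Measure.ext fun s hs => ?_⟩
  have hm := measurable_flip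
  rw [Measure.map_apply hm hs, measW, withDensity_apply _ (hm hs), withDensity_apply _ hs,
    ← F.measurePreserving_flip_base.setLIntegral_comp_preimage hs F.measurable_wt]
  simp only [μe_flip]

/-- The reflection of `L²_{|μ_e|}`. -/
def refl : F.L2W →ₗ[ℝ] F.L2W :=
  Lp.compMeasurePreservingₗ ℝ flip F.measurePreserving_flip

lemma refl_coeFn (h : F.L2W) : F.refl h =ᵐ[F.measW] fun z => h (flip z) :=
  Lp.coeFn_compMeasurePreserving h F.measurePreserving_flip

lemma refl_eq_iff {h k : F.L2W} : F.refl h = k ↔ (fun z => h (flip z)) =ᵐ[F.measW] k := by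
  rw [Lp.ext_iff]
  exact ⟨fun e => (F.refl_coeFn h).symm.trans e, fun e => (F.refl_coeFn h).trans e⟩

lemma refl_refl (h : F.L2W) : F.refl (F.refl h) = h := by
  rw [F.refl_eq_iff]
  have := F.measurePreserving_flip.quasiMeasurePreserving.ae_eq_comp (F.refl_coeFn h)
  filter_upwards [this] with z hz
  simpa using hz

lemma inner_refl (h k : F.L2W) : inner ℝ (F.refl h) k = inner ℝ h (F.refl k) := by
  rw [inner_Lp_eq, inner_Lp_eq, ← F.measurePreserving_flip.integral_comp
    flipEquiv.measurableEmbedding]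
  have := F.measurePreserving_flip.quasiMeasurePreserving.ae_eq_comp (F.refl_coeFn h)
  refine integral_congr_ae ?_
  filter_upwards [this, F.refl_coeFn k] with z h1 h2
  simp only [Function.comp_apply, flip_flip] at h1
  rw [h1, h2]

lemma mem_XodDual_iff (h : F.L2W) : h ∈ F.XodDual ↔ F.refl h = -h := by
  constructor
  · rintro ⟨r, hr, hh⟩
    rw [F.refl_eq_iff]
    have := F.measurePreserving_flip.quasiMeasurePreserving.ae_eq_comp hh
    filter_upwards [this, hh, Lp.coeFn_neg h] with z h1 h2 h3
    simp only [Function.comp_apply] at h1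
    rw [h1, h3, Pi.neg_apply, h2]
    exact hr _ _ _
  · intro hh
    -- Antisymmetrization produces a representative that is odd everywhere, as the definition of
    -- `XodDual` requires, and not merely almost everywhere.
    refine ⟨fun z => (h z - h (flip z)) / 2, fun x v₁ v₂ => ?_, ?_⟩
    · simp only [flip, neg_neg]; ring
    · filter_upwards [F.refl_eq_iff.1 hh, Lp.coeFn_neg h] with z h1 h2
      rw [h1, h2, Pi.neg_apply]; ring

lemma mulμe_mem_Xev_iff (h : F.L2W) : F.mulμe h ∈ F.Xev ↔ F.refl h = h := by
  have hac : F.measW ≪ F.measInv := F.measW_ac_base.trans F.base_ac_measInv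
  have h0 : F.mulμe h =ᵐ[F.measW] _ := hac.ae_le (F.mulμe_coeFn h)
  constructor
  · rintro ⟨r, hr, hh⟩
    rw [F.refl_eq_iff]
    have h1 : (fun z => F.μe z.1 z.2 * h z) =ᵐ[F.measW] r :=
      h0.symm.trans (hac.ae_le hh : F.mulμe h =ᵐ[F.measW] r)
    have h2 := F.measurePreserving_flip.quasiMeasurePreserving.ae_eq_comp h1
    filter_upwards [h1, h2] with z e1 e2
    simp only [Function.comp_apply, μe_flip] at e2
    have : r (flip z) = r z := hr _ _ _
    exact mul_left_cancel₀ (F.μe_lt z.1 z.2).ne (by rw [e1, e2, this])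
  · intro hh
    refine ⟨fun z => F.μe z.1 z.2 * ((h z + h (flip z)) / 2), fun x v₁ v₂ => ?_, ?_⟩
    · have e := F.μe_flip (x, v₁, v₂)
      simp only [flip, neg_neg] at e ⊢
      rw [e]; ring
    · filter_upwards [F.mulμe_coeFn h, F.measInv_ac_measW.ae_le (F.refl_eq_iff.1 hh)] with z h1 h2
      rw [h1, h2]; ring

lemma refl_lift (q : ℝ × ℝ → ℝ) (hq : IsWeight q) (hev : ∀ v, q (-v.1, v.2) = q v) (f : F.L2P) :
    F.refl (F.lift q hq f) = F.lift q hq f := by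
  rw [F.refl_eq_iff]
  have h1 := F.lift_coeFn q hq f
  have h2 := F.measurePreserving_flip.quasiMeasurePreserving.ae_eq_comp h1
  filter_upwards [h1, h2] with z e1 e2
  simp only [Function.comp_apply] at e2
  rw [e1, e2]
  simp [flip, hev z.2]

lemma refl_lift_fst (f : F.L2P) :
    F.refl (F.lift (fun v => v.1) isWeight_fst f) = -F.lift (fun v => v.1) isWeight_fst f := by
  rw [F.refl_eq_iff]
  have h1 := F.lift_coeFn _ isWeight_fst f
  have h2 := F.measurePreserving_flip.quasiMeasurePreserving.ae_eq_comp h1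
  filter_upwards [h1, h2, Lp.coeFn_neg (F.lift (fun v => v.1) isWeight_fst f)] with z e1 e2 e3
  simp only [Function.comp_apply] at e2
  rw [e3, Pi.neg_apply, e1, e2]
  simp [flip]

end Equilibrium
end VlasovMaxwell

namespace VlasovMaxwell

/-! ### Periodization -/

section Periodize

variable {E : Type*}

/-- The `P`-periodic extension in `x` of the restriction of `g` to `[0, P)`. -/
def periodize (P : ℝ) (g : ℝ × E → ℝ) (z : ℝ × E) : ℝ := g (z.1 - P * ⌊z.1 / P⌋, z.2)

lemma periodize_add {P : ℝ} (hP : 0 < P) (g : ℝ × E → ℝ) (x : ℝ) (v : E) :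
    periodize P g (x + P, v) = periodize P g (x, v) := by
  have : ⌊(x + P) / P⌋ = ⌊x / P⌋ + 1 := by
    rw [add_div, div_self hP.ne', Int.floor_add_one]
  simp only [periodize, this]
  push_cast
  congr 2
  ring

lemma periodize_eq_of_mem {P : ℝ} (hP : 0 < P) {g : ℝ × E → ℝ} {z : ℝ × E}
    (hz : z.1 ∈ Ioo 0 P) : periodize P g z = g z := by
  have : ⌊z.1 / P⌋ = 0 := by
    rw [Int.floor_eq_iff]
    simp only [Int.cast_zero, zero_add]
    exact ⟨div_nonneg hz.1.le hP.le, (div_lt_one hP).2 hz.2⟩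
  simp [periodize, this]

variable [NormedAddCommGroup E] [NormedSpace ℝ E]

/-- Near a point of `P ℤ` the extension vanishes, because `g` is supported at distance `δ` from the
ends of the period; elsewhere it is locally a translate of `g`. -/
lemma contDiff_periodize {P δ : ℝ} (hP : 0 < P) (hδ : 0 < δ) {g : ℝ × E → ℝ} {n : ℕ∞}
    (hg : ContDiff ℝ n g) (hs : ∀ x v, g (x, v) ≠ 0 → δ ≤ x ∧ x ≤ P - δ) :
    ContDiff ℝ n (periodize P g) := by
  rw [contDiff_iff_contDiffAt]
  rintro ⟨x₀, v₀⟩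
  set m := ⌊x₀ / P⌋ with hm
  have hm1 : P * m ≤ x₀ := by
    have := Int.floor_le (x₀ / P)
    rw [le_div_iff₀ hP] at this
    linarith
  have hm2 : x₀ < P * m + P := by
    have := Int.lt_floor_add_one (x₀ / P)
    rw [div_lt_iff₀ hP] at this
    linarith
  by_cases hc : x₀ < P * m + δ
  · have hU : ∀ᶠ z : ℝ × E in nhds (x₀, v₀), z.1 ∈ Ioo (P * m - δ) (P * m + δ) :=
      continuous_fst.continuousAt.eventually_mem (Ioo_mem_nhds (by simp; linarith) hc)
    refine (contDiffAt_const (c := (0 : ℝ))).congr_of_eventuallyEq (hU.mono fun z hz => ?_)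
    by_contra hne
    obtain ⟨h1, h2⟩ := hs _ _ hne
    rcases le_or_gt m ⌊z.1 / P⌋ with hk | hk
    · have : (m : ℝ) ≤ ⌊z.1 / P⌋ := by exact_mod_cast hk
      nlinarith [hz.2]
    · have : (⌊z.1 / P⌋ : ℝ) + 1 ≤ m := by exact_mod_cast hk
      nlinarith [hz.1]
  · have hU : ∀ᶠ z : ℝ × E in nhds (x₀, v₀), z.1 ∈ Ioo (P * m) (P * m + P) :=
      continuous_fst.continuousAt.eventually_mem
        (Ioo_mem_nhds (by simp only; linarith) hm2)
    have hsm : ContDiffAt ℝ n (fun z : ℝ × E => g (z.1 - P * m, z.2)) (x₀, v₀) := by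
      refine ContDiff.contDiffAt (hg.comp ?_)
      fun_prop
    refine hsm.congr_of_eventuallyEq (hU.mono fun z hz => ?_)
    have : ⌊z.1 / P⌋ = m := by
      rw [Int.floor_eq_iff]
      constructor
      · rw [le_div_iff₀ hP]; linarith [hz.1]
      · rw [div_lt_iff₀ hP]; linarith [hz.2]
    simp only [periodize, this]

lemma exists_margin_of_isCompact {P : ℝ} {K : Set ℝ} (hK : IsCompact K) (hKP : K ⊆ Ioo 0 P) :
    ∃ δ, 0 < δ ∧ ∀ x ∈ K, δ ≤ x ∧ x ≤ P - δ := by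
  obtain ⟨δ, hδ, h⟩ := hK.exists_cthickening_subset_open isOpen_Ioo hKP
  refine ⟨δ, hδ, fun x hx => ?_⟩
  have h1 := h (Metric.mem_cthickening_of_dist_le (x - δ) x δ K hx (by simp [abs_of_pos hδ]))
  have h2 := h (Metric.mem_cthickening_of_dist_le (x + δ) x δ K hx (by simp [abs_of_pos hδ]))
  exact ⟨by linarith [h1.1], by linarith [h2.2]⟩

end Periodize

namespace Equilibrium

variable (F : Equilibrium)

/-! ### Continuous functions and constants in `L²_P` -/

lemma memLp_continuous {κ : ℝ → ℝ} (hκ : Continuous κ) : MemLp κ 2 F.perMeas := by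
  obtain ⟨C, hC⟩ := (isCompact_Icc (a := (0 : ℝ)) (b := F.P)).exists_bound_of_continuousOn
    hκ.continuousOn
  refine MemLp.of_bound hκ.aestronglyMeasurable C ?_
  exact (ae_restrict_mem measurableSet_Ioc).mono fun x hx => hC x (Ioc_subset_Icc_self hx)

/-- A continuous function as an element of `L²_P`. -/
def contLp (κ : ℝ → ℝ) (hκ : Continuous κ) : F.L2P := (F.memLp_continuous hκ).toLp κ

lemma contLp_coeFn {κ : ℝ → ℝ} (hκ : Continuous κ) : F.contLp κ hκ =ᵐ[F.perMeas] κ :=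
  MemLp.coeFn_toLp _

lemma inner_contLp (f : F.L2P) {κ : ℝ → ℝ} (hκ : Continuous κ) :
    inner ℝ f (F.contLp κ hκ) = ∫ x, f x * κ x ∂F.perMeas := by
  rw [inner_Lp_eq]
  refine integral_congr_ae ?_
  filter_upwards [F.contLp_coeFn hκ] with x hx
  rw [hx]

/-- The constant function `1`. -/
def one : F.L2P := F.contLp (fun _ => 1) continuous_const

lemma one_coeFn : F.one =ᵐ[F.perMeas] fun _ => 1 := F.contLp_coeFn _

lemma inner_one (f : F.L2P) : inner ℝ f F.one = ∫ x, f x ∂F.perMeas := by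
  rw [one, F.inner_contLp]; simp

lemma perInt_eq (f : F.L2P) : F.perInt f = inner ℝ f F.one := (F.inner_one f).symm

lemma inner_one_one : inner ℝ F.one F.one = F.P := by
  rw [F.inner_one, integral_congr_ae F.one_coeFn]
  simp [F.P_pos.le]

lemma isWeakDeriv_iff (f w : F.L2P) : F.IsWeakDeriv f w ↔
    ∀ (χ : ℝ → ℝ) (hχ : ContDiff ℝ (⊤ : ℕ∞) χ), Function.Periodic χ F.P →
      inner ℝ f (F.contLp (deriv χ) (hχ.continuous_deriv (by simp)))
        = -inner ℝ w (F.contLp χ hχ.continuous) := by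
  refine forall_congr' fun χ => forall_congr' fun hχ => forall_congr' fun hp => ?_
  rw [F.inner_contLp, F.inner_contLp]

lemma integrable_coeFn (f : F.L2P) : Integrable f F.perMeas :=
  (Lp.memLp f).integrable (by norm_num)

/-- Smooth periodic functions are total in `L²_P`. -/
lemma eq_zero_of_inner_smooth (u : F.L2P)
    (h : ∀ (χ : ℝ → ℝ) (hχ : ContDiff ℝ (⊤ : ℕ∞) χ), Function.Periodic χ F.P →
      inner ℝ u (F.contLp χ hχ.continuous) = 0) : u = 0 := by
  have hae := IsOpen.ae_eq_zero_of_integral_contDiff_smul_eq_zero (μ := F.perMeas) (f := u)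
    (isOpen_Ioo (a := 0) (b := F.P)) ((F.integrable_coeFn u).locallyIntegrable.locallyIntegrableOn _)
    fun g hg hc hs => by
      obtain ⟨δ, hδ, hK⟩ := exists_margin_of_isCompact hc hs
      have hsm := contDiff_periodize (E := ℝ) F.P_pos hδ (g := fun z => g z.1)
        (n := ⊤) (hg.comp contDiff_fst)
        fun x v hx => hK x (subset_tsupport _ hx)
      have h1 := h (fun x => periodize F.P (fun z : ℝ × ℝ => g z.1) (x, 0))
        (hsm.comp (contDiff_id.prodMk contDiff_const))
        fun x => periodize_add F.P_pos _ _ _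
      rw [F.inner_contLp] at h1
      rw [← h1]
      refine integral_congr_ae ?_
      have hne : ∀ᵐ x ∂F.perMeas, x ≠ F.P := (Measure.ae_ne _ _)
      filter_upwards [ae_restrict_mem measurableSet_Ioc, hne] with x hx hx'
      rw [periodize_eq_of_mem F.P_pos ⟨hx.1, lt_of_le_of_ne hx.2 hx'⟩, smul_eq_mul, mul_comm]
  refine Lp.ext ?_
  have hne : ∀ᵐ x ∂F.perMeas, x ≠ F.P := (Measure.ae_ne _ _)
  filter_upwards [hae, ae_restrict_mem measurableSet_Ioc, hne, Lp.coeFn_zero ℝ 2 F.perMeas]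
    with x h1 hx hx' h0
  rw [h1 ⟨hx.1, lt_of_le_of_ne hx.2 hx'⟩, h0]; rfl

/-! ### The primitive -/

/-- The indicator function of `(-∞, x]`. -/
def ind (x : ℝ) : F.L2P :=
  indicatorConstLp 2 (measurableSet_Iic (a := x)) (measure_ne_top F.perMeas _) (1 : ℝ)

lemma inner_ind (x : ℝ) (w : F.L2P) : inner ℝ (F.ind x) w = ∫ y in Iic x, w y ∂F.perMeas :=
  L2.inner_indicatorConstLp_one _ _ _

/-- Hölder continuity of exponent `1/2`. It makes primitives continuous and, being uniform, yields
the compactness of integration. -/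
lemma norm_ind_sub_le {x y : ℝ} : ‖F.ind x - F.ind y‖ ≤ Real.sqrt |x - y| := by
  wlog h : y ≤ x generalizing x y
  · rw [norm_sub_rev, abs_sub_comm]
    exact this (not_le.1 h).le
  have h1 : F.ind x - F.ind y = indicatorConstLp 2 (measurableSet_Ioc (a := y) (b := x))
      (measure_ne_top F.perMeas _) (1 : ℝ) := by
    refine Lp.ext ?_
    filter_upwards [Lp.coeFn_sub (F.ind x) (F.ind y),
      indicatorConstLp_coeFn (p := 2) (hs := measurableSet_Iic (a := x))
        (hμs := measure_ne_top F.perMeas _) (c := (1 : ℝ)),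
      indicatorConstLp_coeFn (p := 2) (hs := measurableSet_Iic (a := y))
        (hμs := measure_ne_top F.perMeas _) (c := (1 : ℝ)),
      indicatorConstLp_coeFn (p := 2) (hs := measurableSet_Ioc (a := y) (b := x))
        (hμs := measure_ne_top F.perMeas _) (c := (1 : ℝ))] with t h1 h2 h3 h4
    rw [h1, Pi.sub_apply, h4, ind, ind, h2, h3]
    simp only [indicator_apply, mem_Iic, mem_Ioc]
    by_cases hy : t ≤ y
    · simp [hy, hy.trans h]
    · simp [hy, not_le.1 hy]
  rw [h1, norm_indicatorConstLp (by norm_num) (by norm_num), norm_one, one_mul,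
    Real.sqrt_eq_rpow]
  norm_num
  refine Real.rpow_le_rpow measureReal_nonneg ?_ (by norm_num)
  refine (measureReal_mono inter_subset_left (by simp)).trans_eq ?_
  rw [Real.volume_real_Ioc_of_le h, abs_of_nonneg (sub_nonneg.2 h)]

lemma continuous_ind : Continuous F.ind := by
  rw [continuous_iff_continuousAt]
  intro x
  rw [ContinuousAt, tendsto_iff_norm_sub_tendsto_zero]
  refine squeeze_zero (fun _ => norm_nonneg _) (fun y => F.norm_ind_sub_le) ?_
  have : Continuous fun y : ℝ => Real.sqrt |y - x| := by fun_prop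
  simpa using this.tendsto x

lemma continuous_inner_ind (w : F.L2P) : Continuous fun x => inner ℝ (F.ind x) w :=
  F.continuous_ind.inner continuous_const

/-- The primitive `x ↦ ∫₀ˣ w`. -/
def prim : F.L2P →ₗ[ℝ] F.L2P where
  toFun w := F.contLp _ (F.continuous_inner_ind w)
  map_add' w w' := by
    simp only [inner_add_right]
    exact MemLp.toLp_add _ _
  map_smul' c w := by
    simp only [inner_smul_right]
    exact MemLp.toLp_const_smul c _

lemma prim_coeFn (w : F.L2P) : F.prim w =ᵐ[F.perMeas] fun x => inner ℝ (F.ind x) w :=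
  F.contLp_coeFn (F.continuous_inner_ind w)

/-- `⟨prim w, z⟩ + ⟨w, prim z⟩ = (∫ w) (∫ z)` -/
lemma inner_prim (w z : F.L2P) : inner ℝ (F.prim w) z + inner ℝ w (F.prim z)
    = inner ℝ w F.one * inner ℝ z F.one := by
  have hw := F.integrable_coeFn w
  have hz := F.integrable_coeFn z
  have h1 : inner ℝ (F.prim w) z
      = ∫ x, ∫ y, (Iic x).indicator (fun _ => 1) y * (w y * z x) ∂F.perMeas ∂F.perMeas := by
    rw [inner_Lp_eq]
    refine integral_congr_ae ?_
    filter_upwards [F.prim_coeFn w] with x hx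
    rw [hx, F.inner_ind, ← integral_indicator measurableSet_Iic, ← integral_mul_const]
    refine integral_congr_ae (.of_forall fun y => ?_)
    by_cases h : y ∈ Iic x <;> simp [h]
  have h2 : inner ℝ w (F.prim z)
      = ∫ y, ∫ x, (Iic y).indicator (fun _ => 1) x * (w y * z x) ∂F.perMeas ∂F.perMeas := by
    rw [inner_Lp_eq]
    refine integral_congr_ae ?_
    filter_upwards [F.prim_coeFn z] with x hx
    rw [hx, F.inner_ind, ← integral_indicator measurableSet_Iic, ← integral_const_mul]
    refine integral_congr_ae (.of_forall fun y => ?_)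
    by_cases h : y ∈ Iic x <;> simp [h]
  have hprod : Integrable (fun p : ℝ × ℝ => w p.2 * z p.1) (F.perMeas.prod F.perMeas) :=
    (hz.mul_prod hw).congr (.of_forall fun p => mul_comm _ _)
  have hi1 : Integrable (fun p : ℝ × ℝ => (Iic p.1).indicator (fun _ => (1 : ℝ)) p.2
      * (w p.2 * z p.1)) (F.perMeas.prod F.perMeas) := by
    have hm : MeasurableSet {p : ℝ × ℝ | p.2 ≤ p.1} := measurableSet_le measurable_snd measurable_fst
    refine (hprod.indicator hm).congr (.of_forall fun p => ?_)
    by_cases h : p.2 ≤ p.1 <;> simp [h]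
  have hi2 : Integrable (fun p : ℝ × ℝ => (Iic p.2).indicator (fun _ => (1 : ℝ)) p.1
      * (w p.2 * z p.1)) (F.perMeas.prod F.perMeas) := by
    have hm : MeasurableSet {p : ℝ × ℝ | p.1 ≤ p.2} := measurableSet_le measurable_fst measurable_snd
    refine (hprod.indicator hm).congr (.of_forall fun p => ?_)
    by_cases h : p.1 ≤ p.2 <;> simp [h]
  rw [h1, h2, ← integral_integral_swap (f := fun x y => (Iic y).indicator (fun _ => (1 : ℝ)) x
      * (w y * z x)) (by exact hi2),
    ← integral_add (by exact hi1.integral_prod_left) (by exact hi2.integral_prod_left),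
    F.inner_one, F.inner_one, mul_comm, ← integral_mul_const]
  refine integral_congr_ae ?_
  filter_upwards [hi1.prod_right_ae, hi2.prod_right_ae] with x e1 e2
  rw [← integral_add e1 e2, ← integral_const_mul]
  refine integral_congr_ae ?_
  -- Off the diagonal, a null set, exactly one of `y ≤ x` and `x ≤ y` holds, so the two indicators
  -- add up to `1`.
  have hne : ∀ᵐ y ∂F.perMeas, y ≠ x := (Measure.ae_ne _ _)
  filter_upwards [hne] with y hy
  rcases lt_or_gt_of_ne hy with h | h
  · simp [h.le, h.not_ge]; ring
  · simp [h.le, h.not_ge]; ring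


lemma norm_ind_le {x : ℝ} (hx : x ∈ Ioc 0 F.P) : ‖F.ind x‖ ≤ Real.sqrt F.P := by
  have h0 : F.ind 0 = 0 := by
    refine Lp.ext ?_
    filter_upwards [indicatorConstLp_coeFn (p := 2) (hs := measurableSet_Iic (a := (0 : ℝ)))
        (hμs := measure_ne_top F.perMeas _) (c := (1 : ℝ)), Lp.coeFn_zero ℝ 2 F.perMeas,
      ae_restrict_mem measurableSet_Ioc] with t h1 h2 ht
    rw [ind, h1, h2]
    simp [ht.1]
  have := F.norm_ind_sub_le (x := x) (y := 0)
  rw [h0, sub_zero, sub_zero, abs_of_pos hx.1] at this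
  exact this.trans (Real.sqrt_le_sqrt hx.2)

lemma norm_le_of_ae_bound {f : F.L2P} {C : ℝ} (hC : 0 ≤ C) (h : ∀ᵐ x ∂F.perMeas, |f x| ≤ C) :
    ‖f‖ ≤ Real.sqrt F.P * C := by
  have := Lp.norm_le_of_ae_bound (f := f) hC h
  refine this.trans_eq ?_
  congr 1
  rw [measureUnivNNReal, Measure.restrict_apply_univ, Real.volume_Ioc, sub_zero]
  have h1 : ((ENNReal.ofReal F.P).toNNReal : ℝ) = F.P := ENNReal.toReal_ofReal F.P_pos.le
  rw [h1, Real.sqrt_eq_rpow]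
  norm_num

lemma norm_prim_le (w : F.L2P) : ‖F.prim w‖ ≤ F.P * ‖w‖ := by
  have := F.norm_le_of_ae_bound (f := F.prim w) (C := Real.sqrt F.P * ‖w‖) (by positivity) <| by
    filter_upwards [F.prim_coeFn w, ae_restrict_mem measurableSet_Ioc] with x h hx
    rw [h]
    exact (abs_real_inner_le_norm _ _).trans
      (mul_le_mul_of_nonneg_right (F.norm_ind_le hx) (norm_nonneg _))
  rwa [← mul_assoc, Real.mul_self_sqrt F.P_pos.le] at this

/-- The primitive as a bounded operator. -/
def primL : F.L2P →L[ℝ] F.L2P := F.prim.mkContinuous F.P F.norm_prim_le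

lemma memLp_step (n : ℕ) (c : Fin (n + 1) → ℝ) :
    MemLp (fun x : ℝ => c (Fin.ofNat (n + 1) ⌊n * x / F.P⌋₊)) 2 F.perMeas := by
  have h : Measurable fun x : ℝ => Fin.ofNat (n + 1) ⌊n * x / F.P⌋₊ :=
    (Measurable.of_discrete (f := Fin.ofNat (n + 1))).comp
      (Nat.measurable_floor.comp (by fun_prop : Measurable fun x : ℝ => n * x / F.P))
  refine MemLp.of_bound (Measurable.of_discrete.comp h).aestronglyMeasurable (‖c‖)
    (.of_forall fun x => norm_le_pi_norm c _)

/-- The step function with value `c k` for `⌊n x / P⌋ = k`. -/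
def step (n : ℕ) : (Fin (n + 1) → ℝ) →ₗ[ℝ] F.L2P where
  toFun c := (F.memLp_step n c).toLp _
  map_add' _ _ := MemLp.toLp_add _ _
  map_smul' a _ := MemLp.toLp_const_smul a _

lemma step_coeFn (n : ℕ) (c : Fin (n + 1) → ℝ) : F.step n c =ᵐ[F.perMeas]
    fun x => c (Fin.ofNat (n + 1) ⌊n * x / F.P⌋₊) :=
  MemLp.coeFn_toLp (F.memLp_step n c)

/-- The approximation of the primitive by step functions. -/
def primStep (n : ℕ) : F.L2P →L[ℝ] F.L2P :=
  (F.step n).toContinuousLinearMap.comp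
    (ContinuousLinearMap.pi fun k : Fin (n + 1) => innerSL ℝ (F.ind (k * F.P / n)))

lemma isCompactOperator_primStep (n : ℕ) : IsCompactOperator (F.primStep n) :=
  (isCompactOperator_of_locallyCompactSpace_rng (F.step n).toContinuousLinearMap).comp_clm _

/-- Every `x` is within `P/n` of the left end of its cell, and `norm_ind_sub_le` bounds the
variation of all primitives there by `√(P/n) ‖w‖`. -/
lemma norm_primL_sub_primStep_le (n : ℕ) (hn : 0 < n) :
    ‖F.primL - F.primStep n‖ ≤ Real.sqrt F.P * Real.sqrt (F.P / n) := by
  have hP := F.P_pos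
  refine ContinuousLinearMap.opNorm_le_bound _ (by positivity) fun w => ?_
  rw [mul_assoc]
  refine F.norm_le_of_ae_bound (by positivity) ?_
  filter_upwards [F.prim_coeFn w, F.step_coeFn n fun k => inner ℝ (F.ind (k * F.P / n)) w,
    Lp.coeFn_sub (F.prim w) (F.step n fun k => inner ℝ (F.ind (k * F.P / n)) w),
    ae_restrict_mem measurableSet_Ioc] with x h1 h2 h3 hx
  have e : (F.primL - F.primStep n) w
    = F.prim w - F.step n fun k => inner ℝ (F.ind (k * F.P / n)) w := rfl
  rw [e, h3, Pi.sub_apply, h1, h2, ← inner_sub_left]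
  refine (abs_real_inner_le_norm _ _).trans (mul_le_mul_of_nonneg_right ?_ (norm_nonneg _))
  refine F.norm_ind_sub_le.trans (Real.sqrt_le_sqrt ?_)
  have hn' : (0 : ℝ) < n := by exact_mod_cast hn
  have hy : 0 ≤ n * x / F.P := by have := hx.1; positivity
  -- At `x = P` the floor equals `n`. This is why there are `n + 1` values, and `Fin.ofNat` never
  -- wraps around.
  have hle : ⌊n * x / F.P⌋₊ < n + 1 := by
    rw [Nat.lt_succ_iff]
    refine Nat.floor_le_of_le ?_
    rw [div_le_iff₀ hP]
    exact mul_le_mul_of_nonneg_left hx.2 hn'.le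
  have hval : ((Fin.ofNat (n + 1) ⌊n * x / F.P⌋₊ : Fin (n + 1)) : ℕ) = ⌊n * x / F.P⌋₊ := by
    simp [Fin.ofNat, Nat.mod_eq_of_lt hle]
  rw [hval]
  have h4 := Nat.floor_le hy
  have h5 := (Nat.lt_floor_add_one (n * x / F.P)).le
  have hx' : x = n * x / F.P * (F.P / n) := by field_simp
  have hk : (⌊n * x / F.P⌋₊ : ℝ) * F.P / n = ⌊n * x / F.P⌋₊ * (F.P / n) := by ring
  have hq : 0 < F.P / n := by positivity
  rw [hk]
  rw [abs_le]
  constructor <;> nlinarith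

/-- A limit in norm of operators of finite rank. -/
lemma isCompactOperator_primL : IsCompactOperator F.primL := by
  refine isCompactOperator_of_tendsto (l := Filter.atTop) (F := F.primStep) ?_
    (.of_forall F.isCompactOperator_primStep)
  rw [tendsto_iff_norm_sub_tendsto_zero]
  refine squeeze_zero' (.of_forall fun _ => norm_nonneg _) (g := fun n : ℕ =>
    Real.sqrt F.P * Real.sqrt (F.P / n)) ?_ ?_
  · filter_upwards [Filter.eventually_gt_atTop 0] with n hn
    rw [norm_sub_rev]
    exact F.norm_primL_sub_primStep_le n hn
  · have h := (tendsto_const_div_atTop_nhds_zero_nat F.P)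
    have := ((Real.continuous_sqrt.tendsto 0).comp h).const_mul (Real.sqrt F.P)
    simpa using this

/-! ### The space `H¹_P` -/

/-- The projection `Π` onto the constants. -/
def mean : F.L2P →L[ℝ] F.L2P := F.P⁻¹ • (innerSL ℝ F.one).smulRight F.one

lemma mean_apply (f : F.L2P) : F.mean f = (F.P⁻¹ * inner ℝ F.one f) • F.one := by
  simp [mean, smul_smul]

lemma mean_one : F.mean F.one = F.one := by
  rw [mean_apply, F.inner_one_one, inv_mul_cancel₀ F.P_pos.ne', one_smul]

lemma mean_eq_zero {f : F.L2P} (h : inner ℝ f F.one = 0) : F.mean f = 0 := by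
  rw [mean_apply, real_inner_comm, h, mul_zero, zero_smul]

lemma inner_mean (f g : F.L2P) : inner ℝ (F.mean f) g = inner ℝ f (F.mean g) := by
  rw [mean_apply, mean_apply, real_inner_smul_left, real_inner_smul_right,
    real_inner_comm f]
  ring

lemma inner_mean_one (f : F.L2P) : inner ℝ (F.mean f) F.one = inner ℝ f F.one := by
  rw [inner_mean, mean_one]

lemma mean_mean (f : F.L2P) : F.mean (F.mean f) = F.mean f := by
  rw [F.mean_apply f, map_smul, mean_one]

/-- The antiderivative of mean zero of the part of mean zero. -/
def antideriv : F.L2P →L[ℝ] F.L2P := (1 - F.mean).comp (F.primL.comp (1 - F.mean))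

lemma antideriv_apply (w : F.L2P) :
    F.antideriv w = F.prim (w - F.mean w) - F.mean (F.prim (w - F.mean w)) := rfl

lemma isCompactOperator_antideriv : IsCompactOperator F.antideriv := by
  have h := (F.isCompactOperator_primL.comp_clm (1 - F.mean)).clm_comp (1 - F.mean)
  exact h

lemma inner_sub_mean_one (w : F.L2P) : inner ℝ (w - F.mean w) F.one = 0 := by
  rw [inner_sub_left, inner_mean_one, sub_self]

lemma inner_antideriv_one (w : F.L2P) : inner ℝ (F.antideriv w) F.one = 0 :=
  F.inner_sub_mean_one _

lemma mean_antideriv (w : F.L2P) : F.mean (F.antideriv w) = 0 :=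
  F.mean_eq_zero (F.inner_antideriv_one w)

lemma antideriv_mean (w : F.L2P) : F.antideriv (F.mean w) = 0 := by
  rw [antideriv_apply, mean_mean, sub_self, map_zero, map_zero, sub_zero]

/-- On functions of mean zero the boundary term in `inner_prim` disappears, and the outer factors `1
- mean` are symmetric. -/
lemma inner_antideriv (w z : F.L2P) :
    inner ℝ (F.antideriv w) z = -inner ℝ w (F.antideriv z) := by
  have h1 : ∀ u z : F.L2P, inner ℝ (u - F.mean u) z = inner ℝ u (z - F.mean z) := fun u z => by
    rw [inner_sub_left, inner_sub_right, inner_mean]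
  have h2 := F.inner_prim (w - F.mean w) (z - F.mean z)
  rw [F.inner_sub_mean_one, zero_mul] at h2
  rw [antideriv_apply, antideriv_apply, h1, ← h1 w]
  linarith

lemma prim_deriv {χ : ℝ → ℝ} (hχ : ContDiff ℝ (⊤ : ℕ∞) χ) :
    F.prim (F.contLp (deriv χ) (hχ.continuous_deriv (by simp)))
      = F.contLp χ hχ.continuous - χ 0 • F.one := by
  have hc : Continuous (deriv χ) := hχ.continuous_deriv (by simp)
  refine Lp.ext ?_
  filter_upwards [F.prim_coeFn (F.contLp (deriv χ) hc), F.contLp_coeFn hχ.continuous, F.one_coeFn,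
    Lp.coeFn_sub (F.contLp χ hχ.continuous) (χ 0 • F.one), Lp.coeFn_smul (χ 0) F.one,
    ae_restrict_mem measurableSet_Ioc] with x h1 h2 h3 h4 h5 hx
  rw [h1, h4, Pi.sub_apply, h5, Pi.smul_apply, h2, h3, F.inner_ind,
    integral_congr_ae (ae_restrict_of_ae (F.contLp_coeFn hc)),
    Measure.restrict_restrict measurableSet_Iic]
  have : Iic x ∩ Ioc 0 F.P = Ioc 0 x := by
    ext t; simp only [mem_inter_iff, mem_Iic, mem_Ioc]
    exact ⟨fun h => ⟨h.2.1, h.1⟩, fun h => ⟨h.2, h.1, h.2.trans hx.2⟩⟩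
  rw [this, ← intervalIntegral.integral_of_le hx.1.le,
    intervalIntegral.integral_deriv_eq_sub (fun t _ => (hχ.differentiable (by simp)) t)
      (hc.intervalIntegrable _ _)]
  simp

lemma inner_deriv_one {χ : ℝ → ℝ} (hχ : ContDiff ℝ (⊤ : ℕ∞) χ) (hp : Function.Periodic χ F.P) :
    inner ℝ (F.contLp (deriv χ) (hχ.continuous_deriv (by simp))) F.one = 0 := by
  have hc : Continuous (deriv χ) := hχ.continuous_deriv (by simp)
  rw [F.inner_one, integral_congr_ae (F.contLp_coeFn hc),
    ← intervalIntegral.integral_of_le F.P_pos.le,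
    intervalIntegral.integral_deriv_eq_sub (fun t _ => (hχ.differentiable (by simp)) t)
      (hc.intervalIntegrable _ _)]
  have := hp 0
  rw [zero_add] at this
  rw [this, sub_self]

lemma antideriv_deriv {χ : ℝ → ℝ} (hχ : ContDiff ℝ (⊤ : ℕ∞) χ) (hp : Function.Periodic χ F.P) :
    F.antideriv (F.contLp (deriv χ) (hχ.continuous_deriv (by simp)))
      = F.contLp χ hχ.continuous - F.mean (F.contLp χ hχ.continuous) := by
  rw [antideriv_apply, F.mean_eq_zero (F.inner_deriv_one hχ hp), sub_zero, F.prim_deriv hχ, map_sub,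
    map_smul, mean_one]
  abel

lemma isWeakDeriv_one : F.IsWeakDeriv F.one 0 := by
  rw [isWeakDeriv_iff]
  intro χ hχ hp
  rw [real_inner_comm, F.inner_deriv_one hχ hp, inner_zero_left, neg_zero]

lemma isWeakDeriv_antideriv {w : F.L2P} (hw : inner ℝ w F.one = 0) :
    F.IsWeakDeriv (F.antideriv w) w := by
  rw [isWeakDeriv_iff]
  intro χ hχ hp
  rw [inner_antideriv, F.antideriv_deriv hχ hp, inner_sub_right, ← inner_mean, F.mean_eq_zero hw,
    inner_zero_left, sub_zero]

variable {F} in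
lemma IsWeakDeriv.inner_one {f w : F.L2P} (h : F.IsWeakDeriv f w) : inner ℝ w F.one = 0 := by
  rw [isWeakDeriv_iff] at h
  have h1 := h (fun _ => 1) contDiff_const fun _ => rfl
  have h2 : F.contLp (deriv fun _ : ℝ => (1 : ℝ)) (by simpa using continuous_const) = 0 := by
    refine Lp.ext ?_
    filter_upwards [F.contLp_coeFn (κ := deriv fun _ : ℝ => (1 : ℝ))
      (by simpa using continuous_const), Lp.coeFn_zero ℝ 2 F.perMeas] with x h1 h2
    rw [h1, h2]; simp
  rw [h2, inner_zero_right] at h1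
  exact neg_eq_zero.1 h1.symm

lemma contLp_sub {κ ξ : ℝ → ℝ} (hκ : Continuous κ) (hξ : Continuous ξ) :
    F.contLp (κ - ξ) (hκ.sub hξ) = F.contLp κ hκ - F.contLp ξ hξ :=
  MemLp.toLp_sub _ _

/-- Removing the mean is exactly what makes the primitive periodic. -/
lemma exists_deriv_eq_sub_mean {κ : ℝ → ℝ} (hκ : ContDiff ℝ (⊤ : ℕ∞) κ)
    (hp : Function.Periodic κ F.P) : ∃ (χ : ℝ → ℝ) (hχ : ContDiff ℝ (⊤ : ℕ∞) χ),
      Function.Periodic χ F.P ∧ F.contLp (deriv χ) (hχ.continuous_deriv (by simp))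
        = F.contLp κ hκ.continuous - F.mean (F.contLp κ hκ.continuous) := by
  set a := F.P⁻¹ * ∫ x, κ x ∂F.perMeas with ha
  have hc : Continuous fun x => κ x - a := hκ.continuous.sub continuous_const
  have hd : ∀ x, HasDerivAt (fun x => ∫ t in (0 : ℝ)..x, (κ t - a)) (κ x - a) x := fun x =>
    intervalIntegral.integral_hasDerivAt_right (hc.intervalIntegrable _ _)
      (hc.stronglyMeasurableAtFilter _ _) hc.continuousAt
  have hd' : deriv (fun x => ∫ t in (0 : ℝ)..x, (κ t - a)) = fun x => κ x - a :=
    funext fun x => (hd x).deriv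
  refine ⟨fun x => ∫ t in (0 : ℝ)..x, (κ t - a), ?_, ?_, ?_⟩
  · rw [contDiff_infty_iff_deriv, hd']
    exact ⟨fun x => (hd x).differentiableAt, hκ.sub contDiff_const⟩
  · intro x
    have hpc : Function.Periodic (fun t => κ t - a) F.P := fun t => by simp only [hp t]
    have h1 : ∫ t in (0 : ℝ)..F.P, (κ t - a) = 0 := by
      rw [intervalIntegral.integral_sub (hκ.continuous.intervalIntegrable _ _) (by simp),
        intervalIntegral.integral_of_le F.P_pos.le, intervalIntegral.integral_const, ha]
      have := F.P_pos.ne'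
      simp only [smul_eq_mul]
      field_simp
      ring
    have h2 := hpc.intervalIntegral_add_eq x 0
    rw [zero_add, h1] at h2
    have h3 := intervalIntegral.integral_add_adjacent_intervals (hc.intervalIntegrable 0 x)
      (hc.intervalIntegrable (μ := volume) x (x + F.P))
    simp only
    rw [← h3, h2, add_zero]
  · have : F.mean (F.contLp κ hκ.continuous) = F.contLp (fun _ => a) continuous_const := by
      rw [mean_apply, real_inner_comm, F.inner_one, integral_congr_ae (F.contLp_coeFn _), ← ha]
      refine Lp.ext ?_
      filter_upwards [Lp.coeFn_smul a F.one, F.one_coeFn,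
        F.contLp_coeFn (continuous_const (y := a))] with x h1 h2 h3
      rw [h1, h3, Pi.smul_apply, h2]; simp
    rw [this, ← contLp_sub]
    congr 1

variable {F} in
-- Du Bois-Reymond: `f - antideriv w` has weak derivative zero, and derivatives of smooth periodic
-- functions are all smooth periodic functions of mean zero, so only a constant remains. Everything
-- about `H¹_P` is read off from this representation.
lemma IsWeakDeriv.eq_add_antideriv {f w : F.L2P} (h : F.IsWeakDeriv f w) :
    f = F.mean f + F.antideriv w := by
  have hw := h.inner_one
  have h1 : F.IsWeakDeriv (f - F.antideriv w) 0 := by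
    have := h.add ((F.isWeakDeriv_antideriv hw).smul (-1))
    rwa [neg_one_smul, neg_one_smul, ← sub_eq_add_neg, ← sub_eq_add_neg, sub_self] at this
  have h2 : f - F.antideriv w - F.mean (f - F.antideriv w) = 0 := by
    refine F.eq_zero_of_inner_smooth _ fun κ hκ hp => ?_
    obtain ⟨χ, hχ, hχp, e⟩ := F.exists_deriv_eq_sub_mean hκ hp
    have h3 := (F.isWeakDeriv_iff _ _).1 h1 χ hχ hχp
    rw [e, inner_zero_left, neg_zero, inner_sub_right, ← inner_mean, ← inner_sub_left] at h3
    exact h3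
  rw [map_sub, mean_antideriv, sub_zero, sub_eq_zero, sub_eq_iff_eq_add] at h2
  exact h2

/-- Integration by parts in `H¹_P`. -/
lemma IsWeakDeriv.inner_add_inner {f w g z : F.L2P} (h : F.IsWeakDeriv f w)
    (h' : F.IsWeakDeriv g z) : inner ℝ w g + inner ℝ f z = 0 := by
  rw [h.eq_add_antideriv, h'.eq_add_antideriv, inner_add_left, inner_add_right, inner_antideriv,
    ← inner_mean, F.mean_eq_zero h.inner_one, inner_mean, F.mean_eq_zero h'.inner_one,
    inner_zero_left, inner_zero_right]
  ring

/-- Smooth periodic functions are themselves in `H¹_P`, so the weak derivative is its own negative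
adjoint with no larger domain. -/
lemma isWeakDeriv_of_forall {f w : F.L2P}
    (h : ∀ g z, F.IsWeakDeriv g z → inner ℝ w g + inner ℝ f z = 0) : F.IsWeakDeriv f w := by
  rw [isWeakDeriv_iff]
  intro χ hχ hp
  have h1 : F.IsWeakDeriv (F.contLp χ hχ.continuous)
      (F.contLp (deriv χ) (hχ.continuous_deriv (by simp))) := by
    have h2 := (F.isWeakDeriv_antideriv (F.inner_deriv_one hχ hp)).add
      (F.isWeakDeriv_one.smul (F.P⁻¹ * inner ℝ F.one (F.contLp χ hχ.continuous)))
    rw [F.antideriv_deriv hχ hp, ← mean_apply, smul_zero, add_zero, sub_add_cancel] at h2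
    exact h2
  linarith [h _ _ h1]

end Equilibrium
end VlasovMaxwell

namespace VlasovMaxwell
namespace Equilibrium

variable (F : Equilibrium)

/-! ### The transport vector field -/

/-- The vector field of the transport operator. -/
def field (z : ℝ × ℝ × ℝ) : ℝ × ℝ × ℝ :=
  (z.2.1, deriv F.φ₀ z.1 - deriv F.ψ₀ z.1 * z.2.2, deriv F.ψ₀ z.1 * z.2.1)

lemma apply_eq_sum (L : ℝ × ℝ × ℝ →L[ℝ] ℝ) (z : ℝ × ℝ × ℝ) :
    L z = z.1 * L (1, 0, 0) + z.2.1 * L (0, 1, 0) + z.2.2 * L (0, 0, 1) := by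
  have : z = z.1 • ((1, 0, 0) : ℝ × ℝ × ℝ) + z.2.1 • ((0, 1, 0) : ℝ × ℝ × ℝ)
      + z.2.2 • ((0, 0, 1) : ℝ × ℝ × ℝ) := by simp
  conv_lhs => rw [this]
  simp only [map_add, map_smul, smul_eq_mul]

lemma transport_eq (χ : ℝ × ℝ × ℝ → ℝ) (z : ℝ × ℝ × ℝ) :
    F.transport χ z = fderiv ℝ χ z (F.field z) := by
  rw [apply_eq_sum, transport, field]
  ring

lemma continuous_deriv_φ₀ : Continuous (deriv F.φ₀) := F.φ₀_contDiff.continuous_deriv (by norm_num)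

lemma continuous_deriv_ψ₀ : Continuous (deriv F.ψ₀) := F.ψ₀_contDiff.continuous_deriv (by norm_num)

lemma continuous_field : Continuous F.field := by
  have h1 := F.continuous_deriv_φ₀
  have h2 := F.continuous_deriv_ψ₀
  unfold field
  fun_prop

/-- Test functions of class `C¹`. -/
structure IsC1Test (χ : ℝ × ℝ × ℝ → ℝ) : Prop where
  contDiff : ContDiff ℝ 1 χ
  periodic : ∀ x v, χ (x + F.P, v) = χ (x, v)
  support : ∃ R : ℝ, ∀ x v, R < ‖v‖ → χ (x, v) = 0

variable {F} in
lemma IsTest.isC1Test {χ : ℝ × ℝ × ℝ → ℝ} (h : F.IsTest χ) : F.IsC1Test χ :=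
  ⟨h.contDiff.of_le (by exact_mod_cast le_top), h.periodic, h.support⟩

variable {F} in
lemma IsC1Test.fderiv_eq_zero {χ : ℝ × ℝ × ℝ → ℝ} {R : ℝ}
    (hR : ∀ x v, R < ‖v‖ → χ (x, v) = 0) (x : ℝ) (v : ℝ × ℝ) (hv : R < ‖v‖) :
    fderiv ℝ χ (x, v) = 0 := by
  have h : χ =ᶠ[nhds (x, v)] fun _ => 0 := by
    have : ∀ᶠ z : ℝ × ℝ × ℝ in nhds (x, v), R < ‖z.2‖ :=
      (continuous_snd.norm.continuousAt (x := (x, v))).eventually_const_lt hv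
    exact this.mono fun z hz => hR z.1 z.2 hz
  rw [h.fderiv_eq]; simp

variable {F} in
lemma IsC1Test.continuous_fderiv {χ : ℝ × ℝ × ℝ → ℝ} (h : F.IsC1Test χ) :
    Continuous (fderiv ℝ χ) := h.contDiff.continuous_fderiv (by simp)

variable {F} in
lemma IsC1Test.continuous_transport {χ : ℝ × ℝ × ℝ → ℝ} (h : F.IsC1Test χ) :
    Continuous (F.transport χ) := by
  have : F.transport χ = fun z => fderiv ℝ χ z (F.field z) := funext (F.transport_eq χ)
  rw [this]
  exact h.continuous_fderiv.clm_apply F.continuous_field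

variable {F} in
lemma IsC1Test.support_transport {χ : ℝ × ℝ × ℝ → ℝ} (h : F.IsC1Test χ) :
    ∃ R : ℝ, ∀ x v, R < ‖v‖ → F.transport χ (x, v) = 0 := by
  obtain ⟨R, hR⟩ := h.support
  refine ⟨R, fun x v hv => ?_⟩
  rw [transport_eq, IsC1Test.fderiv_eq_zero hR x v hv]
  rfl

lemma fderiv_periodic {χ : ℝ × ℝ × ℝ → ℝ} (h : ∀ x v, χ (x + F.P, v) = χ (x, v)) (x : ℝ)
    (v : ℝ × ℝ) : fderiv ℝ χ (x + F.P, v) = fderiv ℝ χ (x, v) := by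
  have h1 : (fun z : ℝ × ℝ × ℝ => χ (z + (F.P, 0))) = χ := funext fun z => by
    have := h z.1 z.2
    simpa [Prod.add_def] using this
  have h2 := fderiv_comp_add_right (𝕜 := ℝ) (f := χ) (x := (x, v)) ((F.P, 0) : ℝ × ℝ × ℝ)
  rw [h1] at h2
  rw [h2]
  simp

lemma exists_bound_of_periodic {G : Type*} [NormedAddCommGroup G] {κ : ℝ × ℝ × ℝ → G}
    (hκ : Continuous κ) (hp : ∀ x v, κ (x + F.P, v) = κ (x, v))
    (hs : ∃ R : ℝ, ∀ x v, R < ‖v‖ → κ (x, v) = 0) : ∃ C : ℝ, 0 ≤ C ∧ ∀ z, ‖κ z‖ ≤ C := by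
  obtain ⟨R, hR⟩ := hs
  obtain ⟨C, hC⟩ := ((isCompact_Icc (a := (0 : ℝ)) (b := F.P)).prod
    (isCompact_closedBall (0 : ℝ × ℝ) R)).exists_bound_of_continuousOn hκ.continuousOn
  refine ⟨max C 0, le_max_right _ _, fun z => ?_⟩
  by_cases hv : ‖z.2‖ ≤ R
  · have hper : Function.Periodic (fun x => κ (x, z.2)) F.P := fun x => hp x z.2
    obtain ⟨y, hy, e⟩ := hper.exists_mem_Ico₀ F.P_pos z.1
    have : κ z = κ (y, z.2) := e
    rw [this]
    exact (hC (y, z.2) ⟨Ico_subset_Icc_self hy, by simpa using hv⟩).trans (le_max_left _ _)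
  · have h0 : κ z = 0 := hR z.1 z.2 (not_le.1 hv)
    simp [h0]

/-! ### Locally square integrable functions -/

/-- The points with `|v| ≤ R`. -/
def vball (R : ℝ) : Set (ℝ × ℝ × ℝ) := {z | ‖z.2‖ ≤ R}

lemma measurableSet_vball (R : ℝ) : MeasurableSet (vball R) :=
  measurableSet_le measurable_snd.norm measurable_const

lemma base_vball_lt_top (R : ℝ) : F.base (vball R) < ⊤ := by
  have : vball R = univ ×ˢ Metric.closedBall (0 : ℝ × ℝ) R := by
    ext z; simp [vball]
  rw [this, Measure.prod_prod]
  exact ENNReal.mul_lt_top (measure_lt_top _ _)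
    ((isCompact_closedBall (0 : ℝ × ℝ) R).measure_lt_top)

instance (R : ℝ) : IsFiniteMeasure (F.base.restrict (vball R)) :=
  ⟨by rw [Measure.restrict_apply_univ]; exact F.base_vball_lt_top R⟩

lemma exists_bound_on_vball {κ : ℝ × ℝ × ℝ → ℝ} (hκ : Continuous κ) (R : ℝ) :
    ∃ C : ℝ, 0 ≤ C ∧ ∀ᵐ z ∂F.base, z ∈ vball R → |κ z| ≤ C := by
  obtain ⟨C, hC⟩ := ((isCompact_Icc (a := (0 : ℝ)) (b := F.P)).prod
    (isCompact_closedBall (0 : ℝ × ℝ) R)).exists_bound_of_continuousOn hκ.continuousOn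
  refine ⟨max C 0, le_max_right _ _, ?_⟩
  have hx : ∀ᵐ z ∂F.base, z.1 ∈ Ioc 0 F.P :=
    Measure.quasiMeasurePreserving_fst.ae (ae_restrict_mem measurableSet_Ioc)
  filter_upwards [hx] with z hz hv
  exact (hC z ⟨Ioc_subset_Icc_self hz, by simpa [vball] using hv⟩).trans (le_max_left _ _)

/-- Functions that are square integrable on bounded sets of velocities. -/
def LocL2 (h : ℝ × ℝ × ℝ → ℝ) : Prop := ∀ R : ℝ, MemLp h 2 (F.base.restrict (vball R))

lemma locL2_of_continuous {κ : ℝ × ℝ × ℝ → ℝ} (hκ : Continuous κ) : F.LocL2 κ := fun R => by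
  obtain ⟨C, -, hC⟩ := F.exists_bound_on_vball hκ R
  refine MemLp.of_bound hκ.aestronglyMeasurable C ?_
  rw [ae_restrict_iff' (measurableSet_vball R)]
  exact hC

/-- The weight `|μ_e|` is continuous and positive, hence bounded below for `x` in a period and
bounded `v`. -/
lemma locL2_L2W (h : F.L2W) : F.LocL2 h := fun R => by
  have hs : Measurable h := (Lp.stronglyMeasurable h).measurable
  have hc : Continuous fun z : ℝ × ℝ × ℝ => |F.μe z.1 z.2|⁻¹ :=
    F.continuous_μe.abs.inv₀ fun z => abs_ne_zero.2 (F.μe_lt z.1 z.2).ne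
  obtain ⟨C, hC0, hC⟩ := F.exists_bound_on_vball hc R
  refine memLp_two_iff.2 ⟨hs.aestronglyMeasurable, ?_⟩
  have h2 := (memLp_two_iff.1 (Lp.memLp h)).2
  rw [F.lintegral_measW (hs.enorm.pow_const 2)] at h2
  calc ∫⁻ z in vball R, ‖h z‖ₑ ^ 2 ∂F.base
      ≤ ∫⁻ z in vball R, ENNReal.ofReal C * (ENNReal.ofReal |F.μe z.1 z.2| * ‖h z‖ₑ ^ 2) ∂F.base := by
        refine lintegral_mono_ae ?_
        rw [ae_restrict_iff' (measurableSet_vball R)]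
        filter_upwards [hC] with z hz hzR
        have h1 := hz hzR
        have h0 : 0 < |F.μe z.1 z.2| := abs_pos.2 (F.μe_lt z.1 z.2).ne
        rw [abs_inv, abs_abs] at h1
        have h3 : 1 ≤ C * |F.μe z.1 z.2| := by
          rwa [inv_le_iff_one_le_mul₀ h0] at h1
        rw [← mul_assoc, ← ENNReal.ofReal_mul hC0]
        calc ‖h z‖ₑ ^ 2 = 1 * ‖h z‖ₑ ^ 2 := (one_mul _).symm
          _ ≤ _ := by
            refine mul_le_mul_left ?_ _
            rw [← ENNReal.ofReal_one]
            exact ENNReal.ofReal_le_ofReal h3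
    _ ≤ ∫⁻ z, ENNReal.ofReal C * (ENNReal.ofReal |F.μe z.1 z.2| * ‖h z‖ₑ ^ 2) ∂F.base :=
        setLIntegral_le_lintegral _ _
    _ < ⊤ := by
        rw [lintegral_const_mul' _ _ (by simp)]
        exact ENNReal.mul_lt_top (by simp) h2

variable {F} in
lemma LocL2.mul_continuous {h κ : ℝ × ℝ × ℝ → ℝ} (hh : F.LocL2 h) (hκ : Continuous κ) :
    F.LocL2 fun z => κ z * h z := fun R => by
  obtain ⟨C, -, hC⟩ := F.exists_bound_on_vball hκ R
  refine (hh R).of_le_mul (c := C) (hκ.aestronglyMeasurable.mul (hh R).1) ?_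
  rw [ae_restrict_iff' (measurableSet_vball R)]
  filter_upwards [hC] with z hz hzR
  rw [norm_mul]
  exact mul_le_mul_of_nonneg_right (hz hzR) (norm_nonneg _)

variable {F} in
lemma LocL2.memLp {h : ℝ × ℝ × ℝ → ℝ} (hh : F.LocL2 h) {R : ℝ}
    (hs : ∀ x v, R < ‖v‖ → h (x, v) = 0) : MemLp h 2 F.base := by
  have h1 := (memLp_indicator_iff_restrict (measurableSet_vball R)).2 (hh R)
  have : (vball R).indicator h = h := by
    rw [indicator_eq_self]
    intro z hz
    by_contra hne
    exact hz (hs z.1 z.2 (not_le.1 hne))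
  rwa [this] at h1

variable {F} in
lemma LocL2.integrable {h : ℝ × ℝ × ℝ → ℝ} (hh : F.LocL2 h)
    (hs : ∃ R : ℝ, ∀ x v, R < ‖v‖ → h (x, v) = 0) : Integrable h F.base := by
  obtain ⟨R, hs⟩ := hs
  have h1 : IntegrableOn h (vball R) F.base := (hh R).integrable (by norm_num)
  have : (vball R).indicator h = h := by
    rw [indicator_eq_self]
    intro z hz
    by_contra hne
    exact hz (hs z.1 z.2 (not_le.1 hne))
  rw [← this]
  exact h1.integrable_indicator (measurableSet_vball R)

variable {F} in
lemma LocL2.integrable_mul {h κ : ℝ × ℝ × ℝ → ℝ} (hh : F.LocL2 h) (hκ : Continuous κ)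
    (hs : ∃ R : ℝ, ∀ x v, R < ‖v‖ → κ (x, v) = 0) : Integrable (fun z => h z * κ z) F.base := by
  obtain ⟨R, hR⟩ := hs
  refine ((hh.mul_continuous hκ).integrable ⟨R, fun x v hv => ?_⟩).congr
    (.of_forall fun z => mul_comm _ _)
  rw [hR x v hv, zero_mul]

lemma integrable_of_continuous {κ : ℝ × ℝ × ℝ → ℝ} (hκ : Continuous κ)
    (hs : ∃ R : ℝ, ∀ x v, R < ‖v‖ → κ (x, v) = 0) : Integrable κ F.base :=
  (F.locL2_of_continuous hκ).integrable hs

/-! ### The divergence theorem -/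

/-- Each coefficient `a`, `c v₁`, `c v₂` is independent of the variable in which `g` is
differentiated next to it, so the field is free of divergence and integration by parts leaves
nothing. -/
lemma integral_vfield_eq_zero {g : ℝ × ℝ → ℝ} (hg : ContDiff ℝ 1 g) (hc : HasCompactSupport g)
    (a c : ℝ) : ∫ v : ℝ × ℝ, (a * fderiv ℝ g v (1, 0)
      + c * (v.1 * fderiv ℝ g v (0, 1) - v.2 * fderiv ℝ g v (1, 0))) = 0 := by
  have hd := hg.differentiable (by norm_num)
  have hcf : ∀ e, Continuous fun v => fderiv ℝ g v e := fun e =>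
    (hg.continuous_fderiv (by norm_num)).clm_apply continuous_const
  have hsf : ∀ e, HasCompactSupport fun v => fderiv ℝ g v e := fun e => hc.fderiv_apply ℝ e
  have key : ∀ (f : ℝ × ℝ → ℝ) (e : ℝ × ℝ), Continuous f → Differentiable ℝ f →
      (∀ v, fderiv ℝ f v e = 0) →
      Integrable (fun v => f v * fderiv ℝ g v e) ∧ ∫ v, f v * fderiv ℝ g v e = 0 := by
    intro f e hf hfd h0
    have i1 : Integrable (fun v => f v * fderiv ℝ g v e) :=
      (hf.mul (hcf e)).integrable_of_hasCompactSupport (hsf e).mul_left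
    refine ⟨i1, ?_⟩
    rw [integral_mul_fderiv_eq_neg_fderiv_mul_of_integrable (by simp [h0]) i1
      ((hf.mul hg.continuous).integrable_of_hasCompactSupport hc.mul_left) (fun _ _ => hfd _)
      (fun _ _ => hd _)]
    simp [h0]
  obtain ⟨i1, e1⟩ := key (fun _ => a) (1, 0) continuous_const (by fun_prop) (by simp)
  obtain ⟨i2, e2⟩ := key (fun v => c * v.1) (0, 1) (by fun_prop) (by fun_prop) fun v => by
    rw [fderiv_const_mul (by fun_prop), fderiv_fst]; simp
  obtain ⟨i3, e3⟩ := key (fun v => c * v.2) (1, 0) (by fun_prop) (by fun_prop) fun v => by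
    rw [fderiv_const_mul (by fun_prop), fderiv_snd]; simp
  have : ∀ v : ℝ × ℝ, (a * fderiv ℝ g v (1, 0)
      + c * (v.1 * fderiv ℝ g v (0, 1) - v.2 * fderiv ℝ g v (1, 0)))
      = a * fderiv ℝ g v (1, 0) + (c * v.1 * fderiv ℝ g v (0, 1) - c * v.2 * fderiv ℝ g v (1, 0)) :=
    fun v => by ring
  simp only [this]
  rw [integral_add i1 (by exact i2.sub i3), integral_sub i2 i3, e1, e2, e3]
  ring

variable {F} in
-- The `x` derivative integrates to zero over a period for each `v`, and the velocity derivatives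
-- integrate to zero for each `x` by `integral_vfield_eq_zero`.
lemma IsC1Test.integral_transport {χ : ℝ × ℝ × ℝ → ℝ} (h : F.IsC1Test χ) :
    ∫ z, F.transport χ z ∂F.base = 0 := by
  obtain ⟨R, hR⟩ := h.support
  have hd := h.contDiff.differentiable (by norm_num)
  have hcf : ∀ e, Continuous fun z => fderiv ℝ χ z e := fun e =>
    h.continuous_fderiv.clm_apply continuous_const
  have h0 : ∀ x v, R < ‖v‖ → fderiv ℝ χ (x, v) = 0 := IsC1Test.fderiv_eq_zero hR
  have i1 : Integrable (fun z : ℝ × ℝ × ℝ => z.2.1 * fderiv ℝ χ z (1, 0, 0)) F.base :=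
    F.integrable_of_continuous (by have := hcf (1, 0, 0); fun_prop)
      ⟨R, fun x v hv => by simp [h0 x v hv]⟩
  have i2 : Integrable (fun z : ℝ × ℝ × ℝ => deriv F.φ₀ z.1 * fderiv ℝ χ z (0, 1, 0)
      + deriv F.ψ₀ z.1 * (z.2.1 * fderiv ℝ χ z (0, 0, 1) - z.2.2 * fderiv ℝ χ z (0, 1, 0)))
      F.base := by
    refine F.integrable_of_continuous ?_ ⟨R, fun x v hv => by simp [h0 x v hv]⟩
    have := hcf (0, 1, 0)
    have := hcf (0, 0, 1)
    have := F.continuous_deriv_φ₀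
    have := F.continuous_deriv_ψ₀
    fun_prop
  have hsplit : ∀ z, F.transport χ z = z.2.1 * fderiv ℝ χ z (1, 0, 0)
      + (deriv F.φ₀ z.1 * fderiv ℝ χ z (0, 1, 0)
      + deriv F.ψ₀ z.1 * (z.2.1 * fderiv ℝ χ z (0, 0, 1) - z.2.2 * fderiv ℝ χ z (0, 1, 0))) :=
    fun z => by rw [transport]; ring
  simp only [hsplit]
  rw [integral_add i1 i2, integral_prod_symm _ i1, integral_prod _ i2]
  have e1 : ∀ v : ℝ × ℝ, ∫ x, v.1 * fderiv ℝ χ (x, v) (1, 0, 0) ∂F.perMeas = 0 := fun v => by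
    rw [integral_const_mul, ← intervalIntegral.integral_of_le F.P_pos.le]
    have hx : ∀ x, HasDerivAt (fun x => χ (x, v)) (fderiv ℝ χ (x, v) (1, 0, 0)) x := fun x =>
      (hd (x, v)).hasFDerivAt.comp_hasDerivAt x ((hasDerivAt_id x).prodMk (hasDerivAt_const x v))
    rw [intervalIntegral.integral_eq_sub_of_hasDerivAt (fun x _ => hx x)
      (((hcf (1, 0, 0)).comp (Continuous.prodMk_left v)).intervalIntegrable _ _)]
    have := h.periodic 0 v
    rw [zero_add] at this
    rw [this, sub_self, mul_zero]
  have e2 : ∀ x : ℝ, ∫ v : ℝ × ℝ, (deriv F.φ₀ x * fderiv ℝ χ (x, v) (0, 1, 0)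
      + deriv F.ψ₀ x * (v.1 * fderiv ℝ χ (x, v) (0, 0, 1) - v.2 * fderiv ℝ χ (x, v) (0, 1, 0)))
      = 0 := fun x => by
    have hg : ContDiff ℝ 1 fun v : ℝ × ℝ => χ (x, v) := h.contDiff.comp (contDiff_prodMk_right x)
    have hc : HasCompactSupport fun v : ℝ × ℝ => χ (x, v) :=
      HasCompactSupport.intro (isCompact_closedBall (0 : ℝ × ℝ) R) fun v hv => hR x v (by
        simpa using hv)
    have hf : ∀ v e, fderiv ℝ (fun v : ℝ × ℝ => χ (x, v)) v e = fderiv ℝ χ (x, v) (0, e) :=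
      fun v e => by
        have := (hd (x, v)).hasFDerivAt.comp v (hasFDerivAt_prodMk_right x v)
        have h2 : fderiv ℝ (fun v : ℝ × ℝ => χ (x, v)) v
          = (fderiv ℝ χ (x, v)).comp (ContinuousLinearMap.inr ℝ ℝ (ℝ × ℝ)) := this.fderiv
        rw [h2]; simp
    have := integral_vfield_eq_zero hg hc (deriv F.φ₀ x) (deriv F.ψ₀ x)
    simpa only [hf] using this
  simp only [e1, e2, integral_zero, add_zero]

lemma transport_mul {f g : ℝ × ℝ × ℝ → ℝ} {z : ℝ × ℝ × ℝ} (hf : DifferentiableAt ℝ f z)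
    (hg : DifferentiableAt ℝ g z) :
    F.transport (fun z => f z * g z) z = f z * F.transport g z + g z * F.transport f z := by
  rw [transport_eq, transport_eq, transport_eq, fderiv_fun_mul hf hg]
  simp

end Equilibrium
end VlasovMaxwell

namespace VlasovMaxwell
namespace Equilibrium

variable (F : Equilibrium)

/-! ### Test functions of class `C¹` -/

instance isAddHaarMeasure_volume₂ : (volume : Measure (ℝ × ℝ)).IsAddHaarMeasure :=
  Measure.prod.instIsAddHaarMeasure _ _

instance isAddHaarMeasure_volume₃ : (volume : Measure (ℝ × ℝ × ℝ)).IsAddHaarMeasure :=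
  Measure.prod.instIsAddHaarMeasure _ _

/-- A sequence of mollifiers on phase space. -/
def mollifier (n : ℕ) : ContDiffBump (0 : ℝ × ℝ × ℝ) :=
  ⟨1 / (n + 1 : ℝ) / 2, 1 / (n + 1 : ℝ), by positivity, half_lt_self (by positivity)⟩

lemma tendsto_mollifier_rOut :
    Filter.Tendsto (fun n => (mollifier n).rOut) Filter.atTop (nhds 0) :=
  tendsto_one_div_add_atTop_nhds_zero_nat

/-- The mollification of `g`. -/
def mollify {G : Type*} [NormedAddCommGroup G] [NormedSpace ℝ G] (n : ℕ) (g : ℝ × ℝ × ℝ → G) :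
    ℝ × ℝ × ℝ → G :=
  MeasureTheory.convolution ((mollifier n).normed volume) g (ContinuousLinearMap.lsmul ℝ ℝ) volume

section Mollify

variable {G : Type*} [NormedAddCommGroup G] [NormedSpace ℝ G]

lemma mollify_apply (n : ℕ) (g : ℝ × ℝ × ℝ → G) (z : ℝ × ℝ × ℝ) :
    mollify n g z = ∫ t, (mollifier n).normed volume t • g (z - t) := rfl

lemma contDiff_mollify (n : ℕ) {g : ℝ × ℝ × ℝ → ℝ} (hg : Continuous g) :
    ContDiff ℝ (⊤ : ℕ∞) (mollify n g) :=
  (mollifier n).hasCompactSupport_normed.contDiff_convolution_left _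
    (mollifier n).contDiff_normed hg.locallyIntegrable

lemma tendsto_mollify [CompleteSpace G] {g : ℝ × ℝ × ℝ → G} (hg : Continuous g) (z : ℝ × ℝ × ℝ) :
    Filter.Tendsto (fun n => mollify n g z) Filter.atTop (nhds (g z)) :=
  ContDiffBump.convolution_tendsto_right_of_continuous tendsto_mollifier_rOut hg z

lemma mollify_eq_zero (n : ℕ) {g : ℝ × ℝ × ℝ → G} {R : ℝ} (hR : ∀ x v, R < ‖v‖ → g (x, v) = 0)
    (x : ℝ) (v : ℝ × ℝ) (hv : R + 1 < ‖v‖) : mollify n g (x, v) = 0 := by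
  rw [mollify_apply]
  refine integral_eq_zero_of_ae (.of_forall fun t => ?_)
  by_cases ht : (mollifier n).normed volume t = 0
  · simp [ht]
  · have h1 : t ∈ Function.support ((mollifier n).normed volume) := ht
    rw [(mollifier n).support_normed_eq] at h1
    have h2 : ‖t‖ < 1 := by
      refine (mem_ball_zero_iff.1 h1).trans_le ?_
      simp only [mollifier]
      rw [div_le_one (by positivity)]
      linarith [(Nat.cast_nonneg n : (0 : ℝ) ≤ n)]
    have h3 : ‖t.2‖ ≤ ‖t‖ := norm_snd_le t
    have h4 : ‖v‖ ≤ ‖v - t.2‖ + ‖t.2‖ := by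
      simpa using norm_add_le (v - t.2) t.2
    have : g ((x, v) - t) = 0 := hR _ _ (by linarith)
    simp [this]

lemma norm_mollify_le (n : ℕ) {g : ℝ × ℝ × ℝ → G} {C : ℝ} (hC : ∀ z, ‖g z‖ ≤ C)
    (z : ℝ × ℝ × ℝ) : ‖mollify n g z‖ ≤ C := by
  rw [mollify_apply]
  have hi : Integrable ((mollifier n).normed (volume : Measure (ℝ × ℝ × ℝ))) volume :=
    (mollifier n).integrable_normed
  have h1 : ‖∫ t, (mollifier n).normed volume t • g (z - t)‖
      ≤ ∫ t, (mollifier n).normed volume t * C := by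
    refine norm_integral_le_of_norm_le (hi.mul_const C) (.of_forall fun t => ?_)
    rw [norm_smul, Real.norm_of_nonneg ((mollifier n).nonneg_normed t)]
    exact mul_le_mul_of_nonneg_left (hC _) ((mollifier n).nonneg_normed t)
  rwa [integral_mul_const, (mollifier n).integral_normed, one_mul] at h1

/-- The derivative falls on `g`, so mollification commutes with it and bounds on `fderiv ℝ g` are
preserved. -/
lemma hasFDerivAt_mollify (n : ℕ) {g : ℝ × ℝ × ℝ → ℝ} (hg : ContDiff ℝ 1 g) {C : ℝ}
    (hC : ∀ z, ‖fderiv ℝ g z‖ ≤ C) (z : ℝ × ℝ × ℝ) :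
    HasFDerivAt (mollify n g) (mollify n (fderiv ℝ g) z) z := by
  have hcn : Continuous ((mollifier n).normed (volume : Measure (ℝ × ℝ × ℝ))) :=
    (mollifier n).continuous_normed
  have hsn := (mollifier n).hasCompactSupport_normed (μ := (volume : Measure (ℝ × ℝ × ℝ)))
  have hdg : Continuous (fderiv ℝ g) := hg.continuous_fderiv (by norm_num)
  refine hasFDerivAt_integral_of_dominated_of_fderiv_le (𝕜 := ℝ) (s := univ)
    (F := fun z t => (mollifier n).normed volume t • g (z - t))
    (F' := fun z t => (mollifier n).normed volume t • fderiv ℝ g (z - t))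
    (bound := fun t => (mollifier n).normed volume t * C) Filter.univ_mem ?_ ?_ ?_ ?_ ?_ ?_
  · refine .of_forall fun y => Continuous.aestronglyMeasurable ?_
    exact hcn.smul (hg.continuous.comp (by fun_prop))
  · exact (hcn.smul (hg.continuous.comp (by fun_prop))).integrable_of_hasCompactSupport
      hsn.smul_right
  · exact (hcn.smul (hdg.comp (by fun_prop))).aestronglyMeasurable
  · refine .of_forall fun t y _ => ?_
    rw [norm_smul, Real.norm_of_nonneg ((mollifier n).nonneg_normed t)]
    exact mul_le_mul_of_nonneg_left (hC _) ((mollifier n).nonneg_normed t)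
  · exact (mollifier n).integrable_normed.mul_const C
  · refine .of_forall fun t y _ => ?_
    have h1 := ((hg.differentiable (by norm_num)) (y - t)).hasFDerivAt.comp y
      ((hasFDerivAt_id y).sub_const t)
    exact h1.const_smul ((mollifier n).normed volume t)

end Mollify

/-- `D h = w` in the sense of distributions, for locally square integrable functions. -/
structure IsWeakTransport (h w : ℝ × ℝ × ℝ → ℝ) : Prop where
  locL2 : F.LocL2 h
  locL2' : F.LocL2 w
  eq : ∀ χ, F.IsC1Test χ → ∫ z, h z * F.transport χ z ∂F.base = -∫ z, w z * χ z ∂F.base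

variable {F} in
lemma isTest_mollify (n : ℕ) {χ : ℝ × ℝ × ℝ → ℝ} (h : F.IsC1Test χ) : F.IsTest (mollify n χ) := by
  obtain ⟨R, hR⟩ := h.support
  refine ⟨contDiff_mollify n h.contDiff.continuous, fun x v => ?_,
    R + 1, fun x v hv => mollify_eq_zero n hR x v hv⟩
  rw [mollify_apply, mollify_apply]
  refine integral_congr_ae (.of_forall fun t => ?_)
  have : ((x + F.P, v) : ℝ × ℝ × ℝ) - t = (((x, v) - t).1 + F.P, ((x, v) - t).2) := by
    ext <;> simp; ring
  simp only [this, h.periodic]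

variable {F} in
-- Test functions of class `C¹` are needed because products with functions of the invariants are
-- only that smooth. They are reached by mollification: values and derivatives converge pointwise,
-- with uniform bounds and support in `|v| ≤ R + 1`, so dominated convergence applies.
lemma IsTransport.isWeakTransport {h w : F.L2W} (hhw : F.IsTransport h w) :
    F.IsWeakTransport h w := by
  refine ⟨F.locL2_L2W h, F.locL2_L2W w, fun χ hχ => ?_⟩
  obtain ⟨R, hR⟩ := hχ.support
  obtain ⟨C₀, hC₀, hb₀⟩ := F.exists_bound_of_periodic hχ.contDiff.continuous hχ.periodic ⟨R, hR⟩
  have hdR : ∀ x v, R < ‖v‖ → fderiv ℝ χ (x, v) = 0 := IsC1Test.fderiv_eq_zero hR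
  obtain ⟨C, hC, hb⟩ := F.exists_bound_of_periodic hχ.continuous_fderiv
    (F.fderiv_periodic hχ.periodic) ⟨R, hdR⟩
  have hfd : ∀ n z, fderiv ℝ (mollify n χ) z = mollify n (fderiv ℝ χ) z := fun n z =>
    (hasFDerivAt_mollify n hχ.contDiff hb z).fderiv
  have heq := fun n => hhw _ (isTest_mollify n hχ)
  have hlim1 : Filter.Tendsto (fun n => ∫ z, h z * F.transport (mollify n χ) z ∂F.base)
      Filter.atTop (nhds (∫ z, h z * F.transport χ z ∂F.base)) := by
    have hi : Integrable (fun z => (vball (R + 1)).indicator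
        (fun z => C * (‖F.field z‖ * ‖h z‖)) z) F.base := by
      have h1 := (((F.locL2_L2W h).mul_continuous F.continuous_field.norm (R + 1)).integrable
        (by norm_num)).norm.const_mul C
      refine (IntegrableOn.integrable_indicator ?_ (measurableSet_vball _))
      refine Integrable.congr h1 (.of_forall fun z => ?_)
      simp
    refine tendsto_integral_of_dominated_convergence _ (fun n => ?_) hi (fun n => ?_) ?_
    · exact ((Lp.stronglyMeasurable h).aestronglyMeasurable).mul
        ((isTest_mollify n hχ).isC1Test.continuous_transport.aestronglyMeasurable)
    · refine .of_forall fun z => ?_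
      by_cases hz : z ∈ vball (R + 1)
      · rw [indicator_of_mem hz, norm_mul, transport_eq, hfd, mul_comm ‖h z‖, ← mul_assoc]
        refine mul_le_mul_of_nonneg_right ?_ (norm_nonneg _)
        exact (ContinuousLinearMap.le_opNorm _ _).trans
          (mul_le_mul_of_nonneg_right (norm_mollify_le n hb z) (norm_nonneg _))
      · rw [indicator_of_notMem hz, transport_eq, hfd,
          show z = (z.1, z.2) from rfl, mollify_eq_zero n hdR z.1 z.2 (not_le.1 hz)]
        simp
    · refine .of_forall fun z => Filter.Tendsto.const_mul _ ?_
      simp only [transport_eq, hfd]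
      exact ((ContinuousLinearMap.apply ℝ ℝ (F.field z)).continuous.tendsto _).comp
        (tendsto_mollify hχ.continuous_fderiv z)
  have hlim2 : Filter.Tendsto (fun n => ∫ z, w z * mollify n χ z ∂F.base)
      Filter.atTop (nhds (∫ z, w z * χ z ∂F.base)) := by
    have hi : Integrable (fun z => (vball (R + 1)).indicator (fun z => C₀ * ‖w z‖) z) F.base :=
      IntegrableOn.integrable_indicator
        (((F.locL2_L2W w (R + 1)).integrable (by norm_num)).norm.const_mul C₀)
        (measurableSet_vball _)
    refine tendsto_integral_of_dominated_convergence _ (fun n => ?_) hi (fun n => ?_) ?_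
    · exact ((Lp.stronglyMeasurable w).aestronglyMeasurable).mul
        ((isTest_mollify n hχ).contDiff.continuous.aestronglyMeasurable)
    · refine .of_forall fun z => ?_
      by_cases hz : z ∈ vball (R + 1)
      · rw [indicator_of_mem hz, norm_mul, mul_comm]
        exact mul_le_mul_of_nonneg_right (norm_mollify_le n hb₀ z) (norm_nonneg _)
      · rw [indicator_of_notMem hz,
          show z = (z.1, z.2) from rfl, mollify_eq_zero n hR z.1 z.2 (not_le.1 hz)]
        simp
    · exact .of_forall fun z => (tendsto_mollify hχ.contDiff.continuous z).const_mul _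
  refine tendsto_nhds_unique hlim1 ?_
  simp only [heq]
  exact hlim2.neg

/-! ### Functions of the invariants -/

/-- The invariants `(e, p)`. -/
def inv (z : ℝ × ℝ × ℝ) : ℝ × ℝ := (energy F.φ₀ z.1 z.2, momentum F.ψ₀ z.1 z.2)

lemma continuous_inv : Continuous F.inv := F.continuous_ep

lemma contDiff_inv : ContDiff ℝ 1 F.inv := by
  have h1 : ContDiff ℝ 1 F.φ₀ := F.φ₀_contDiff.of_le (by norm_num)
  have h2 : ContDiff ℝ 1 F.ψ₀ := F.ψ₀_contDiff.of_le (by norm_num)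
  unfold inv energy momentum
  fun_prop

lemma inv_periodic (x : ℝ) (v : ℝ × ℝ) : F.inv (x + F.P, v) = F.inv (x, v) := by
  simp only [inv, energy, momentum, F.φ₀_periodic x, F.ψ₀_periodic x]

/-- Conservation of the energy `e` and of the momentum `p` along the flow. -/
lemma fderiv_inv_field (z : ℝ × ℝ × ℝ) : fderiv ℝ F.inv z (F.field z) = 0 := by
  have h1 : HasDerivAt F.φ₀ (deriv F.φ₀ z.1) z.1 :=
    (F.φ₀_contDiff.differentiable (by norm_num) z.1).hasDerivAt
  have h2 : HasDerivAt F.ψ₀ (deriv F.ψ₀ z.1) z.1 :=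
    (F.ψ₀_contDiff.differentiable (by norm_num) z.1).hasDerivAt
  have hx : HasFDerivAt (fun z : ℝ × ℝ × ℝ => z.1) (ContinuousLinearMap.fst ℝ ℝ (ℝ × ℝ)) z :=
    hasFDerivAt_fst
  have hv : HasFDerivAt (fun z : ℝ × ℝ × ℝ => z.2) (ContinuousLinearMap.snd ℝ ℝ (ℝ × ℝ)) z :=
    hasFDerivAt_snd
  have hv1 := (hasFDerivAt_fst (𝕜 := ℝ) (E := ℝ) (F := ℝ) (p := z.2)).comp z hv
  have hv2 := (hasFDerivAt_snd (𝕜 := ℝ) (E := ℝ) (F := ℝ) (p := z.2)).comp z hv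
  have he := ((((hv1.pow 2).add (hv2.pow 2)).const_mul (1 / 2 : ℝ)).sub
    (h1.hasFDerivAt.comp z hx)).prodMk (hv2.sub (h2.hasFDerivAt.comp z hx))
  have he' := he.congr_of_eventuallyEq (f₁ := F.inv) (.of_forall fun y => by
    simp [inv, energy, momentum]
    ring)
  rw [he'.fderiv]
  simp only [field, Prod.mk_eq_zero, ContinuousLinearMap.prod_apply]
  constructor <;> simp <;> ring

variable {F} in
lemma IsC1Test.mul_inv {χ : ℝ × ℝ × ℝ → ℝ} (hχ : F.IsC1Test χ) {M : ℝ × ℝ → ℝ}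
    (hM : ContDiff ℝ 1 M) : F.IsC1Test fun z => M (F.inv z) * χ z := by
  refine ⟨(hM.comp F.contDiff_inv).mul hχ.contDiff, fun x v => ?_, ?_⟩
  · simp only [inv_periodic, hχ.periodic]
  · obtain ⟨R, hR⟩ := hχ.support
    exact ⟨R, fun x v hv => by simp [hR x v hv]⟩

lemma transport_inv {M : ℝ × ℝ → ℝ} (hM : ContDiff ℝ 1 M) (z : ℝ × ℝ × ℝ) :
    F.transport (fun z => M (F.inv z)) z = 0 := by
  have := ((hM.differentiable (by norm_num)) (F.inv z)).hasFDerivAt.comp z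
    (F.contDiff_inv.differentiable (by norm_num) z).hasFDerivAt
  have h2 : fderiv ℝ (fun z => M (F.inv z)) z
    = (fderiv ℝ M (F.inv z)).comp (fderiv ℝ F.inv z) := this.fderiv
  rw [transport_eq, h2]
  simp [fderiv_inv_field]

lemma transport_inv_mul {M : ℝ × ℝ → ℝ} (hM : ContDiff ℝ 1 M) {χ : ℝ × ℝ × ℝ → ℝ}
    {z : ℝ × ℝ × ℝ} (hχ : DifferentiableAt ℝ χ z) :
    F.transport (fun z => M (F.inv z) * χ z) z = M (F.inv z) * F.transport χ z := by
  have h1 : DifferentiableAt ℝ (fun z => M (F.inv z)) z :=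
    (hM.comp F.contDiff_inv).differentiable (by norm_num) z
  rw [F.transport_mul h1 hχ, F.transport_inv hM, mul_zero, add_zero]

lemma exists_contDiff_near {M : ℝ × ℝ → ℝ} (hM : Continuous M) {K : Set (ℝ × ℝ)}
    (hK : IsCompact K) {ε : ℝ} (hε : 0 < ε) :
    ∃ g : ℝ × ℝ → ℝ, ContDiff ℝ 1 g ∧ ∀ y ∈ K, |g y - M y| < ε := by
  have h := ContinuousMap.dense_setOfPred_contDiff (E := ℝ × ℝ) (F := ℝ) ⟨M, hM⟩
  rw [mem_closure_iff_nhds_basis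
    (nhds_basis_uniformity Metric.uniformity_basis_dist.compactConvergenceUniformity)] at h
  obtain ⟨g, hg, h⟩ := h (K, ε) ⟨hK, hε⟩
  exact ⟨g, ContDiff.of_le (mem_ofPred_eq ▸ hg) (by exact_mod_cast le_top), fun y hy => h y hy⟩

/-- The invariants map the support of `u` over one period into a compact set, on which a continuous
`M` is a uniform limit of `C¹` functions. This matters since `μ_e` is only continuous in `(e, p)`.
-/
lemma integral_inv_mul_eq_zero {u : ℝ × ℝ × ℝ → ℝ} (hu : Integrable u F.base)
    (hs : ∃ R : ℝ, ∀ x v, R < ‖v‖ → u (x, v) = 0)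
    (h : ∀ M : ℝ × ℝ → ℝ, ContDiff ℝ 1 M → ∫ z, M (F.inv z) * u z ∂F.base = 0)
    {M : ℝ × ℝ → ℝ} (hM : Continuous M) : ∫ z, M (F.inv z) * u z ∂F.base = 0 := by
  obtain ⟨R, hR⟩ := hs
  set K := F.inv '' (Icc 0 F.P ×ˢ Metric.closedBall 0 R) with hK
  have hKc : IsCompact K := (isCompact_Icc.prod (isCompact_closedBall _ _)).image F.continuous_inv
  have hx : ∀ᵐ z ∂F.base, z.1 ∈ Ioc 0 F.P :=
    Measure.quasiMeasurePreserving_fst.ae (ae_restrict_mem measurableSet_Ioc)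
  have hint : ∀ M : ℝ × ℝ → ℝ, Continuous M → Integrable (fun z => M (F.inv z) * u z) F.base := by
    intro M hM
    obtain ⟨C, hC⟩ := hKc.exists_bound_of_continuousOn hM.continuousOn
    refine (hu.norm.const_mul C).mono' ((hM.comp F.continuous_inv).aestronglyMeasurable.mul hu.1) ?_
    filter_upwards [hx] with z hz
    by_cases hv : ‖z.2‖ ≤ R
    · rw [norm_mul]
      refine mul_le_mul_of_nonneg_right (hC _ ?_) (norm_nonneg _)
      exact ⟨z, ⟨Ioc_subset_Icc_self hz, by simpa using hv⟩, rfl⟩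
    · have : u z = 0 := hR z.1 z.2 (not_le.1 hv)
      simp [this]
  rw [← abs_eq_zero]
  refine le_antisymm (le_of_forall_pos_le_add fun ε hε => ?_) (abs_nonneg _)
  set I := ∫ z, |u z| ∂F.base with hI
  have hI0 : 0 ≤ I := integral_nonneg fun _ => abs_nonneg _
  obtain ⟨g, hg, hgM⟩ := exists_contDiff_near hM hKc (show 0 < ε / (I + 1) by positivity)
  have h1 : ∫ z, M (F.inv z) * u z ∂F.base = ∫ z, (M (F.inv z) - g (F.inv z)) * u z ∂F.base := by
    have : ∀ z, (M (F.inv z) - g (F.inv z)) * u z = M (F.inv z) * u z - g (F.inv z) * u z :=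
      fun z => by ring
    simp only [this]
    rw [integral_sub (hint M hM) (hint g hg.continuous), h g hg, sub_zero]
  rw [h1, zero_add]
  have h2 : |∫ z, (M (F.inv z) - g (F.inv z)) * u z ∂F.base|
      ≤ ∫ z, ε / (I + 1) * |u z| ∂F.base := by
    rw [← Real.norm_eq_abs]
    refine norm_integral_le_of_norm_le (hu.norm.const_mul _) ?_
    filter_upwards [hx] with z hz
    by_cases hv : ‖z.2‖ ≤ R
    · rw [norm_mul, Real.norm_eq_abs, Real.norm_eq_abs, abs_sub_comm]
      refine mul_le_mul_of_nonneg_right (hgM _ ?_).le (abs_nonneg _)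
      exact ⟨z, ⟨Ioc_subset_Icc_self hz, by simpa using hv⟩, rfl⟩
    · have : u z = 0 := hR z.1 z.2 (not_le.1 hv)
      simp [this]
  refine h2.trans ?_
  rw [integral_const_mul, ← hI, div_mul_eq_mul_div, div_le_iff₀ (by positivity)]
  nlinarith

variable {F} in
/-- `∫ M(e, p) D χ = 0` -/
lemma IsC1Test.integral_inv_mul_transport {χ : ℝ × ℝ × ℝ → ℝ} (hχ : F.IsC1Test χ) {M : ℝ × ℝ → ℝ}
    (hM : Continuous M) : ∫ z, M (F.inv z) * F.transport χ z ∂F.base = 0 := by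
  refine F.integral_inv_mul_eq_zero
    (F.integrable_of_continuous hχ.continuous_transport hχ.support_transport)
    hχ.support_transport (fun M hM => ?_) hM
  rw [← (hχ.mul_inv hM).integral_transport]
  refine integral_congr_ae (.of_forall fun z => ?_)
  exact (F.transport_inv_mul hM (hχ.contDiff.differentiable (by norm_num) z)).symm

variable {F} in
/-- Multiplication by functions of the invariants commutes with `D`. -/
lemma IsWeakTransport.inv_mul {h w : ℝ × ℝ × ℝ → ℝ} (hhw : F.IsWeakTransport h w)
    {M : ℝ × ℝ → ℝ} (hM : Continuous M) :
    F.IsWeakTransport (fun z => M (F.inv z) * h z) fun z => M (F.inv z) * w z := by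
  have hMc : Continuous fun z => M (F.inv z) := hM.comp F.continuous_inv
  refine ⟨hhw.locL2.mul_continuous hMc, hhw.locL2'.mul_continuous hMc, fun χ hχ => ?_⟩
  have i1 := hhw.locL2.integrable_mul hχ.continuous_transport hχ.support_transport
  have i2 := hhw.locL2'.integrable_mul hχ.contDiff.continuous hχ.support
  have hs : ∃ R : ℝ, ∀ x v, R < ‖v‖ → h (x, v) * F.transport χ (x, v) + w (x, v) * χ (x, v) = 0 := by
    obtain ⟨R, hR⟩ := hχ.support
    exact ⟨R, fun x v hv => by
      rw [transport_eq, IsC1Test.fderiv_eq_zero hR x v hv, hR x v hv]; simp⟩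
  -- For `M` of class `C¹` the weak equation is tested with `M(e, p) χ`; the combination `h D χ + w
  -- χ` then admits the passage to continuous `M`.
  have key := F.integral_inv_mul_eq_zero (i1.add i2) hs (fun M hM => by
    have h1 := hhw.eq _ (hχ.mul_inv hM)
    have e1 : ∀ z, F.transport (fun z => M (F.inv z) * χ z) z = M (F.inv z) * F.transport χ z :=
      fun z => F.transport_inv_mul hM (hχ.contDiff.differentiable (by norm_num) z)
    simp only [e1] at h1
    rw [eq_neg_iff_add_eq_zero, ← integral_add] at h1
    · rw [← h1]
      refine integral_congr_ae (.of_forall fun z => ?_)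
      simp only [Pi.add_apply]
      ring
    · refine hhw.locL2.integrable_mul
        ((hM.continuous.comp F.continuous_inv).mul hχ.continuous_transport) ?_
      obtain ⟨R, hR⟩ := hχ.support_transport
      exact ⟨R, fun x v hv => by simp [hR x v hv]⟩
    · exact hhw.locL2'.integrable_mul (hχ.mul_inv hM).contDiff.continuous (hχ.mul_inv hM).support)
    hM
  rw [eq_neg_iff_add_eq_zero, ← integral_add]
  · rw [← key]
    refine integral_congr_ae (.of_forall fun z => ?_)
    simp only [Pi.add_apply]
    ring
  · exact (hhw.locL2.mul_continuous hMc).integrable_mul hχ.continuous_transport hχ.support_transport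
  · exact (hhw.locL2'.mul_continuous hMc).integrable_mul hχ.contDiff.continuous hχ.support

end Equilibrium
end VlasovMaxwell

namespace VlasovMaxwell

/-! ### A cutoff function -/

/-- A smooth even cutoff function, equal to `1` for `y² ≤ 1/2` and to `0` for `y² ≥ 1`. -/
def cutoff (y : ℝ) : ℝ := Real.smoothTransition (2 - 2 * y ^ 2)

lemma contDiff_cutoff : ContDiff ℝ (⊤ : ℕ∞) cutoff :=
  Real.smoothTransition.contDiff.comp (by fun_prop)

lemma continuous_cutoff : Continuous cutoff := contDiff_cutoff.continuous

lemma cutoff_nonneg (y : ℝ) : 0 ≤ cutoff y := Real.smoothTransition.nonneg _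

lemma cutoff_le_one (y : ℝ) : cutoff y ≤ 1 := Real.smoothTransition.le_one _

lemma cutoff_eq_one {y : ℝ} (h : y ^ 2 ≤ 1 / 2) : cutoff y = 1 :=
  Real.smoothTransition.one_of_one_le (by linarith)

lemma cutoff_eq_zero {y : ℝ} (h : 1 ≤ |y|) : cutoff y = 0 :=
  Real.smoothTransition.zero_of_nonpos (by nlinarith [sq_abs y])

lemma cutoff_neg (y : ℝ) : cutoff (-y) = cutoff y := by simp [cutoff]

lemma hasDerivAt_cutoff (y : ℝ) : HasDerivAt cutoff (deriv cutoff y) y :=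
  (contDiff_cutoff.differentiable (by simp) y).hasDerivAt

lemma hasCompactSupport_cutoff : HasCompactSupport cutoff :=
  HasCompactSupport.intro (isCompact_closedBall (0 : ℝ) 1) fun y hy =>
    cutoff_eq_zero (by simpa using (not_le.1 (by simpa using hy : ¬ |y| ≤ 1)).le)

lemma deriv_cutoff_eq_zero {y : ℝ} (h : 1 < |y|) : deriv cutoff y = 0 := by
  have : cutoff =ᶠ[nhds y] fun _ => 0 := by
    have : ∀ᶠ t : ℝ in nhds y, 1 < |t| := continuous_abs.continuousAt.eventually_const_lt h
    exact this.mono fun t ht => cutoff_eq_zero ht.le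
  rw [this.deriv_eq]; simp

lemma exists_deriv_cutoff_le : ∃ T : ℝ, 0 ≤ T ∧ ∀ y, |deriv cutoff y| ≤ T := by
  obtain ⟨T, hT⟩ := (hasCompactSupport_cutoff.deriv).exists_bound_of_continuous
    (contDiff_cutoff.continuous_deriv (by simp))
  exact ⟨T, (norm_nonneg _).trans (hT 0), hT⟩

lemma integral_cutoff_pos : 0 < ∫ y, cutoff y :=
  continuous_cutoff.integral_pos_of_hasCompactSupport_nonneg_nonzero hasCompactSupport_cutoff
    cutoff_nonneg (x := 0) (by rw [cutoff_eq_one (by norm_num)]; norm_num)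

namespace Equilibrium

variable (F : Equilibrium)

/-! ### The periodic mollification kernel -/

/-- The periodic sine. -/
def psin (x : ℝ) : ℝ := Real.sin (Real.pi * x / F.P)

lemma psin_neg (x : ℝ) : F.psin (-x) = -F.psin x := by
  simp [psin, neg_div]

lemma psin_add_P (x : ℝ) : F.psin (x + F.P) = -F.psin x := by
  have := F.P_pos.ne'
  rw [psin, psin, show Real.pi * (x + F.P) / F.P = Real.pi * x / F.P + Real.pi by field_simp,
    Real.sin_add_pi]

lemma abs_psin_sub_int (x : ℝ) (k : ℤ) : |F.psin (x - k * F.P)| = |F.psin x| := by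
  have := F.P_pos.ne'
  rw [psin, psin,
    show Real.pi * (x - k * F.P) / F.P = Real.pi * x / F.P - k * Real.pi by field_simp,
    Real.sin_sub_int_mul_pi, abs_mul, abs_zpow]
  simp

/-- Jordan's inequality. It makes `|psin|` comparable from below with the distance to `P ℤ`, so it
serves as a smooth periodic substitute for that distance. -/
lemma le_abs_psin {t : ℝ} (ht : |t| ≤ F.P / 2) : 2 / F.P * |t| ≤ |F.psin t| := by
  have hP := F.P_pos
  have h1 : |F.psin t| = |F.psin (abs t)| := by
    rcases abs_choice t with h | h
    · rw [h]
    · rw [h, psin_neg, abs_neg]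
  rw [h1]
  refine le_trans ?_ (le_abs_self _)
  have h2 : Real.pi * |t| / F.P ≤ Real.pi / 2 := by
    rw [div_le_div_iff₀ hP (by norm_num)]
    nlinarith [Real.pi_pos]
  have h3 := Real.mul_le_sin (x := Real.pi * |t| / F.P)
    (by have := Real.pi_pos; positivity) h2
  refine le_trans (le_of_eq ?_) h3
  have := Real.pi_pos.ne'
  field_simp

/-- Lipschitz continuity of periodic functions, in terms of `psin`. -/
lemma norm_sub_le_of_periodic {G : Type*} [NormedAddCommGroup G] {κ : ℝ × ℝ × ℝ → G} {C : ℝ}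
    (hC : 0 ≤ C) (hL : ∀ z z', ‖κ z - κ z'‖ ≤ C * ‖z - z'‖)
    (hp : ∀ x v, κ (x + F.P, v) = κ (x, v)) (z z' : ℝ × ℝ × ℝ) :
    ‖κ z - κ z'‖ ≤ C * (F.P / 2 * |F.psin (z.1 - z'.1)| + ‖z.2 - z'.2‖) := by
  have hP := F.P_pos
  -- Translating by the nearest multiple of the period brings the difference in `x` into `[-P/2,
  -- P/2]`.
  set k : ℤ := round ((z.1 - z'.1) / F.P) with hk
  set t : ℝ := z.1 - z'.1 - k * F.P with ht
  have hper : Function.Periodic (fun x => κ (x, z.2)) F.P := fun x => hp x z.2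
  have h1 : κ z = κ (z'.1 + t, z.2) := by
    have := hper.sub_int_mul_eq (x := z.1) k
    rw [show z'.1 + t = z.1 - k * F.P by rw [ht]; ring, this]
  have h2 : |t| ≤ F.P / 2 := by
    have h3 := abs_sub_round ((z.1 - z'.1) / F.P)
    have : t = ((z.1 - z'.1) / F.P - k) * F.P := by rw [ht]; field_simp
    rw [this, abs_mul, abs_of_pos hP]
    nlinarith
  have h4 := F.le_abs_psin h2
  rw [ht, F.abs_psin_sub_int, ← ht, div_mul_eq_mul_div, div_le_iff₀ hP] at h4
  rw [h1]
  refine (hL _ _).trans (mul_le_mul_of_nonneg_left ?_ hC)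
  have h5 : ‖((z'.1 + t, z.2) : ℝ × ℝ × ℝ) - z'‖ ≤ |t| + ‖z.2 - z'.2‖ := by
    rw [Prod.norm_def]
    refine max_le ?_ ?_
    · simp
    · simp
  refine h5.trans (add_le_add_left ?_ _)
  linarith

/-- The unnormalized kernel. -/
def kern (r : ℝ) (z : ℝ × ℝ × ℝ) : ℝ :=
  cutoff (r * F.psin z.1) * (cutoff (r * z.2.1) * cutoff (r * z.2.2))

lemma contDiff_psin : ContDiff ℝ (⊤ : ℕ∞) F.psin := by
  unfold psin
  exact Real.contDiff_sin.comp (by fun_prop)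

lemma contDiff_kern (r : ℝ) : ContDiff ℝ (⊤ : ℕ∞) (F.kern r) := by
  have h := F.contDiff_psin
  have hc := contDiff_cutoff
  unfold kern
  fun_prop

lemma continuous_kern (r : ℝ) : Continuous (F.kern r) := (F.contDiff_kern r).continuous

lemma kern_nonneg (r : ℝ) (z : ℝ × ℝ × ℝ) : 0 ≤ F.kern r z :=
  mul_nonneg (cutoff_nonneg _) (mul_nonneg (cutoff_nonneg _) (cutoff_nonneg _))

lemma kern_neg (r : ℝ) (z : ℝ × ℝ × ℝ) : F.kern r (-z) = F.kern r z := by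
  simp [kern, psin_neg, cutoff_neg]

lemma kern_periodic (r : ℝ) (x : ℝ) (v : ℝ × ℝ) : F.kern r (x + F.P, v) = F.kern r (x, v) := by
  simp [kern, psin_add_P, cutoff_neg]

/-- The set on which the kernel and its derivatives may be nonzero. -/
def kernSet (r : ℝ) : Set (ℝ × ℝ × ℝ) :=
  {z | r * |F.psin z.1| ≤ 1 ∧ r * |z.2.1| ≤ 1 ∧ r * |z.2.2| ≤ 1}

lemma kern_eq_zero {r : ℝ} (hr : 0 < r) {z : ℝ × ℝ × ℝ} (hz : z ∉ F.kernSet r) :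
    F.kern r z = 0 := by
  by_contra hne
  simp only [kern, mul_eq_zero, not_or] at hne
  have h : ∀ y, cutoff (r * y) ≠ 0 → r * |y| ≤ 1 := fun y hy => by
    by_contra! h1
    refine hy (cutoff_eq_zero ?_)
    rw [abs_mul, abs_of_pos hr]
    exact h1.le
  exact hz ⟨h _ hne.1, h _ hne.2.1, h _ hne.2.2⟩

lemma kern_support {r : ℝ} (hr : 0 < r) (x : ℝ) (v : ℝ × ℝ) (hv : r⁻¹ < ‖v‖) :
    F.kern r (x, v) = 0 := by
  refine F.kern_eq_zero hr fun h => ?_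
  have h1 : |v.1| ≤ r⁻¹ := by
    rw [← one_div, le_div_iff₀' hr]; exact h.2.1
  have h2 : |v.2| ≤ r⁻¹ := by
    rw [← one_div, le_div_iff₀' hr]; exact h.2.2
  exact hv.not_ge (max_le h1 h2)

/-- The kernel of twice the width equals `1` where the kernel or its derivative can be nonzero.
Derivatives of `kern r` are therefore dominated by multiples of `kern (r / 2)`, to which Schur's
test applies. -/
lemma kern_half_eq_one {r : ℝ} (hr : 0 < r) {z : ℝ × ℝ × ℝ} (hz : z ∈ F.kernSet r) :
    F.kern (r / 2) z = 1 := by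
  have h : ∀ y, r * |y| ≤ 1 → cutoff (r / 2 * y) = 1 := fun y hy => by
    refine cutoff_eq_one ?_
    have h0 : 0 ≤ r * |y| := by positivity
    have : (r / 2 * y) ^ 2 = (r * |y|) ^ 2 / 4 := by rw [mul_pow, mul_pow, sq_abs]; ring
    rw [this]
    nlinarith
  simp [kern, h _ hz.1, h _ hz.2.1, h _ hz.2.2]

lemma fderiv_kern (r : ℝ) (z ξ : ℝ × ℝ × ℝ) : fderiv ℝ (F.kern r) z ξ
    = deriv cutoff (r * F.psin z.1) * (r * (Real.cos (Real.pi * z.1 / F.P) * (Real.pi / F.P))) * ξ.1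
        * (cutoff (r * z.2.1) * cutoff (r * z.2.2))
      + cutoff (r * F.psin z.1) * (deriv cutoff (r * z.2.1) * r * ξ.2.1 * cutoff (r * z.2.2)
        + cutoff (r * z.2.1) * (deriv cutoff (r * z.2.2) * r * ξ.2.2)) := by
  have hx : HasFDerivAt (fun z : ℝ × ℝ × ℝ => z.1) (ContinuousLinearMap.fst ℝ ℝ (ℝ × ℝ)) z :=
    hasFDerivAt_fst
  have hv : HasFDerivAt (fun z : ℝ × ℝ × ℝ => z.2) (ContinuousLinearMap.snd ℝ ℝ (ℝ × ℝ)) z :=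
    hasFDerivAt_snd
  have hv1 := (hasFDerivAt_fst (𝕜 := ℝ) (E := ℝ) (F := ℝ) (p := z.2)).comp z hv
  have hv2 := (hasFDerivAt_snd (𝕜 := ℝ) (E := ℝ) (F := ℝ) (p := z.2)).comp z hv
  have hs : HasDerivAt F.psin (Real.cos (Real.pi * z.1 / F.P) * (Real.pi / F.P)) z.1 := by
    have h1 : HasDerivAt (fun x : ℝ => Real.pi * x / F.P) (Real.pi / F.P) z.1 := by
      simpa using ((hasDerivAt_id z.1).const_mul Real.pi).div_const F.P
    exact (Real.hasDerivAt_sin _).comp z.1 h1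
  have c1 := (hasDerivAt_cutoff (r * F.psin z.1)).comp_hasFDerivAt_of_eq z
    ((hs.comp_hasFDerivAt z hx).const_mul r) rfl
  have c2 := (hasDerivAt_cutoff (r * z.2.1)).comp_hasFDerivAt_of_eq z (hv1.const_mul r) rfl
  have c3 := (hasDerivAt_cutoff (r * z.2.2)).comp_hasFDerivAt_of_eq z (hv2.const_mul r) rfl
  have e := (c1.mul (c2.mul c3)).fderiv
  change fderiv ℝ (F.kern r) z = _ at e
  rw [e]
  simp
  ring

lemma fderiv_kern_eq_zero {r : ℝ} (hr : 0 < r) {z : ℝ × ℝ × ℝ} (hz : z ∉ F.kernSet r)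
    (ξ : ℝ × ℝ × ℝ) : fderiv ℝ (F.kern r) z ξ = 0 := by
  have h : ∀ y, ¬ r * |y| ≤ 1 → cutoff (r * y) = 0 ∧ deriv cutoff (r * y) = 0 := fun y hy => by
    have : 1 < |r * y| := by rw [abs_mul, abs_of_pos hr]; exact not_le.1 hy
    exact ⟨cutoff_eq_zero this.le, deriv_cutoff_eq_zero this⟩
  rw [fderiv_kern]
  simp only [kernSet, mem_ofPred_eq, not_and_or] at hz
  rcases hz with hz | hz | hz
  · simp [h _ hz]
  · simp [h _ hz]
  · simp [h _ hz]

lemma exists_fderiv_kern_le : ∃ C : ℝ, 0 ≤ C ∧ ∀ r : ℝ, 0 < r → ∀ z ξ,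
    |fderiv ℝ (F.kern r) z ξ| ≤ C * r * (|ξ.1| + |ξ.2.1| + |ξ.2.2|) := by
  obtain ⟨T, hT0, hT⟩ := exists_deriv_cutoff_le
  have hP := F.P_pos
  have hπ := Real.pi_pos
  refine ⟨T * (Real.pi / F.P + 1), by positivity, fun r hr z ξ => ?_⟩
  have hc : ∀ y, |cutoff y| ≤ 1 := fun y => by
    rw [abs_of_nonneg (cutoff_nonneg y)]; exact cutoff_le_one y
  have b1 : |deriv cutoff (r * F.psin z.1) * (r * (Real.cos (Real.pi * z.1 / F.P)
      * (Real.pi / F.P))) * ξ.1 * (cutoff (r * z.2.1) * cutoff (r * z.2.2))|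
      ≤ T * (r * (1 * (Real.pi / F.P))) * |ξ.1| * (1 * 1) := by
    simp only [abs_mul, abs_of_pos hr, abs_of_pos (div_pos hπ hP)]
    gcongr
    · exact hT _
    · exact Real.abs_cos_le_one _
    · exact hc _
    · exact hc _
  have b2 : |cutoff (r * F.psin z.1) * (deriv cutoff (r * z.2.1) * r * ξ.2.1 * cutoff (r * z.2.2)
        + cutoff (r * z.2.1) * (deriv cutoff (r * z.2.2) * r * ξ.2.2))|
      ≤ 1 * (T * r * |ξ.2.1| * 1 + 1 * (T * r * |ξ.2.2|)) := by
    rw [abs_mul]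
    refine mul_le_mul (hc _) ((abs_add_le _ _).trans ?_) (abs_nonneg _) zero_le_one
    simp only [abs_mul, abs_of_pos hr]
    gcongr
    · exact hT _
    · exact hc _
    · exact hc _
    · exact hT _
  rw [fderiv_kern]
  refine (abs_add_le _ _).trans ((add_le_add b1 b2).trans ?_)
  have h1 : 0 ≤ T * r * |ξ.1| := by positivity
  have h2 : 0 ≤ T * (Real.pi / F.P) * r * (|ξ.2.1| + |ξ.2.2|) := by positivity
  nlinarith

/-! ### The mass of the kernel -/

/-- The mass of the unnormalized kernel. -/
def mass (r : ℝ) : ℝ := ∫ z, F.kern r z ∂F.base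

lemma integral_cutoff_mul {r : ℝ} (hr : 0 < r) : ∫ y, cutoff (r * y) = r⁻¹ * ∫ y, cutoff y := by
  rw [Measure.integral_comp_mul_left cutoff r, abs_of_pos (inv_pos.2 hr), smul_eq_mul]

lemma mass_eq {r : ℝ} (hr : 0 < r) : F.mass r
    = (∫ x, cutoff (r * F.psin x) ∂F.perMeas)
      * ((r⁻¹ * ∫ y, cutoff y) * (r⁻¹ * ∫ y, cutoff y)) := by
  rw [← integral_cutoff_mul hr]
  unfold mass kern
  rw [integral_prod_mul (μ := F.perMeas) (ν := (volume : Measure (ℝ × ℝ)))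
    (fun x => cutoff (r * F.psin x)) (fun v => cutoff (r * v.1) * cutoff (r * v.2)),
    Measure.volume_eq_prod, integral_prod_mul (μ := volume) (ν := volume)
    (fun y => cutoff (r * y)) (fun y => cutoff (r * y))]

lemma continuous_cutoff_psin (r : ℝ) : Continuous fun x => cutoff (r * F.psin x) :=
  continuous_cutoff.comp (continuous_const.mul F.contDiff_psin.continuous)

lemma cutoff_psin_periodic (r : ℝ) : Function.Periodic (fun x => cutoff (r * F.psin x)) F.P :=
  fun x => by simp [psin_add_P, cutoff_neg]

lemma integral_cutoff_psin_le {r : ℝ} (hr : 0 < r) :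
    ∫ x, cutoff (r * F.psin x) ∂F.perMeas ≤ F.P / r := by
  have hP := F.P_pos
  -- The period is recentred at `0`, where the lower bound `le_abs_psin` is available throughout.
  have h1 : ∫ x, cutoff (r * F.psin x) ∂F.perMeas
      = ∫ x in Ioc (-(F.P / 2)) (F.P / 2), cutoff (r * F.psin x) := by
    have := (F.cutoff_psin_periodic r).intervalIntegral_add_eq 0 (-(F.P / 2))
    rw [zero_add, show -(F.P / 2) + F.P = F.P / 2 by ring,
      intervalIntegral.integral_of_le hP.le, intervalIntegral.integral_of_le (by linarith)] at this
    exact this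
  rw [h1]
  have h2 : ∫ x in Ioc (-(F.P / 2)) (F.P / 2), cutoff (r * F.psin x)
      ≤ ∫ x in Ioc (-(F.P / 2)) (F.P / 2), (Icc (-(F.P / (2 * r))) (F.P / (2 * r))).indicator 1 x := by
    refine setIntegral_mono_on (F.continuous_cutoff_psin r).integrableOn_Ioc
      ((integrable_indicator_iff measurableSet_Icc).2
        (integrableOn_const (C := (1 : ℝ)) (hs := by
          rw [Measure.restrict_apply measurableSet_Icc]
          exact (measure_mono inter_subset_left).trans_lt measure_Icc_lt_top |>.ne)))
      measurableSet_Ioc ?_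
    intro x hx
    by_cases hxr : x ∈ Icc (-(F.P / (2 * r))) (F.P / (2 * r))
    · rw [indicator_of_mem hxr]
      exact cutoff_le_one _
    · rw [indicator_of_notMem hxr]
      refine (cutoff_eq_zero ?_).le
      have h3 := F.le_abs_psin (abs_le.2 ⟨hx.1.le, hx.2⟩)
      have h4 : F.P / (2 * r) < |x| := by
        by_contra! h
        exact hxr (abs_le.1 h)
      rw [abs_mul, abs_of_pos hr]
      have h5 : 1 = r * (2 / F.P * (F.P / (2 * r))) := by field_simp
      rw [h5]
      refine mul_le_mul_of_nonneg_left (le_trans ?_ h3) hr.le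
      exact mul_le_mul_of_nonneg_left h4.le (by positivity)
  refine h2.trans ?_
  refine (setIntegral_le_integral (μ := volume) ((integrable_indicator_iff measurableSet_Icc).2
      (integrableOn_const (C := (1 : ℝ)) (hs := measure_Icc_lt_top.ne)))
    (.of_forall fun x => indicator_nonneg (fun _ _ => zero_le_one) x)).trans ?_
  rw [← Pi.one_def, integral_indicator_one measurableSet_Icc, Real.volume_real_Icc_of_le]
  · refine le_of_eq ?_
    field_simp
    ring
  · have : 0 ≤ F.P / (2 * r) := by positivity
    linarith

/-- On an interval of length `P/(5r)` one has `r |psin| ≤ π/5 < 0.63`, and the square of this is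
below the threshold `1/2` of the cutoff. -/
lemma le_integral_cutoff_psin {r : ℝ} (hr : 1 ≤ r) :
    F.P / (5 * r) ≤ ∫ x, cutoff (r * F.psin x) ∂F.perMeas := by
  have hP := F.P_pos
  have hr0 : 0 < r := by linarith
  have h1 : ∫ x, (Ioc 0 (F.P / (5 * r))).indicator 1 x ∂F.perMeas = F.P / (5 * r) := by
    rw [integral_indicator_one measurableSet_Ioc, measureReal_restrict_apply measurableSet_Ioc,
      Ioc_inter_Ioc, max_self, min_eq_left, Real.volume_real_Ioc_of_le (by positivity), sub_zero]
    rw [div_le_iff₀ (by positivity)]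
    nlinarith
  rw [← h1]
  refine integral_mono_of_nonneg (.of_forall fun x => indicator_nonneg (fun _ _ => zero_le_one) x)
    ((F.continuous_cutoff_psin r).integrableOn_Ioc) (.of_forall fun x => ?_)
  by_cases hx : x ∈ Ioc 0 (F.P / (5 * r))
  · rw [indicator_of_mem hx]
    refine (cutoff_eq_one ?_).ge
    have hπ := Real.pi_pos
    have h2 : |F.psin x| ≤ Real.pi * x / F.P := by
      have := Real.abs_sin_le_abs (x := Real.pi * x / F.P)
      rwa [abs_of_nonneg (a := Real.pi * x / F.P) (by have := hx.1; positivity)] at this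
    have h3 : r * |F.psin x| ≤ 3.15 / 5 := by
      have h4 : Real.pi * x / F.P ≤ Real.pi / (5 * r) := by
        rw [div_le_div_iff₀ hP (by positivity)]
        have := (le_div_iff₀ (by positivity : (0 : ℝ) < 5 * r)).1 hx.2
        nlinarith
      calc r * |F.psin x| ≤ r * (Real.pi / (5 * r)) :=
            mul_le_mul_of_nonneg_left (h2.trans h4) hr0.le
        _ = Real.pi / 5 := by field_simp
        _ ≤ 3.15 / 5 := by linarith [Real.pi_lt_d2]
    have h5 : 0 ≤ r * |F.psin x| := by positivity
    rw [mul_pow, ← sq_abs (F.psin x), ← mul_pow]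
    nlinarith
  · rw [indicator_of_notMem hx]
    exact cutoff_nonneg _

lemma mass_pos {r : ℝ} (hr : 1 ≤ r) : 0 < F.mass r := by
  have hr0 : 0 < r := by linarith
  rw [F.mass_eq hr0]
  have h1 := integral_cutoff_pos
  have h2 := F.le_integral_cutoff_psin hr
  have h3 : 0 < F.P / (5 * r) := by have := F.P_pos; positivity
  have : 0 < r⁻¹ * ∫ y, cutoff y := by positivity
  exact mul_pos (h3.trans_le h2) (by positivity)

/-- The factor is `10` from the upper and lower bounds in `x`, times `4` from exact scaling in the
two velocities. Only its independence of `r` matters. -/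
lemma mass_half_le {r : ℝ} (hr : 1 ≤ r) : F.mass (r / 2) ≤ 40 * F.mass r := by
  have hr0 : 0 < r := by linarith
  have hP := F.P_pos
  rw [F.mass_eq hr0, F.mass_eq (half_pos hr0)]
  have h1 := F.le_integral_cutoff_psin hr
  have h2 := F.integral_cutoff_psin_le (half_pos hr0)
  have h3 := integral_cutoff_pos
  have h4 : F.P / (r / 2) = 10 * (F.P / (5 * r)) := by field_simp; ring
  have h5 : ∫ x, cutoff (r / 2 * F.psin x) ∂F.perMeas
      ≤ 10 * ∫ x, cutoff (r * F.psin x) ∂F.perMeas := by linarith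
  set B := ∫ y, cutoff y
  have h6 : (r / 2)⁻¹ * B * ((r / 2)⁻¹ * B) = 4 * (r⁻¹ * B * (r⁻¹ * B)) := by
    field_simp; ring
  rw [h6]
  have h7 : 0 ≤ r⁻¹ * B * (r⁻¹ * B) := by positivity
  nlinarith [mul_le_mul_of_nonneg_right h5 h7]

/-- Translation invariance: in `v` it is that of Lebesgue measure, in `x` that of the integral of a
periodic function over a period. -/
lemma integral_comp_sub {K : ℝ × ℝ × ℝ → ℝ} (hK : Continuous K)
    (hp : ∀ x v, K (x + F.P, v) = K (x, v))
    {R : ℝ} (hR : ∀ x v, R < ‖v‖ → K (x, v) = 0) (z : ℝ × ℝ × ℝ) :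
    Integrable (fun y => K (y - z)) F.base ∧ ∫ y, K (y - z) ∂F.base = ∫ y, K y ∂F.base := by
  have hi : Integrable (fun y => K (y - z)) F.base :=
    F.integrable_of_continuous (hK.comp (by fun_prop)) ⟨R + ‖z.2‖, fun x v hv => hR _ _ (by
      have := norm_sub_norm_le v z.2
      show R < ‖v - z.2‖
      linarith)⟩
  refine ⟨hi, ?_⟩
  rw [integral_prod _ hi, integral_prod _ (F.integrable_of_continuous hK ⟨R, hR⟩)]
  have h1 : ∀ x, ∫ v, K ((x, v) - z) = ∫ v, K (x - z.1, v) := fun x =>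
    integral_sub_right_eq_self (fun v => K (x - z.1, v)) z.2
  simp only [h1]
  have hper : Function.Periodic (fun x => ∫ v, K (x, v)) F.P := fun x => by simp only [hp]
  have h2 := hper.intervalIntegral_add_eq (0 - z.1) 0
  rw [← intervalIntegral.integral_of_le F.P_pos.le, ← intervalIntegral.integral_of_le F.P_pos.le,
    intervalIntegral.integral_comp_sub_right (fun x => ∫ v, K (x, v)) z.1]
  rw [zero_add] at h2
  rw [← h2]
  congr 1
  ring

lemma integral_kern_sub {r : ℝ} (hr : 0 < r) (z : ℝ × ℝ × ℝ) :
    Integrable (fun y => F.kern r (y - z)) F.base ∧ ∫ y, F.kern r (y - z) ∂F.base = F.mass r :=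
  F.integral_comp_sub (F.continuous_kern r) (F.kern_periodic r) (F.kern_support hr) z

lemma integral_kern_sub' {r : ℝ} (hr : 0 < r) (z : ℝ × ℝ × ℝ) :
    Integrable (fun y => F.kern r (z - y)) F.base ∧ ∫ y, F.kern r (z - y) ∂F.base = F.mass r := by
  have := F.integral_kern_sub hr z
  simp only [← F.kern_neg r (_ - z), neg_sub] at this
  exact this

end Equilibrium
end VlasovMaxwell

namespace VlasovMaxwell
namespace Equilibrium

variable (F : Equilibrium)

/-! ### Density of the test functions -/

/-- The classes of the test functions in `L²` of one period of phase space. -/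
def testSpace : Submodule ℝ (Lp ℝ 2 F.base) where
  carrier := {u | ∃ χ, F.IsTest χ ∧ u =ᵐ[F.base] χ}
  zero_mem' := ⟨0, ⟨contDiff_const, fun _ _ => rfl, 0, fun _ _ _ => rfl⟩, Lp.coeFn_zero _ _ _⟩
  add_mem' := by
    rintro a b ⟨χ, hχ, ha⟩ ⟨η, hη, hb⟩
    obtain ⟨R, hR⟩ := hχ.support
    obtain ⟨T, hT⟩ := hη.support
    refine ⟨χ + η, ⟨hχ.contDiff.add hη.contDiff, fun x v => ?_, max R T, fun x v hv => ?_⟩,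
      (Lp.coeFn_add a b).trans (ha.add hb)⟩
    · simp only [Pi.add_apply, hχ.periodic, hη.periodic]
    · simp only [Pi.add_apply, hR x v ((le_max_left _ _).trans_lt hv),
        hT x v ((le_max_right _ _).trans_lt hv), add_zero]
  smul_mem' := by
    rintro c a ⟨χ, hχ, ha⟩
    obtain ⟨R, hR⟩ := hχ.support
    refine ⟨c • χ, ⟨contDiff_const.smul hχ.contDiff, fun x v => ?_, R, fun x v hv => ?_⟩,
      (Lp.coeFn_smul c a).trans (ha.const_smul c)⟩
    · simp only [Pi.smul_apply, hχ.periodic]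
    · simp only [Pi.smul_apply, hR x v hv, smul_zero]

variable {F} in
lemma IsTest.memLp {χ : ℝ × ℝ × ℝ → ℝ} (hχ : F.IsTest χ) : MemLp χ 2 F.base := by
  obtain ⟨R, hR⟩ := hχ.support
  exact (F.locL2_of_continuous hχ.contDiff.continuous).memLp hR

/-- Smooth functions with compact support in the open period extend periodically to test functions,
so an `L²` function orthogonal to the test functions vanishes almost everywhere. -/
lemma testSpace_topologicalClosure : F.testSpace.topologicalClosure = ⊤ := by
  rw [Submodule.topologicalClosure_eq_top_iff, Submodule.eq_bot_iff]
  intro u hu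
  have hae := IsOpen.ae_eq_zero_of_integral_contDiff_smul_eq_zero (μ := F.base) (f := u)
    ((isOpen_Ioo (a := 0) (b := F.P)).prod (isOpen_univ (X := ℝ × ℝ)))
    (((Lp.memLp u).locallyIntegrable (by norm_num)).locallyIntegrableOn _)
    fun g hg hc hs => by
      obtain ⟨δ, hδ, hK⟩ := exists_margin_of_isCompact (P := F.P) (hc.image continuous_fst)
        (by rintro _ ⟨z, hz, rfl⟩; exact (hs hz).1)
      have hK' : ∀ x v, g (x, v) ≠ 0 → δ ≤ x ∧ x ≤ F.P - δ :=
        fun x v hx => hK x ⟨(x, v), subset_tsupport _ hx, rfl⟩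
      obtain ⟨R, hR⟩ := (hc.image continuous_snd).isBounded.exists_norm_le
      have hχ : F.IsTest (periodize F.P g) := by
        refine ⟨contDiff_periodize F.P_pos hδ hg hK', fun x v => periodize_add F.P_pos _ _ _, R,
          fun x v hv => ?_⟩
        by_contra hne
        exact hv.not_ge (hR v ⟨_, subset_tsupport _ hne, rfl⟩)
      have h1 := hu (hχ.memLp.toLp _) ⟨_, hχ, hχ.memLp.coeFn_toLp⟩
      rw [inner_Lp_eq] at h1
      rw [← h1]
      refine integral_congr_ae ?_
      have hx : ∀ᵐ z ∂F.base, z.1 ∈ Ioo 0 F.P := by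
        have h2 : ∀ᵐ x ∂F.perMeas, x ∈ Ioo 0 F.P := by
          filter_upwards [ae_restrict_mem measurableSet_Ioc, Measure.ae_ne _ F.P] with x hx hx'
          exact ⟨hx.1, lt_of_le_of_ne hx.2 hx'⟩
        exact Measure.quasiMeasurePreserving_fst.ae h2
      filter_upwards [hx, hχ.memLp.coeFn_toLp] with z hz h2
      rw [h2, periodize_eq_of_mem F.P_pos hz, smul_eq_mul]
  refine Lp.ext ?_
  have hx : ∀ᵐ z ∂F.base, z.1 ∈ Ioo 0 F.P := by
    have h2 : ∀ᵐ x ∂F.perMeas, x ∈ Ioo 0 F.P := by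
      filter_upwards [ae_restrict_mem measurableSet_Ioc, Measure.ae_ne _ F.P] with x hx hx'
      exact ⟨hx.1, lt_of_le_of_ne hx.2 hx'⟩
    exact Measure.quasiMeasurePreserving_fst.ae h2
  filter_upwards [hae, hx, Lp.coeFn_zero ℝ 2 F.base] with z h1 hz h0
  rw [h1 ⟨hz, mem_univ _⟩, h0]; rfl

lemma exists_isTest_near {f : ℝ × ℝ × ℝ → ℝ} (hf : MemLp f 2 F.base) {ε : ℝ} (hε : 0 < ε) :
    ∃ χ, F.IsTest χ ∧ ∫ z, (f z - χ z) ^ 2 ∂F.base ≤ ε ^ 2 := by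
  have h : hf.toLp f ∈ F.testSpace.topologicalClosure := by
    rw [testSpace_topologicalClosure]; trivial
  obtain ⟨u, ⟨χ, hχ, hu⟩, hlt⟩ := Metric.mem_closure_iff.1 h ε hε
  refine ⟨χ, hχ, ?_⟩
  rw [dist_eq_norm] at hlt
  have h1 : ∫ z, (f z - χ z) ^ 2 ∂F.base = ‖hf.toLp f - u‖ ^ 2 := by
    rw [← real_inner_self_eq_norm_sq, inner_Lp_eq]
    refine integral_congr_ae ?_
    filter_upwards [Lp.coeFn_sub (hf.toLp f) u, hf.coeFn_toLp, hu] with z h1 h2 h3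
    rw [h1, Pi.sub_apply, h2, h3, pow_two]
  rw [h1]
  exact pow_le_pow_left₀ (norm_nonneg _) hlt.le 2

/-! ### Schur's test -/

lemma integrable_kern_mul_snd {r : ℝ} (hr : 0 < r) {u : ℝ × ℝ × ℝ → ℝ} (hu : Integrable u F.base) :
    Integrable (fun p : (ℝ × ℝ × ℝ) × (ℝ × ℝ × ℝ) => F.kern r (p.2 - p.1) * u p.2)
      (F.base.prod F.base) ∧
    ∫ p : (ℝ × ℝ × ℝ) × (ℝ × ℝ × ℝ), F.kern r (p.2 - p.1) * u p.2 ∂(F.base.prod F.base)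
      = F.mass r * ∫ z, u z ∂F.base := by
  have hm : AEStronglyMeasurable
      (fun p : (ℝ × ℝ × ℝ) × (ℝ × ℝ × ℝ) => F.kern r (p.2 - p.1) * u p.2)
      (F.base.prod F.base) :=
    ((F.continuous_kern r).comp (continuous_snd.sub continuous_fst)).aestronglyMeasurable.mul
      hu.1.comp_snd
  have hi : Integrable (fun p : (ℝ × ℝ × ℝ) × (ℝ × ℝ × ℝ) => F.kern r (p.2 - p.1) * u p.2)
      (F.base.prod F.base) := by
    refine (integrable_prod_iff' hm).2
      ⟨.of_forall fun y => (F.integral_kern_sub' hr y).1.mul_const (u y), ?_⟩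
    refine (hu.norm.const_mul (F.mass r)).congr (.of_forall fun y => ?_)
    simp only [norm_mul, Real.norm_of_nonneg (F.kern_nonneg _ _)]
    rw [integral_mul_const, (F.integral_kern_sub' hr y).2]
  refine ⟨hi, ?_⟩
  rw [integral_prod_symm _ hi, ← integral_const_mul]
  refine integral_congr_ae (.of_forall fun y => ?_)
  simp only []
  rw [integral_mul_const, (F.integral_kern_sub' hr y).2]

lemma integrable_kern_mul_fst {r : ℝ} (hr : 0 < r) {u : ℝ × ℝ × ℝ → ℝ} (hu : Integrable u F.base) :
    Integrable (fun p : (ℝ × ℝ × ℝ) × (ℝ × ℝ × ℝ) => F.kern r (p.2 - p.1) * u p.1)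
      (F.base.prod F.base) ∧
    ∫ p : (ℝ × ℝ × ℝ) × (ℝ × ℝ × ℝ), F.kern r (p.2 - p.1) * u p.1 ∂(F.base.prod F.base)
      = F.mass r * ∫ z, u z ∂F.base := by
  have h := F.integrable_kern_mul_snd hr hu
  have e : (fun p : (ℝ × ℝ × ℝ) × (ℝ × ℝ × ℝ) => F.kern r (p.2 - p.1) * u p.1)
      = fun p => (fun q : (ℝ × ℝ × ℝ) × (ℝ × ℝ × ℝ) => F.kern r (q.2 - q.1) * u q.2) p.swap := by
    funext p
    simp only [Prod.fst_swap, Prod.snd_swap]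
    rw [← kern_neg, neg_sub]
  rw [e]
  exact ⟨h.1.swap, (integral_prod_swap _).trans h.2⟩

/-- Schur's test. -/
lemma schur {κ : (ℝ × ℝ × ℝ) × (ℝ × ℝ × ℝ) → ℝ} (hκ : Measurable κ) {c r : ℝ} (hr : 0 < r)
    (hk : ∀ p, |κ p| ≤ c * F.kern r (p.2 - p.1)) {f g : ℝ × ℝ × ℝ → ℝ}
    (hf : MemLp f 2 F.base) (hg : MemLp g 2 F.base) :
    Integrable (fun p => κ p * (f p.2 * g p.1)) (F.base.prod F.base) ∧
    ∀ t > 0, |∫ p, κ p * (f p.2 * g p.1) ∂(F.base.prod F.base)|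
      ≤ c * F.mass r / 2 * (t * ∫ z, f z ^ 2 ∂F.base + t⁻¹ * ∫ z, g z ^ 2 ∂F.base) := by
  have h1 := F.integrable_kern_mul_snd hr hf.integrable_sq
  have h2 := F.integrable_kern_mul_fst hr hg.integrable_sq
  have hb : ∀ t > 0, ∀ p, ‖κ p * (f p.2 * g p.1)‖ ≤ c / 2 * (t * (F.kern r (p.2 - p.1) * f p.2 ^ 2)
      + t⁻¹ * (F.kern r (p.2 - p.1) * g p.1 ^ 2)) := fun t ht p => by
    rw [norm_mul, Real.norm_eq_abs, Real.norm_eq_abs]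
    -- Young's inequality with a free parameter `t`, chosen later to make a small `f` count.
    have h3 : |f p.2 * g p.1| ≤ (t * f p.2 ^ 2 + t⁻¹ * g p.1 ^ 2) / 2 := by
      have h4 : ∀ a b : ℝ, a * b ≤ (t * a ^ 2 + t⁻¹ * b ^ 2) / 2 := fun a b => by
        have h5 : 0 ≤ t⁻¹ * (t * a - b) ^ 2 := by positivity
        have h6 : t⁻¹ * (t * a - b) ^ 2 = t * a ^ 2 + t⁻¹ * b ^ 2 - 2 * (a * b) := by
          field_simp; ring
        linarith
      refine abs_le.2 ⟨?_, h4 _ _⟩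
      have := h4 (-f p.2) (g p.1)
      rw [neg_sq] at this
      linarith
    calc |κ p| * |f p.2 * g p.1|
        ≤ (c * F.kern r (p.2 - p.1)) * ((t * f p.2 ^ 2 + t⁻¹ * g p.1 ^ 2) / 2) :=
          mul_le_mul (hk p) h3 (abs_nonneg _) ((abs_nonneg _).trans (hk p))
      _ = _ := by ring
  have hi : ∀ t : ℝ, Integrable (fun p : (ℝ × ℝ × ℝ) × (ℝ × ℝ × ℝ) =>
      c / 2 * (t * (F.kern r (p.2 - p.1) * f p.2 ^ 2)
      + t⁻¹ * (F.kern r (p.2 - p.1) * g p.1 ^ 2))) (F.base.prod F.base) := fun t =>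
    ((h1.1.const_mul t).add (h2.1.const_mul t⁻¹)).const_mul _
  refine ⟨(hi 1).mono' (hκ.aestronglyMeasurable.mul (hf.1.comp_snd.mul hg.1.comp_fst))
    (.of_forall (hb 1 one_pos)), fun t ht => ?_⟩
  refine (norm_integral_le_of_norm_le (hi t) (.of_forall (hb t ht))).trans (le_of_eq ?_)
  rw [integral_const_mul, integral_add (h1.1.const_mul t) (h2.1.const_mul t⁻¹),
    integral_const_mul, integral_const_mul, h1.2, h2.2]
  ring

/-- Convergence of a sequence of bilinear forms with bounded kernels follows from the convergence
for test functions. -/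
lemma tendsto_form_of_isTest {κ : ℕ → (ℝ × ℝ × ℝ) × (ℝ × ℝ × ℝ) → ℝ} (hκ : ∀ n, Measurable (κ n))
    {c r : ℕ → ℝ} (hr : ∀ n, 0 < r n) (hk : ∀ n p, |κ n p| ≤ c n * F.kern (r n) (p.2 - p.1))
    {S : ℝ} (hS : ∀ n, c n * F.mass (r n) ≤ S) {g : ℝ × ℝ × ℝ → ℝ} (hg : MemLp g 2 F.base) {b : ℝ}
    (ht : ∀ χ, F.IsTest χ → Filter.Tendsto
      (fun n => ∫ p, κ n p * (χ p.2 * g p.1) ∂(F.base.prod F.base)) Filter.atTop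
      (nhds (b * ∫ z, χ z * g z ∂F.base))) {f : ℝ × ℝ × ℝ → ℝ} (hf : MemLp f 2 F.base) :
    Filter.Tendsto (fun n => ∫ p, κ n p * (f p.2 * g p.1) ∂(F.base.prod F.base)) Filter.atTop
      (nhds (b * ∫ z, f z * g z ∂F.base)) := by
  rw [Metric.tendsto_atTop]
  intro ε hε
  set G := ∫ z, g z ^ 2 ∂F.base with hG
  have hG0 : 0 ≤ G := integral_nonneg fun z => sq_nonneg _
  -- `T - 1` is the factor by which an approximation error `δ` in `f` enters the final estimate, so
  -- `δ = ε/(2T)` costs less than `ε/2`.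
  set T := |S| / 2 * (1 + G) + |b| * (1 + G) + 1 with hT
  have hT0 : 0 < T := by positivity
  obtain ⟨χ, hχ, hd⟩ := F.exists_isTest_near hf (ε := ε / (2 * T)) (by positivity)
  set δ := ε / (2 * T) with hδ
  have hδ0 : 0 < δ := by positivity
  obtain ⟨N, hN⟩ := Metric.tendsto_atTop.1 (ht χ hχ) (ε / 2) (half_pos hε)
  refine ⟨N, fun n hn => ?_⟩
  have hfχ : MemLp (fun z => f z - χ z) 2 F.base := hf.sub hχ.memLp
  have h0 : δ⁻¹ * ∫ z, (f z - χ z) ^ 2 ∂F.base ≤ δ := by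
    rw [inv_mul_le_iff₀ hδ0]; nlinarith
  have h1 : |∫ p, κ n p * ((f p.2 - χ p.2) * g p.1) ∂(F.base.prod F.base)|
      ≤ |S| / 2 * (1 + G) * δ := by
    -- With `t = 1/δ`, both `t ∫ (f - χ)²` and `t⁻¹ ∫ g²` are of order `δ`.
    refine ((F.schur (hκ n) (hr n) (hk n) hfχ hg).2 δ⁻¹ (by positivity)).trans ?_
    rw [inv_inv]
    have h2 : 0 ≤ δ⁻¹ * ∫ z, (f z - χ z) ^ 2 ∂F.base + δ * ∫ z, g z ^ 2 ∂F.base := by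
      have : 0 ≤ ∫ z, (f z - χ z) ^ 2 ∂F.base := integral_nonneg fun z => sq_nonneg _
      positivity
    have h3 : c n * F.mass (r n) / 2 ≤ |S| / 2 := by linarith [hS n, le_abs_self S]
    refine (mul_le_mul_of_nonneg_right h3 h2).trans ?_
    rw [mul_assoc]
    refine mul_le_mul_of_nonneg_left ?_ (by positivity)
    rw [← hG]; linarith
  have e1 : ∫ p, κ n p * (f p.2 * g p.1) ∂(F.base.prod F.base)
      = ∫ p, κ n p * (χ p.2 * g p.1) ∂(F.base.prod F.base)
        + ∫ p, κ n p * ((f p.2 - χ p.2) * g p.1) ∂(F.base.prod F.base) := by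
    rw [← integral_add (F.schur (hκ n) (hr n) (hk n) hχ.memLp hg).1
      (F.schur (hκ n) (hr n) (hk n) hfχ hg).1]
    refine integral_congr_ae (.of_forall fun p => ?_)
    simp only []; ring
  have i1 : Integrable (fun z => (f z - χ z) * g z) F.base := hfχ.integrable_mul hg
  have e2 : ∫ z, f z * g z ∂F.base = ∫ z, χ z * g z ∂F.base + ∫ z, (f z - χ z) * g z ∂F.base := by
    have i0 : Integrable (fun z => χ z * g z) F.base := hχ.memLp.integrable_mul hg
    rw [← integral_add i0 i1]
    refine integral_congr_ae (.of_forall fun p => ?_)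
    simp only []; ring
  have h4 : |∫ z, (f z - χ z) * g z ∂F.base| ≤ (1 + G) * δ := by
    have hi : Integrable (fun z => δ⁻¹ * (f z - χ z) ^ 2 + δ * g z ^ 2) F.base :=
      (hfχ.integrable_sq.const_mul _).add (hg.integrable_sq.const_mul _)
    rw [← Real.norm_eq_abs]
    refine (norm_integral_le_of_norm_le hi (.of_forall fun z => ?_)).trans ?_
    · rw [Real.norm_eq_abs]
      have h5 : ∀ a b : ℝ, |a * b| ≤ δ⁻¹ * a ^ 2 + δ * b ^ 2 := fun a b => by
        have h5 : 0 ≤ δ⁻¹ * (a - δ * b) ^ 2 := by positivity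
        have h6 : δ⁻¹ * (a - δ * b) ^ 2 = δ⁻¹ * a ^ 2 + δ * b ^ 2 - 2 * (a * b) := by
          field_simp; ring
        have h7 : 0 ≤ δ⁻¹ * (a + δ * b) ^ 2 := by positivity
        have h8 : δ⁻¹ * (a + δ * b) ^ 2 = δ⁻¹ * a ^ 2 + δ * b ^ 2 + 2 * (a * b) := by
          field_simp; ring
        have h9 : 0 ≤ δ⁻¹ * a ^ 2 + δ * b ^ 2 := by positivity
        exact abs_le.2 ⟨by linarith, by linarith⟩
      exact h5 _ _
    · rw [integral_add (hfχ.integrable_sq.const_mul _) (hg.integrable_sq.const_mul _),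
        integral_const_mul, integral_const_mul, ← hG]
      linarith
  have h6 := hN n hn
  rw [Real.dist_eq] at h6 ⊢
  rw [e1, e2]
  set u := ∫ p, κ n p * (χ p.2 * g p.1) ∂(F.base.prod F.base)
  set v := ∫ p, κ n p * ((f p.2 - χ p.2) * g p.1) ∂(F.base.prod F.base)
  set w := ∫ z, χ z * g z ∂F.base
  set y := ∫ z, (f z - χ z) * g z ∂F.base
  have h7 : u + v - b * (w + y) = (u - b * w) + (v - b * y) := by ring
  rw [h7]
  have h8 : |v - b * y| ≤ |S| / 2 * (1 + G) * δ + |b| * ((1 + G) * δ) := by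
    refine (abs_sub _ _).trans (add_le_add h1 ?_)
    rw [abs_mul]
    exact mul_le_mul_of_nonneg_left h4 (abs_nonneg _)
  have h9 : |S| / 2 * (1 + G) * δ + |b| * ((1 + G) * δ) = (T - 1) * δ := by rw [hT]; ring
  have h10 : T * δ = ε / 2 := by rw [hδ]; field_simp
  have h11 := abs_add_le (u - b * w) (v - b * y)
  nlinarith

end Equilibrium
end VlasovMaxwell

namespace VlasovMaxwell
namespace Equilibrium

variable (F : Equilibrium)

/-! ### Estimates for the doubling of variables -/

variable {F} in
lemma IsC1Test.exists_lipschitz {χ : ℝ × ℝ × ℝ → ℝ} (hχ : F.IsC1Test χ) :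
    ∃ C : ℝ, 0 ≤ C ∧ ∀ r : ℝ, 0 < r → ∀ z z', z' - z ∈ F.kernSet r → |χ z' - χ z| ≤ C / r := by
  obtain ⟨R, hR⟩ := hχ.support
  obtain ⟨C, hC, hb⟩ := F.exists_bound_of_periodic hχ.continuous_fderiv
    (F.fderiv_periodic hχ.periodic) ⟨R, IsC1Test.fderiv_eq_zero hR⟩
  have hL : ∀ z z', ‖χ z - χ z'‖ ≤ C * ‖z - z'‖ := fun z z' =>
    convex_univ.norm_image_sub_le_of_norm_fderiv_le (𝕜 := ℝ)
      (fun y _ => hχ.contDiff.differentiable (by norm_num) y) (fun y _ => hb y)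
      (mem_univ z') (mem_univ z)
  have hP := F.P_pos
  refine ⟨C * (F.P / 2 + 1), by positivity, fun r hr z z' hz => ?_⟩
  refine (F.norm_sub_le_of_periodic hC hL hχ.periodic z' z).trans ?_
  rw [mul_div_assoc]
  refine mul_le_mul_of_nonneg_left ?_ hC
  have h1 : |F.psin (z'.1 - z.1)| ≤ 1 / r := by
    rw [le_div_iff₀' hr]; exact hz.1
  have h2 : ‖z'.2 - z.2‖ ≤ 1 / r := by
    refine max_le ?_ ?_ <;> rw [le_div_iff₀' hr]
    · exact hz.2.1
    · exact hz.2.2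
  have h3 : (F.P / 2 + 1) / r = F.P / 2 * (1 / r) + 1 / r := by ring
  rw [h3]
  gcongr

lemma exists_lipschitz_of_periodic {u : ℝ → ℝ} (hu : ContDiff ℝ 1 u)
    (hp : Function.Periodic u F.P) : ∃ C : ℝ, 0 ≤ C ∧ ∀ r : ℝ, 0 < r → ∀ x x' : ℝ,
      r * |F.psin (x' - x)| ≤ 1 → |u x' - u x| ≤ C / r := by
  have hpd : Function.Periodic (deriv u) F.P := fun x => by
    rw [← deriv_comp_add_const, show (fun x => u (x + F.P)) = u from funext hp]
  obtain ⟨C, hC⟩ := (hpd.isBounded_of_continuous F.P_pos.ne'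
    (hu.continuous_deriv (by norm_num))).exists_norm_le
  have hC0 : 0 ≤ C := (norm_nonneg _).trans (hC _ ⟨0, rfl⟩)
  have hP := F.P_pos
  have hL : ∀ z z' : ℝ × ℝ × ℝ, ‖u z.1 - u z'.1‖ ≤ C * ‖z - z'‖ := fun z z' =>
    (convex_univ.norm_image_sub_le_of_norm_deriv_le (𝕜 := ℝ)
      (fun y _ => hu.differentiable (by norm_num) y) (fun y _ => hC _ ⟨y, rfl⟩)
      (mem_univ z'.1) (mem_univ z.1)).trans
      (mul_le_mul_of_nonneg_left (norm_fst_le (z - z')) hC0)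
  refine ⟨C * (F.P / 2), by positivity, fun r hr x x' hx => ?_⟩
  have := F.norm_sub_le_of_periodic (κ := fun z => u z.1) hC0 hL (fun x v => hp x) (x', 0) (x, 0)
  simp only [sub_self, norm_zero, add_zero] at this
  refine this.trans ?_
  have h1 : |F.psin (x' - x)| ≤ 1 / r := by
    rw [le_div_iff₀' hr]; exact hx
  rw [mul_div_assoc, div_eq_mul_one_div (F.P / 2) r]
  gcongr

lemma exists_bound_of_periodic' {u : ℝ → ℝ} (hu : Continuous u)
    (hp : Function.Periodic u F.P) : ∃ C : ℝ, 0 ≤ C ∧ ∀ x, |u x| ≤ C := by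
  obtain ⟨C, hC⟩ := (hp.isBounded_of_continuous F.P_pos.ne' hu).exists_norm_le
  exact ⟨C, (norm_nonneg _).trans (hC _ ⟨0, rfl⟩), fun x => hC _ ⟨x, rfl⟩⟩

/-- The `ℓ¹` norm on phase space. -/
def ell (ξ : ℝ × ℝ × ℝ) : ℝ := |ξ.1| + |ξ.2.1| + |ξ.2.2|

lemma deriv_φ₀_periodic : Function.Periodic (deriv F.φ₀) F.P := fun x => by
  rw [← deriv_comp_add_const, show (fun x => F.φ₀ (x + F.P)) = F.φ₀ from funext F.φ₀_periodic]

lemma deriv_ψ₀_periodic : Function.Periodic (deriv F.ψ₀) F.P := fun x => by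
  rw [← deriv_comp_add_const, show (fun x => F.ψ₀ (x + F.P)) = F.ψ₀ from funext F.ψ₀_periodic]

lemma exists_ell_field_le (R : ℝ) : ∃ C : ℝ, 0 ≤ C ∧ ∀ z ∈ vball R, ell (F.field z) ≤ C := by
  obtain ⟨A, hA, ha⟩ := F.exists_bound_of_periodic' F.continuous_deriv_φ₀ F.deriv_φ₀_periodic
  obtain ⟨B, hB, hb⟩ := F.exists_bound_of_periodic' F.continuous_deriv_ψ₀ F.deriv_ψ₀_periodic
  refine ⟨|R| + (A + B * |R|) + B * |R|, by positivity, fun z hz => ?_⟩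
  have h1 : |z.2.1| ≤ |R| := (norm_fst_le z.2).trans (le_trans hz (le_abs_self R))
  have h2 : |z.2.2| ≤ |R| := (norm_snd_le z.2).trans (le_trans hz (le_abs_self R))
  unfold ell field
  have h3 := abs_sub (deriv F.φ₀ z.1) (deriv F.ψ₀ z.1 * z.2.2)
  rw [abs_mul] at h3
  simp only [abs_mul]
  have h4 := mul_le_mul (hb z.1) h1 (abs_nonneg _) hB
  have h5 := mul_le_mul (hb z.1) h2 (abs_nonneg _) hB
  linarith [ha z.1]

/-- The field is Lipschitz on bounded sets of velocities since `φ⁰` and `ψ⁰` are `C²`. As it grows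
with `v`, one of the two points is kept in `|v| ≤ R`. -/
lemma exists_ell_field_sub_le (R : ℝ) : ∃ C : ℝ, 0 ≤ C ∧ ∀ r : ℝ, 1 ≤ r → ∀ z ∈ vball R, ∀ z',
    z' - z ∈ F.kernSet r → ell (F.field z' - F.field z) ≤ C / r := by
  obtain ⟨A, hA, ha⟩ := F.exists_lipschitz_of_periodic (u := deriv F.φ₀)
    ((one_add_one_eq_two (R := WithTop ℕ∞) ▸ F.φ₀_contDiff : ContDiff ℝ (1 + 1) F.φ₀).deriv') F.deriv_φ₀_periodic
  obtain ⟨A', hA', ha'⟩ := F.exists_lipschitz_of_periodic (u := deriv F.ψ₀)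
    ((one_add_one_eq_two (R := WithTop ℕ∞) ▸ F.ψ₀_contDiff : ContDiff ℝ (1 + 1) F.ψ₀).deriv') F.deriv_ψ₀_periodic
  obtain ⟨B, hB, hb⟩ := F.exists_bound_of_periodic' F.continuous_deriv_ψ₀ F.deriv_ψ₀_periodic
  refine ⟨1 + (A + (B + A' * |R|)) + (B + A' * |R|), by positivity, fun r hr z hz z' hzz => ?_⟩
  have hr0 : 0 < r := by linarith
  have h1 : |z.2.1| ≤ |R| := (norm_fst_le z.2).trans (le_trans hz (le_abs_self R))
  have h2 : |z.2.2| ≤ |R| := (norm_snd_le z.2).trans (le_trans hz (le_abs_self R))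
  have d1 : |z'.2.1 - z.2.1| ≤ 1 / r := by
    rw [le_div_iff₀' hr0]; exact hzz.2.1
  have d2 : |z'.2.2 - z.2.2| ≤ 1 / r := by
    rw [le_div_iff₀' hr0]; exact hzz.2.2
  have d3 := ha r hr0 z.1 z'.1 hzz.1
  have d4 := ha' r hr0 z.1 z'.1 hzz.1
  have key : ∀ y y' : ℝ, |y| ≤ |R| → |y' - y| ≤ 1 / r →
      |deriv F.ψ₀ z'.1 * y' - deriv F.ψ₀ z.1 * y| ≤ (B + A' * |R|) / r := fun y y' h h' => by
    have : deriv F.ψ₀ z'.1 * y' - deriv F.ψ₀ z.1 * y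
      = deriv F.ψ₀ z'.1 * (y' - y) + (deriv F.ψ₀ z'.1 - deriv F.ψ₀ z.1) * y := by ring
    rw [this]
    refine (abs_add_le _ _).trans ?_
    rw [abs_mul, abs_mul]
    have e1 := mul_le_mul (hb z'.1) h' (abs_nonneg _) hB
    have e2 := mul_le_mul d4 h (abs_nonneg _) (by positivity)
    refine (add_le_add e1 e2).trans (le_of_eq ?_)
    ring
  have k1 := key z.2.1 z'.2.1 h1 d1
  have k2 := key z.2.2 z'.2.2 h2 d2
  unfold ell field
  simp only [Prod.fst_sub, Prod.snd_sub]
  have h3 : |deriv F.φ₀ z'.1 - deriv F.ψ₀ z'.1 * z'.2.2 - (deriv F.φ₀ z.1 - deriv F.ψ₀ z.1 * z.2.2)|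
      ≤ A / r + (B + A' * |R|) / r := by
    have : deriv F.φ₀ z'.1 - deriv F.ψ₀ z'.1 * z'.2.2 - (deriv F.φ₀ z.1 - deriv F.ψ₀ z.1 * z.2.2)
      = (deriv F.φ₀ z'.1 - deriv F.φ₀ z.1)
        - (deriv F.ψ₀ z'.1 * z'.2.2 - deriv F.ψ₀ z.1 * z.2.2) := by ring
    rw [this]
    exact (abs_sub _ _).trans (add_le_add d3 k2)
  rw [add_div, add_div, add_div A]
  linarith

lemma fderiv_kern_neg (r : ℝ) (z ξ : ℝ × ℝ × ℝ) :
    fderiv ℝ (F.kern r) (-z) ξ = -fderiv ℝ (F.kern r) z ξ := by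
  have h : (fun y => F.kern r (-y)) = F.kern r := funext (F.kern_neg r)
  have hd := ((F.contDiff_kern r).differentiable (by simp) (-z)).hasFDerivAt.comp z
    (hasFDerivAt_id z).neg
  have h2 : F.kern r ∘ Neg.neg = F.kern r := h
  rw [h2] at hd
  rw [hd.fderiv]
  simp

/-- One derivative costs a factor `r`; the wider kernel `kern (r / 2)` records the support. -/
lemma exists_abs_fderiv_kern_le : ∃ C : ℝ, 0 ≤ C ∧ ∀ r : ℝ, 0 < r → ∀ z ξ,
    |fderiv ℝ (F.kern r) z ξ| ≤ C * r * ell ξ * F.kern (r / 2) z := by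
  obtain ⟨C, hC, h⟩ := F.exists_fderiv_kern_le
  refine ⟨C, hC, fun r hr z ξ => ?_⟩
  by_cases hz : z ∈ F.kernSet r
  · rw [F.kern_half_eq_one hr hz, mul_one]
    exact h r hr z ξ
  · rw [F.fderiv_kern_eq_zero hr hz, abs_zero]
    have := F.kern_nonneg (r / 2) z
    unfold ell
    positivity

lemma isC1Test_kern_sub {r : ℝ} (hr : 0 < r) (z : ℝ × ℝ × ℝ) :
    F.IsC1Test fun z' => F.kern r (z' - z) := by
  refine ⟨((F.contDiff_kern r).of_le (by exact_mod_cast le_top)).comp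
    (contDiff_id.sub contDiff_const), fun x v => ?_, r⁻¹ + ‖z.2‖, fun x v hv => ?_⟩
  · have : ((x + F.P, v) : ℝ × ℝ × ℝ) - z = (((x, v) - z).1 + F.P, ((x, v) - z).2) := by
      ext <;> simp; ring
    rw [this, F.kern_periodic]
  · refine F.kern_support hr _ _ ?_
    have := norm_sub_norm_le v z.2
    linarith

lemma transport_kern_sub (r : ℝ) (z z' : ℝ × ℝ × ℝ) :
    F.transport (fun y => F.kern r (y - z)) z' = fderiv ℝ (F.kern r) (z' - z) (F.field z') := by
  rw [transport_eq, fderiv_comp_sub]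

variable {F} in
-- Product rule together with `IsC1Test.integral_transport`: for smooth functions the distributional
-- and the classical operator agree.
lemma IsC1Test.isWeakTransport {χ : ℝ × ℝ × ℝ → ℝ} (hχ : F.IsC1Test χ) :
    F.IsWeakTransport χ (F.transport χ) := by
  refine ⟨F.locL2_of_continuous hχ.contDiff.continuous,
    F.locL2_of_continuous hχ.continuous_transport, fun η hη => ?_⟩
  have h1 : F.IsC1Test fun z => χ z * η z := by
    obtain ⟨R, hR⟩ := hχ.support
    exact ⟨hχ.contDiff.mul hη.contDiff, fun x v => by simp only [hχ.periodic, hη.periodic],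
      R, fun x v hv => by simp [hR x v hv]⟩
  have h2 := h1.integral_transport
  have h3 : ∀ z, F.transport (fun z => χ z * η z) z = χ z * F.transport η z + F.transport χ z * η z :=
    fun z => by
      rw [F.transport_mul (hχ.contDiff.differentiable (by norm_num) z)
        (hη.contDiff.differentiable (by norm_num) z), mul_comm (η z)]
  simp only [h3] at h2
  rw [integral_add ((F.locL2_of_continuous hχ.contDiff.continuous).integrable_mul
    hη.continuous_transport hη.support_transport)
    ((F.locL2_of_continuous hχ.continuous_transport).integrable_mul hη.contDiff.continuous
      hη.support)] at h2
  linarith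

/-! ### Integration by parts for the transport operator -/

lemma measurable_fderiv_kern_apply (r : ℝ) {b : (ℝ × ℝ × ℝ) × (ℝ × ℝ × ℝ) → ℝ × ℝ × ℝ}
    (hb : Continuous b) : Measurable fun p : (ℝ × ℝ × ℝ) × (ℝ × ℝ × ℝ) =>
      fderiv ℝ (F.kern r) (p.2 - p.1) (b p) :=
  ((((F.contDiff_kern r).continuous_fderiv (by simp)).comp
    (continuous_snd.sub continuous_fst)).clm_apply hb).measurable

/-- The kernel of the transport operator acting on the second variable. -/
def kernSnd (R r : ℝ) (p : (ℝ × ℝ × ℝ) × (ℝ × ℝ × ℝ)) : ℝ :=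
  (Prod.snd ⁻¹' vball R).indicator (fun p => fderiv ℝ (F.kern r) (p.2 - p.1) (F.field p.2)) p

lemma measurable_kernSnd (R r : ℝ) : Measurable (F.kernSnd R r) :=
  (F.measurable_fderiv_kern_apply r (F.continuous_field.comp continuous_snd)).indicator
    (measurable_snd (measurableSet_vball R))

lemma exists_kernSnd_le (R : ℝ) {r : ℝ} (hr : 0 < r) :
    ∃ c : ℝ, ∀ p, |F.kernSnd R r p| ≤ c * F.kern (r / 2) (p.2 - p.1) := by
  obtain ⟨C, hC, h⟩ := F.exists_abs_fderiv_kern_le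
  obtain ⟨B, hB, hb⟩ := F.exists_ell_field_le R
  refine ⟨C * r * B, fun p => ?_⟩
  have h0 := F.kern_nonneg (r / 2) (p.2 - p.1)
  unfold kernSnd
  by_cases hp : p ∈ Prod.snd ⁻¹' vball R
  · rw [indicator_of_mem hp]
    refine (h r hr _ _).trans ?_
    have := hb p.2 hp
    gcongr
  · rw [indicator_of_notMem hp, abs_zero]
    positivity

lemma abs_kern_le (r : ℝ) (p : (ℝ × ℝ × ℝ) × (ℝ × ℝ × ℝ)) :
    |F.kern r (p.2 - p.1)| ≤ 1 * F.kern r (p.2 - p.1) := by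
  rw [one_mul, abs_of_nonneg (F.kern_nonneg _ _)]

lemma measurable_kern_sub (r : ℝ) :
    Measurable fun p : (ℝ × ℝ × ℝ) × (ℝ × ℝ × ℝ) => F.kern r (p.2 - p.1) :=
  ((F.continuous_kern r).comp (continuous_snd.sub continuous_fst)).measurable

/-- For fixed `z` the function `z' ↦ kern r (z' - z)` is an admissible test function in the equation
for `f`; the result is integrated against `g`. -/
lemma integral_kernSnd {r : ℝ} (hr : 0 < r) {R : ℝ} {f f' g : ℝ × ℝ × ℝ → ℝ}
    (hf : F.IsWeakTransport f f') (hfR : ∀ x v, R < ‖v‖ → f (x, v) = 0)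
    (hfm : MemLp f 2 F.base) (hfm' : MemLp f' 2 F.base) (hg : MemLp g 2 F.base) :
    ∫ p, F.kernSnd R r p * (f p.2 * g p.1) ∂(F.base.prod F.base)
      = -∫ p : (ℝ × ℝ × ℝ) × (ℝ × ℝ × ℝ), F.kern r (p.2 - p.1) * (f' p.2 * g p.1)
        ∂(F.base.prod F.base) := by
  obtain ⟨c, hc⟩ := F.exists_kernSnd_le R hr
  have i1 := (F.schur (F.measurable_kernSnd R r) (half_pos hr) hc hfm hg).1
  have i2 := (F.schur (F.measurable_kern_sub r) hr (F.abs_kern_le r) hfm' hg).1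
  rw [integral_prod _ i1, integral_prod _ i2, ← integral_neg]
  refine integral_congr_ae (.of_forall fun z => ?_)
  have h1 := hf.eq _ (F.isC1Test_kern_sub hr z)
  simp only [transport_kern_sub] at h1
  have e1 : ∀ z', F.kernSnd R r (z, z') * (f z' * g z)
      = g z * (f z' * fderiv ℝ (F.kern r) (z' - z) (F.field z')) := fun z' => by
    unfold kernSnd
    by_cases hz : (z, z') ∈ Prod.snd ⁻¹' vball R
    · rw [indicator_of_mem hz]; ring
    · have : f z' = 0 := hfR z'.1 z'.2 (not_le.1 hz)
      simp [this]
  have e2 : ∀ z', F.kern r (z' - z) * (f' z' * g z) = g z * (f' z' * F.kern r (z' - z)) :=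
    fun z' => by ring
  simp only [e1, e2]
  rw [integral_const_mul, integral_const_mul, h1]
  ring

/-- The commutator kernel. -/
def kernComm (R r : ℝ) (p : (ℝ × ℝ × ℝ) × (ℝ × ℝ × ℝ)) : ℝ :=
  (Prod.fst ⁻¹' vball R).indicator
    (fun p => fderiv ℝ (F.kern r) (p.2 - p.1) (F.field p.2 - F.field p.1)) p

lemma measurable_kernComm (R r : ℝ) : Measurable (F.kernComm R r) :=
  (F.measurable_fderiv_kern_apply r ((F.continuous_field.comp continuous_snd).sub
    (F.continuous_field.comp continuous_fst))).indicator
    (measurable_fst (measurableSet_vball R))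

/-- The cancellation behind the commutator estimate: the derivative of the kernel is of size `r`,
the difference of the field at the two points of size `1/r`. The bound is uniform in `r`. -/
lemma exists_kernComm_le (R : ℝ) : ∃ c : ℝ, 0 ≤ c ∧ ∀ r : ℝ, 1 ≤ r →
    ∀ p, |F.kernComm R r p| ≤ c * F.kern (r / 2) (p.2 - p.1) := by
  obtain ⟨C, hC, h⟩ := F.exists_abs_fderiv_kern_le
  obtain ⟨B, hB, hb⟩ := F.exists_ell_field_sub_le R
  refine ⟨C * B, by positivity, fun r hr p => ?_⟩
  have hr0 : 0 < r := by linarith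
  have h0 := F.kern_nonneg (r / 2) (p.2 - p.1)
  unfold kernComm
  by_cases hp : p ∈ Prod.fst ⁻¹' vball R
  · rw [indicator_of_mem hp]
    by_cases hk : p.2 - p.1 ∈ F.kernSet r
    · refine (h r hr0 _ _).trans ?_
      have h1 := hb r hr p.1 hp p.2 hk
      refine mul_le_mul_of_nonneg_right ?_ h0
      rw [mul_assoc]
      refine mul_le_mul_of_nonneg_left ?_ hC
      rwa [le_div_iff₀' hr0] at h1
    · rw [F.fderiv_kern_eq_zero hr0 hk, abs_zero]
      positivity
  · rw [indicator_of_notMem hp, abs_zero]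
    positivity

/-- The transport operator is applied to the kernel in `z'` against `f` and in `z` against `g`.
Since the kernel is even, its derivative in `z` is the opposite of that in `z'`, and the two
contributions combine into the difference of the field values. -/
lemma integral_kernComm {r : ℝ} (hr : 1 ≤ r) {R R' : ℝ} {f f' g g' : ℝ × ℝ × ℝ → ℝ}
    (hf : F.IsWeakTransport f f') (hfR : ∀ x v, R' < ‖v‖ → f (x, v) = 0)
    (hfR' : ∀ x v, R' < ‖v‖ → f' (x, v) = 0)
    (hg : F.IsWeakTransport g g') (hgR : ∀ x v, R < ‖v‖ → g (x, v) = 0)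
    (hgR' : ∀ x v, R < ‖v‖ → g' (x, v) = 0) :
    ∫ p, F.kernComm R r p * (f p.2 * g p.1) ∂(F.base.prod F.base)
      = -(∫ p : (ℝ × ℝ × ℝ) × (ℝ × ℝ × ℝ), F.kern r (p.2 - p.1) * (f' p.2 * g p.1)
        ∂(F.base.prod F.base)
      + ∫ p : (ℝ × ℝ × ℝ) × (ℝ × ℝ × ℝ), F.kern r (p.2 - p.1) * (f p.2 * g' p.1)
        ∂(F.base.prod F.base)) := by
  have hr0 : 0 < r := by linarith
  have mf := hf.locL2.memLp hfR
  have mf' := hf.locL2'.memLp hfR'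
  have mg := hg.locL2.memLp hgR
  have mg' := hg.locL2'.memLp hgR'
  obtain ⟨c, hc⟩ := F.exists_kernSnd_le R' hr0
  obtain ⟨c', hc'⟩ := F.exists_kernSnd_le R hr0
  have i1 := (F.schur (F.measurable_kernSnd R' r) (half_pos hr0) hc mf mg).1
  have i2 : Integrable (fun p => F.kernSnd R r p.swap * (g p.swap.2 * f p.swap.1))
      (F.base.prod F.base) := (F.schur (F.measurable_kernSnd R r) (half_pos hr0) hc' mg mf).1.swap
  have e1 := F.integral_kernSnd hr0 hf hfR mf mf' mg
  have e2 := F.integral_kernSnd hr0 hg hgR mg mg' mf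
  rw [← integral_prod_swap, ← integral_prod_swap (fun p : (ℝ × ℝ × ℝ) × (ℝ × ℝ × ℝ) =>
    F.kern r (p.2 - p.1) * (g' p.2 * f p.1))] at e2
  have e3 : ∀ p : (ℝ × ℝ × ℝ) × (ℝ × ℝ × ℝ), F.kernComm R r p * (f p.2 * g p.1)
      = F.kernSnd R' r p * (f p.2 * g p.1)
        + F.kernSnd R r p.swap * (g p.swap.2 * f p.swap.1) := fun p => by
    unfold kernComm kernSnd
    by_cases h1 : p ∈ Prod.fst ⁻¹' vball R
    · have h1' : p.swap ∈ Prod.snd ⁻¹' vball R := h1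
      by_cases h2 : p ∈ Prod.snd ⁻¹' vball R'
      · rw [indicator_of_mem h1, indicator_of_mem h1', indicator_of_mem h2]
        simp only [Prod.fst_swap, Prod.snd_swap]
        rw [← neg_sub p.2 p.1, fderiv_kern_neg, map_sub]
        ring
      · have : f p.2 = 0 := hfR p.2.1 p.2.2 (not_le.1 h2)
        simp [this]
    · have : g p.1 = 0 := hgR p.1.1 p.1.2 (not_le.1 h1)
      simp [this]
  simp only [e3]
  rw [integral_add i1 i2, e1]
  refine Eq.trans (congrArg _ e2) ?_
  have e4 : ∀ p : (ℝ × ℝ × ℝ) × (ℝ × ℝ × ℝ), F.kern r (p.swap.2 - p.swap.1)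
      * (g' p.swap.2 * f p.swap.1) = F.kern r (p.2 - p.1) * (f p.2 * g' p.1) := fun p => by
    simp only [Prod.fst_swap, Prod.snd_swap]
    rw [← neg_sub p.2 p.1, kern_neg]
    ring
  simp only [e4]
  ring

/-- The radii of the kernels. -/
def rad (n : ℕ) : ℝ := n + 1

lemma one_le_rad (n : ℕ) : 1 ≤ rad n := by unfold rad; linarith [Nat.cast_nonneg (α := ℝ) n]

lemma rad_pos (n : ℕ) : 0 < rad n := one_pos.trans_le (one_le_rad n)

/-- The normalized kernels are an approximate identity. For a test function `χ` its values at the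
two points differ by `O(1/r)`; general `f` follows by density and Schur's test. -/
lemma tendsto_kern {f g : ℝ × ℝ × ℝ → ℝ} (hf : MemLp f 2 F.base) (hg : F.LocL2 g) {R : ℝ}
    (hgR : ∀ x v, R < ‖v‖ → g (x, v) = 0) :
    Filter.Tendsto (fun n => ∫ p : (ℝ × ℝ × ℝ) × (ℝ × ℝ × ℝ),
      F.kern (rad n) (p.2 - p.1) / F.mass (rad n) * (f p.2 * g p.1) ∂(F.base.prod F.base))
      Filter.atTop (nhds (∫ z, f z * g z ∂F.base)) := by
  have hm : ∀ n, 0 < F.mass (rad n) := fun n => F.mass_pos (one_le_rad n)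
  have hmg := hg.memLp hgR
  have hk : ∀ n (p : (ℝ × ℝ × ℝ) × (ℝ × ℝ × ℝ)), |F.kern (rad n) (p.2 - p.1) / F.mass (rad n)|
      ≤ (F.mass (rad n))⁻¹ * F.kern (rad n) (p.2 - p.1) := fun n p => by
    rw [abs_div, abs_of_nonneg (F.kern_nonneg _ _), abs_of_pos (hm n), div_eq_inv_mul]
  have hmeas : ∀ n, Measurable fun p : (ℝ × ℝ × ℝ) × (ℝ × ℝ × ℝ) =>
      F.kern (rad n) (p.2 - p.1) / F.mass (rad n) := fun n => (F.measurable_kern_sub _).div_const _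
  have := F.tendsto_form_of_isTest (κ := fun n p => F.kern (rad n) (p.2 - p.1) / F.mass (rad n))
    (b := 1) (S := 1) hmeas rad_pos hk (fun n => (inv_mul_cancel₀ (hm n).ne').le) hmg ?_ hf
  · simpa using this
  intro χ hχ
  obtain ⟨C, hC, hL⟩ := hχ.isC1Test.exists_lipschitz
  have hgi : Integrable g F.base := hg.integrable ⟨R, hgR⟩
  have hχg : Integrable (fun z => χ z * g z) F.base := hχ.memLp.integrable_mul hmg
  have hlim : Filter.Tendsto (fun n => C / rad n * ∫ z, |g z| ∂F.base) Filter.atTop (nhds 0) := by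
    have h1 := (tendsto_one_div_add_atTop_nhds_zero_nat (𝕜 := ℝ)).const_mul
      (C * ∫ z, |g z| ∂F.base)
    rw [mul_zero] at h1
    refine h1.congr fun n => ?_
    unfold rad; ring
  rw [one_mul, tendsto_iff_dist_tendsto_zero]
  refine squeeze_zero (fun _ => dist_nonneg) (fun n => ?_) hlim
  have j1 := (F.schur (hmeas n) (rad_pos n) (hk n) hχ.memLp hmg).1
  have j2 := F.integrable_kern_mul_fst (rad_pos n) hχg
  have j3 := F.integrable_kern_mul_fst (rad_pos n) hgi.abs
  have e1 : ∫ z, χ z * g z ∂F.base = ∫ p : (ℝ × ℝ × ℝ) × (ℝ × ℝ × ℝ),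
      (F.mass (rad n))⁻¹ * (F.kern (rad n) (p.2 - p.1) * (χ p.1 * g p.1))
        ∂(F.base.prod F.base) := by
    rw [integral_const_mul, j2.2, inv_mul_cancel_left₀ (hm n).ne']
  rw [Real.dist_eq, e1, ← integral_sub j1 (j2.1.const_mul _), ← Real.norm_eq_abs]
  refine (norm_integral_le_of_norm_le (j3.1.const_mul (C / rad n * (F.mass (rad n))⁻¹))
    (.of_forall fun p => ?_)).trans (le_of_eq ?_)
  · have e2 : F.kern (rad n) (p.2 - p.1) / F.mass (rad n) * (χ p.2 * g p.1)
        - (F.mass (rad n))⁻¹ * (F.kern (rad n) (p.2 - p.1) * (χ p.1 * g p.1))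
        = (χ p.2 - χ p.1) * ((F.mass (rad n))⁻¹ * (F.kern (rad n) (p.2 - p.1) * g p.1)) := by
      ring
    rw [e2]
    simp only [norm_mul, Real.norm_eq_abs, abs_of_nonneg (F.kern_nonneg _ _),
      abs_of_pos (inv_pos.2 (hm n))]
    by_cases hz : p.2 - p.1 ∈ F.kernSet (rad n)
    · rw [mul_assoc (C / rad n)]
      have := (hm n).le
      exact mul_le_mul_of_nonneg_right (hL _ (rad_pos n) _ _ hz)
        (mul_nonneg (inv_nonneg.2 this) (mul_nonneg (F.kern_nonneg _ _) (abs_nonneg _)))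
    · rw [F.kern_eq_zero (rad_pos n) hz]; simp
  · rw [integral_const_mul, j3.2, mul_assoc, inv_mul_cancel_left₀ (hm n).ne']

/-- Integration by parts for functions of bounded support in `v`. -/
lemma IsWeakTransport.integral_add {R : ℝ} {f f' g g' : ℝ × ℝ × ℝ → ℝ}
    (hf : F.IsWeakTransport f f') (hfR : ∀ x v, R < ‖v‖ → f (x, v) = 0)
    (hfR' : ∀ x v, R < ‖v‖ → f' (x, v) = 0)
    (hg : F.IsWeakTransport g g') (hgR : ∀ x v, R < ‖v‖ → g (x, v) = 0)
    (hgR' : ∀ x v, R < ‖v‖ → g' (x, v) = 0) :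
    ∫ z, f' z * g z ∂F.base + ∫ z, f z * g' z ∂F.base = 0 := by
  have hm : ∀ n, 0 < F.mass (rad n) := fun n => F.mass_pos (one_le_rad n)
  have mg := hg.locL2.memLp hgR
  obtain ⟨c, hc0, hc⟩ := F.exists_kernComm_le R
  -- The normalized commutator forms converge to minus the quantity to be computed, for every
  -- admissible `f`.
  have lim : ∀ {R' : ℝ} {f f' : ℝ × ℝ × ℝ → ℝ},
      F.IsWeakTransport f f' → (∀ x v, R' < ‖v‖ → f (x, v) = 0) →
      (∀ x v, R' < ‖v‖ → f' (x, v) = 0) →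
      Filter.Tendsto (fun n => ∫ p, F.kernComm R (rad n) p / F.mass (rad n) * (f p.2 * g p.1)
        ∂(F.base.prod F.base)) Filter.atTop
        (nhds (-(∫ z, f' z * g z ∂F.base + ∫ z, f z * g' z ∂F.base))) := by
    intro R' f f' hf hfR hfR'
    refine ((F.tendsto_kern (hf.locL2'.memLp hfR') hg.locL2 hgR).add
      (F.tendsto_kern (hf.locL2.memLp hfR) hg.locL2' hgR')).neg.congr fun n => ?_
    have e : ∀ κ u : (ℝ × ℝ × ℝ) × (ℝ × ℝ × ℝ) → ℝ,
        ∫ p, κ p / F.mass (rad n) * u p ∂(F.base.prod F.base)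
          = (F.mass (rad n))⁻¹ * ∫ p, κ p * u p ∂(F.base.prod F.base) := fun κ u => by
      rw [← integral_const_mul]
      refine integral_congr_ae (.of_forall fun p => ?_)
      simp only []; ring
    rw [e (fun p => F.kern (rad n) (p.2 - p.1)) fun p => f' p.2 * g p.1,
      e (fun p => F.kern (rad n) (p.2 - p.1)) fun p => f p.2 * g' p.1,
      e _ fun p => f p.2 * g p.1,
      F.integral_kernComm (one_le_rad n) hf hfR hfR' hg hgR hgR']
    ring
  have h1 := lim hf hfR hfR'
  -- The same forms converge to `0`. For smooth `f` the limit found in `lim` vanishes by the weak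
  -- equation for `g`, and the uniform bound carries this over to all `f`; `40` is the constant of
  -- `mass_half_le`.
  have h2 := F.tendsto_form_of_isTest
    (κ := fun n p => F.kernComm R (rad n) p / F.mass (rad n)) (b := 0) (S := c * 40)
    (c := fun n => c / F.mass (rad n)) (r := fun n => rad n / 2)
    (fun n => (F.measurable_kernComm R _).div_const _) (fun n => half_pos (rad_pos n))
    (fun n p => ?_) (fun n => ?_) mg (fun χ hχ => ?_) (hf.locL2.memLp hfR)
  · have := tendsto_nhds_unique h1 h2
    linarith
  · rw [abs_div, abs_of_pos (hm n), div_mul_eq_mul_div]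
    exact div_le_div_of_nonneg_right (hc _ (one_le_rad n) p) (hm n).le
  · rw [div_mul_eq_mul_div, div_le_iff₀ (hm n), mul_assoc]
    exact mul_le_mul_of_nonneg_left (F.mass_half_le (one_le_rad n)) hc0
  · obtain ⟨R', hR'⟩ := hχ.support
    have h3 := lim hχ.isC1Test.isWeakTransport hR' fun x v hv => by
      rw [transport_eq, IsC1Test.fderiv_eq_zero hR' x v hv]; rfl
    have h4 := hg.eq _ hχ.isC1Test
    have e1 : ∫ z, F.transport χ z * g z ∂F.base = ∫ z, g z * F.transport χ z ∂F.base :=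
      integral_congr_ae (.of_forall fun z => mul_comm _ _)
    have e2 : ∫ z, χ z * g' z ∂F.base = ∫ z, g' z * χ z ∂F.base :=
      integral_congr_ae (.of_forall fun z => mul_comm _ _)
    rw [e1, e2, h4, neg_add_cancel, neg_zero] at h3
    rw [zero_mul]
    exact h3

end Equilibrium
end VlasovMaxwell

namespace VlasovMaxwell
namespace Equilibrium

variable (F : Equilibrium)

/-! ### The transport operator is skew-adjoint -/

/-- The values of `μ_e` on all of `ℝ²`. -/
def slope (y : ℝ × ℝ) : ℝ := |fderiv ℝ F.μ y (1, 0)|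

lemma continuous_slope : Continuous F.slope :=
  ((F.μ_contDiff.continuous_fderiv (by norm_num)).clm_apply continuous_const).abs

lemma slope_inv (z : ℝ × ℝ × ℝ) : F.slope (F.inv z) = |F.μe z.1 z.2| := rfl

lemma exists_norm_le_of_energy_le (T : ℝ) :
    ∃ R : ℝ, ∀ x v, R < ‖v‖ → T < energy F.φ₀ x v := by
  obtain ⟨C, hC, hb⟩ := F.exists_bound_of_periodic' F.φ₀_contDiff.continuous F.φ₀_periodic
  refine ⟨2 * (|T| + C) + 1, fun x v hv => ?_⟩
  have h1 : ‖v‖ ^ 2 ≤ v.1 ^ 2 + v.2 ^ 2 := by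
    rw [Prod.norm_def]
    rcases max_cases ‖v.1‖ ‖v.2‖ with h | h <;> rw [h.1, Real.norm_eq_abs, sq_abs] <;>
      nlinarith [sq_nonneg v.1, sq_nonneg v.2]
  have h2 := (abs_le.1 (hb x)).2
  have h3 := le_abs_self T
  have h4 := abs_nonneg T
  unfold energy
  nlinarith

/-- Cutoffs in energy have bounded support in `v` and commute with `D`, so
`IsWeakTransport.integral_add` applies to the truncated functions without any error. The weight is
invariant too and may be attached to one factor. Dominated convergence removes the cutoff. -/
lemma inner_add_inner_of_mem_transportGraph {h w k l : F.L2W} (hh : (h, w) ∈ F.transportGraph)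
    (hk : (k, l) ∈ F.transportGraph) : inner ℝ w k + inner ℝ h l = 0 := by
  have h1 : F.IsWeakTransport h w := IsTransport.isWeakTransport hh
  have h2 : F.IsWeakTransport k l := IsTransport.isWeakTransport hk
  set θ : ℕ → ℝ × ℝ × ℝ → ℝ := fun n z => cutoff ((rad n)⁻¹ * (F.inv z).1) with hθ
  have hcut : ∀ n, Continuous fun y : ℝ × ℝ => cutoff ((rad n)⁻¹ * y.1) := fun n =>
    continuous_cutoff.comp (continuous_const.mul continuous_fst)
  have hzero : ∀ n, ∃ R : ℝ, ∀ x v, R < ‖v‖ → θ n (x, v) = 0 := fun n => by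
    obtain ⟨R, hR⟩ := F.exists_norm_le_of_energy_le (rad n)
    refine ⟨R, fun x v hv => cutoff_eq_zero ?_⟩
    rw [abs_mul, abs_of_pos (inv_pos.2 (rad_pos n)), inv_mul_eq_div, le_div_iff₀ (rad_pos n),
      one_mul]
    exact (hR x v hv).le.trans (le_abs_self _)
  have i1 : Integrable (fun z => |F.μe z.1 z.2| * (w z * k z)) F.base :=
    F.integrable_measW_iff.1 ((Lp.memLp w).integrable_mul (Lp.memLp k))
  have i2 : Integrable (fun z => |F.μe z.1 z.2| * (h z * l z)) F.base :=
    F.integrable_measW_iff.1 ((Lp.memLp h).integrable_mul (Lp.memLp l))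
  have key : ∀ n, ∫ z, θ n z ^ 2 * (|F.μe z.1 z.2| * (w z * k z) + |F.μe z.1 z.2| * (h z * l z))
      ∂F.base = 0 := fun n => by
    obtain ⟨R, hR⟩ := hzero n
    -- The factor `h` carries the cutoff and the weight, `k` only the cutoff, which produces `θ²
    -- |μ_e|` in the products.
    have c1 := h1.inv_mul ((hcut n).mul F.continuous_slope)
    have c2 := h2.inv_mul (hcut n)
    have z1 : ∀ u : ℝ × ℝ × ℝ → ℝ, ∀ x v, R < ‖v‖ →
        cutoff ((rad n)⁻¹ * (F.inv (x, v)).1) * F.slope (F.inv (x, v)) * u (x, v) = 0 :=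
      fun u x v hv => by
        have := hR x v hv
        simp only [hθ] at this
        rw [this, zero_mul, zero_mul]
    have z2 : ∀ u : ℝ × ℝ × ℝ → ℝ, ∀ x v, R < ‖v‖ →
        cutoff ((rad n)⁻¹ * (F.inv (x, v)).1) * u (x, v) = 0 := fun u x v hv => by
        have := hR x v hv
        simp only [hθ] at this
        rw [this, zero_mul]
    have := c1.integral_add F (z1 _) (z1 _) c2 (z2 _) (z2 _)
    refine Eq.trans (Eq.trans (integral_congr_ae (.of_forall fun z => ?_))
      (integral_add ((c1.locL2'.memLp (z1 _)).integrable_mul (c2.locL2.memLp (z2 _)))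
        ((c1.locL2.memLp (z1 _)).integrable_mul (c2.locL2'.memLp (z2 _))))) this
    simp only [hθ, Pi.mul_apply, slope_inv]
    ring
  have hlim : Filter.Tendsto (fun n => ∫ z, θ n z ^ 2 *
      (|F.μe z.1 z.2| * (w z * k z) + |F.μe z.1 z.2| * (h z * l z)) ∂F.base) Filter.atTop
      (nhds (∫ z, (|F.μe z.1 z.2| * (w z * k z) + |F.μe z.1 z.2| * (h z * l z)) ∂F.base)) := by
    refine tendsto_integral_of_dominated_convergence
      (fun z => ‖|F.μe z.1 z.2| * (w z * k z) + |F.μe z.1 z.2| * (h z * l z)‖)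
      (fun n => ?_) (i1.add i2).norm (fun n => .of_forall fun z => ?_) (.of_forall fun z => ?_)
    · exact (((hcut n).comp F.continuous_inv).pow 2).aestronglyMeasurable.mul (i1.add i2).1
    · rw [norm_mul, norm_pow]
      have : ‖θ n z‖ ≤ 1 := by
        rw [Real.norm_of_nonneg (cutoff_nonneg _)]; exact cutoff_le_one _
      exact mul_le_of_le_one_left (norm_nonneg _) (pow_le_one₀ (norm_nonneg _) this)
    · have hr : Filter.Tendsto (fun n => (rad n)⁻¹ * (F.inv z).1) Filter.atTop (nhds 0) := by
        have := (tendsto_one_div_add_atTop_nhds_zero_nat (𝕜 := ℝ)).mul_const (F.inv z).1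
        rw [zero_mul] at this
        refine this.congr fun n => ?_
        rw [rad, one_div]
      have h0 : cutoff 0 = 1 := cutoff_eq_one (by norm_num)
      have := ((continuous_cutoff.tendsto 0).comp hr).pow 2
      rw [h0, one_pow] at this
      simpa using this.mul_const (|F.μe z.1 z.2| * (w z * k z) + |F.μe z.1 z.2| * (h z * l z))
  simp only [key] at hlim
  rw [F.inner_L2W, F.inner_L2W, ← integral_add i1 i2]
  exact (tendsto_nhds_unique hlim tendsto_const_nhds)

lemma exists_coeFn_eq {κ : ℝ × ℝ × ℝ → ℝ} (hκ : Continuous κ)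
    (hs : ∃ R : ℝ, ∀ x v, R < ‖v‖ → κ (x, v) = 0) : ∃ k : F.L2W, k =ᵐ[F.measW] κ := by
  obtain ⟨R, hR⟩ := hs
  obtain ⟨C, hC, hb⟩ := F.exists_bound_on_vball hκ R
  have hm : MemLp κ 2 F.measW := by
    refine MemLp.of_bound hκ.aestronglyMeasurable C ?_
    filter_upwards [F.measW_ac_base.ae_le hb] with z hz
    by_cases hv : z ∈ vball R
    · exact hz hv
    · rw [hR z.1 z.2 (not_le.1 hv), norm_zero]; exact hC
  exact ⟨hm.toLp κ, hm.coeFn_toLp⟩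

lemma continuous_inv_μe : Continuous fun z : ℝ × ℝ × ℝ => |F.μe z.1 z.2|⁻¹ :=
  F.continuous_μe.abs.inv₀ fun z => abs_ne_zero.2 (F.μe_lt z.1 z.2).ne

variable {F} in
lemma IsC1Test.integral_inv_μe_mul_transport {χ : ℝ × ℝ × ℝ → ℝ} (hχ : F.IsC1Test χ) :
    ∫ z, |F.μe z.1 z.2|⁻¹ * F.transport χ z ∂F.base = 0 := by
  obtain ⟨R, hR⟩ := hχ.support
  obtain ⟨C, hC, hb⟩ := F.exists_bound_on_vball F.continuous_inv_μe R
  -- Off the values of `(e, p)` that are attained, `slope` may vanish. Truncation from below makes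
  -- its inverse continuous and changes nothing on the support of `χ`.
  have hM : Continuous fun y : ℝ × ℝ => (max (C + 1)⁻¹ (F.slope y))⁻¹ :=
    (continuous_const.max F.continuous_slope).inv₀ fun y =>
      (lt_max_of_lt_left (by positivity)).ne'
  rw [← hχ.integral_inv_mul_transport hM]
  refine integral_congr_ae ?_
  filter_upwards [hb] with z hz
  by_cases hv : z ∈ vball R
  · have h1 := hz hv
    rw [abs_of_nonneg (by positivity)] at h1
    have h2 : 0 < |F.μe z.1 z.2| := abs_pos.2 (F.μe_lt z.1 z.2).ne
    have h3 : (C + 1)⁻¹ ≤ |F.μe z.1 z.2| := by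
      rw [inv_le_comm₀ (by positivity) h2]; linarith
    rw [slope_inv, max_eq_right h3]
  · have h0 : F.transport χ z = 0 := by
      rw [transport_eq, IsC1Test.fderiv_eq_zero hR z.1 z.2 (not_le.1 hv)]; rfl
    rw [h0, mul_zero, mul_zero]

/-- Since `|μ_e|` is an invariant, `D(χ/|μ_e|) = Dχ/|μ_e|`. Testing with `χ` is thus pairing in
`L²_{|μ_e|}` with elements of the graph, which makes the symmetric relation determine the maximal
domain. -/
lemma exists_test_mem_transportGraph {χ : ℝ × ℝ × ℝ → ℝ} (hχ : F.IsTest χ) :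
    ∃ k l : F.L2W, (k, l) ∈ F.transportGraph ∧
      (∀ h : F.L2W, inner ℝ h k = ∫ z, h z * χ z ∂F.base) ∧
      ∀ h : F.L2W, inner ℝ h l = ∫ z, h z * F.transport χ z ∂F.base := by
  have hχ' := hχ.isC1Test
  obtain ⟨R, hR⟩ := hχ.support
  obtain ⟨T, hT⟩ := hχ'.support_transport
  obtain ⟨k, hk⟩ := F.exists_coeFn_eq (F.continuous_inv_μe.mul hχ.contDiff.continuous)
    ⟨R, fun x v hv => by simp [hR x v hv]⟩
  obtain ⟨l, hl⟩ := F.exists_coeFn_eq (F.continuous_inv_μe.mul hχ'.continuous_transport)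
    ⟨T, fun x v hv => by simp [hT x v hv]⟩
  have hin : ∀ {k : F.L2W} {κ : ℝ × ℝ × ℝ → ℝ},
      k =ᵐ[F.measW] (fun z : ℝ × ℝ × ℝ => |F.μe z.1 z.2|⁻¹ * κ z) →
      ∀ h : F.L2W, inner ℝ h k = ∫ z, h z * κ z ∂F.base := fun {k κ} hk h => by
    rw [F.inner_L2W]
    refine integral_congr_ae ?_
    filter_upwards [F.base_ac_measW.ae_le hk] with z hz
    have h0 : |F.μe z.1 z.2| ≠ 0 := abs_ne_zero.2 (F.μe_lt z.1 z.2).ne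
    rw [hz]
    field_simp
  refine ⟨k, l, ?_, hin hk, hin hl⟩
  intro η hη
  have hη' := hη.isC1Test
  have h1 : F.IsC1Test fun z => χ z * η z :=
    ⟨hχ'.contDiff.mul hη'.contDiff, fun x v => by simp only [hχ.periodic, hη.periodic],
      R, fun x v hv => by simp [hR x v hv]⟩
  have h2 := h1.integral_inv_μe_mul_transport
  have i1 := (F.locL2_L2W k).integrable_mul hη'.continuous_transport hη'.support_transport
  have i2 := (F.locL2_L2W l).integrable_mul hη.contDiff.continuous hη.support
  rw [eq_neg_iff_add_eq_zero, ← integral_add i1 i2, ← h2]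
  refine integral_congr_ae ?_
  filter_upwards [F.base_ac_measW.ae_le hk, F.base_ac_measW.ae_le hl] with z hz hz'
  simp only [Pi.mul_apply] at hz hz'
  rw [hz, hz', F.transport_mul (hχ'.contDiff.differentiable (by norm_num) z)
    (hη'.contDiff.differentiable (by norm_num) z)]
  ring

/-- The transport operator is skew-adjoint. -/
lemma mem_transportGraph_iff {h w : F.L2W} : (h, w) ∈ F.transportGraph ↔
    ∀ k l, (k, l) ∈ F.transportGraph → inner ℝ w k + inner ℝ h l = 0 := by
  refine ⟨fun hh k l hk => F.inner_add_inner_of_mem_transportGraph hh hk, fun H χ hχ => ?_⟩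
  obtain ⟨k, l, hkl, hk, hl⟩ := F.exists_test_mem_transportGraph hχ
  have := H k l hkl
  rw [hk, hl] at this
  linarith

/-! ### Functions of `x` -/

lemma locL2_fst (f : F.L2P) : F.LocL2 fun z => f z.1 := fun R => by
  refine (memLp_congr_ae (ae_restrict_of_ae ?_)).1 (F.locL2_L2W (F.lift _ isWeight_one f) R)
  filter_upwards [F.base_ac_measW.ae_le (F.lift_coeFn _ isWeight_one f)] with z hz
  rw [hz, one_mul]

/-- On functions of `x` alone, `D f = v₁ f'`. The velocity derivatives of the test function
integrate to zero for each `x`, and the weak derivative is tested with `χ(·, v)` for each `v`. -/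
lemma lift_mem_transportGraph {f w : F.L2P} (hfw : F.IsWeakDeriv f w) :
    (F.lift (fun _ => 1) isWeight_one f, F.lift (fun v => v.1) isWeight_fst w)
      ∈ F.transportGraph := by
  intro χ hχ
  have hχ' := hχ.isC1Test
  obtain ⟨R, hR⟩ := hχ.support
  have hd := hχ'.contDiff.differentiable (by norm_num)
  have h0 : ∀ x v, R < ‖v‖ → fderiv ℝ χ (x, v) = 0 := IsC1Test.fderiv_eq_zero hR
  have hcf : ∀ e, Continuous fun z => fderiv ℝ χ z e := fun e =>
    hχ'.continuous_fderiv.clm_apply continuous_const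
  set A : ℝ × ℝ × ℝ → ℝ := fun z => z.2.1 * fderiv ℝ χ z (1, 0, 0) with hA
  set Q : ℝ × ℝ × ℝ → ℝ := fun z => (deriv F.φ₀ z.1) * fderiv ℝ χ z (0, 1, 0)
    + deriv F.ψ₀ z.1 * (z.2.1 * fderiv ℝ χ z (0, 0, 1) - z.2.2 * fderiv ℝ χ z (0, 1, 0)) with hQ
  have hAc : Continuous A := by
    have := hcf (1, 0, 0)
    simp only [hA]; fun_prop
  have hQc : Continuous Q := by
    have := hcf (0, 1, 0)
    have := hcf (0, 0, 1)
    have := F.continuous_deriv_φ₀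
    have := F.continuous_deriv_ψ₀
    simp only [hQ]; fun_prop
  have iA : Integrable (fun z => f z.1 * A z) F.base :=
    (F.locL2_fst f).integrable_mul hAc ⟨R, fun x v hv => by simp [hA, h0 x v hv]⟩
  have iQ : Integrable (fun z => f z.1 * Q z) F.base :=
    (F.locL2_fst f).integrable_mul hQc ⟨R, fun x v hv => by simp [hQ, h0 x v hv]⟩
  have iW : Integrable (fun z : ℝ × ℝ × ℝ => w z.1 * (z.2.1 * χ z)) F.base :=
    (F.locL2_fst w).integrable_mul (continuous_snd.fst.mul hχ.contDiff.continuous)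
      ⟨R, fun x v hv => by simp [hR x v hv]⟩
  have e1 : ∫ z, F.lift (fun _ => 1) isWeight_one f z * F.transport χ z ∂F.base
      = ∫ z, f z.1 * A z ∂F.base + ∫ z, f z.1 * Q z ∂F.base := by
    rw [← integral_add iA iQ]
    refine integral_congr_ae ?_
    filter_upwards [F.base_ac_measW.ae_le (F.lift_coeFn _ isWeight_one f)] with z hz
    rw [hz, transport, hA, hQ]
    ring
  have e2 : ∫ z, F.lift (fun v => v.1) isWeight_fst w z * χ z ∂F.base
      = ∫ z : ℝ × ℝ × ℝ, w z.1 * (z.2.1 * χ z) ∂F.base := by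
    refine integral_congr_ae ?_
    filter_upwards [F.base_ac_measW.ae_le (F.lift_coeFn _ isWeight_fst w)] with z hz
    rw [hz]
    ring
  have hder : ∀ x v, HasDerivAt (fun x => χ (x, v)) (fderiv ℝ χ (x, v) (1, 0, 0)) x := fun x v => by
    have := (hd (x, v)).hasFDerivAt.comp_hasDerivAt x
      ((hasDerivAt_id x).prodMk (hasDerivAt_const x v))
    exact this
  have hdv : ∀ x v e, fderiv ℝ (fun v => χ (x, v)) v e = fderiv ℝ χ (x, v) (0, e) := fun x v e => by
    have := (hd (x, v)).hasFDerivAt.comp v (hasFDerivAt_prodMk_right x v)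
    rw [HasFDerivAt.fderiv (f := fun v => χ (x, v)) this]
    simp
  have hQ0 : ∫ z, f z.1 * Q z ∂F.base = 0 := by
    rw [integral_prod _ iQ]
    refine integral_eq_zero_of_ae (.of_forall fun x => ?_)
    simp only []
    rw [integral_const_mul]
    have h1 : ContDiff ℝ 1 fun v => χ (x, v) :=
      hχ'.contDiff.comp (contDiff_const.prodMk contDiff_id)
    have h2 : HasCompactSupport fun v => χ (x, v) :=
      HasCompactSupport.intro (isCompact_closedBall (0 : ℝ × ℝ) R) fun v hv =>
        hR x v (by simpa using hv)
    have h3 := integral_vfield_eq_zero h1 h2 (deriv F.φ₀ x) (deriv F.ψ₀ x)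
    simp only [hdv] at h3
    simp only [hQ]
    rw [h3, mul_zero]; rfl
  rw [e1, e2, hQ0, add_zero, integral_prod_symm _ iA, integral_prod_symm _ iW, ← integral_neg]
  refine integral_congr_ae (.of_forall fun v => ?_)
  have h4 := hfw (fun x => χ (x, v)) (hχ.contDiff.comp (contDiff_id.prodMk contDiff_const))
    fun x => hχ.periodic x v
  simp only [(hder _ v).deriv] at h4
  have e3 : ∀ x, f x * A (x, v) = v.1 * (f x * fderiv ℝ χ (x, v) (1, 0, 0)) := fun x => by
    simp only [hA]; ring
  have e4 : ∀ x, w x * (v.1 * χ (x, v)) = v.1 * (w x * χ (x, v)) := fun x => by ring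
  simp only [e3, e4]
  rw [integral_const_mul, integral_const_mul, h4]
  ring

/-! ### Parity -/

/-- Reversibility: the reflection of `v₁` carries the vector field to its negative, so `D` exchanges
parity. -/
lemma transport_comp_flip {χ : ℝ × ℝ × ℝ → ℝ} (hχ : Differentiable ℝ χ) (z : ℝ × ℝ × ℝ) :
    F.transport (fun z => χ (flip z)) z = -F.transport χ (flip z) := by
  have h1 : HasFDerivAt flip ((ContinuousLinearMap.fst ℝ ℝ (ℝ × ℝ)).prod
      ((-((ContinuousLinearMap.fst ℝ ℝ ℝ).comp (ContinuousLinearMap.snd ℝ ℝ (ℝ × ℝ)))).prod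
        ((ContinuousLinearMap.snd ℝ ℝ ℝ).comp (ContinuousLinearMap.snd ℝ ℝ (ℝ × ℝ))))) z :=
    ContinuousLinearMap.hasFDerivAt ((ContinuousLinearMap.fst ℝ ℝ (ℝ × ℝ)).prod
      ((-((ContinuousLinearMap.fst ℝ ℝ ℝ).comp (ContinuousLinearMap.snd ℝ ℝ (ℝ × ℝ)))).prod
        ((ContinuousLinearMap.snd ℝ ℝ ℝ).comp (ContinuousLinearMap.snd ℝ ℝ (ℝ × ℝ)))))
  have h2 := (hχ (flip z)).hasFDerivAt.comp z h1
  have h3 : fderiv ℝ (fun z => χ (flip z)) z = _ := h2.fderiv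
  rw [transport_eq, transport_eq, h3, ContinuousLinearMap.comp_apply, ← map_neg]
  congr 1
  ext <;> simp [field, flip]

lemma refl_mem_transportGraph {h w : F.L2W} (hh : (h, w) ∈ F.transportGraph) :
    (F.refl h, -F.refl w) ∈ F.transportGraph := by
  intro χ hχ
  obtain ⟨R, hR⟩ := hχ.support
  have hc : ContDiff ℝ (⊤ : ℕ∞) flip := by unfold flip; fun_prop
  have hχf : F.IsTest fun z => χ (flip z) := by
    refine ⟨hχ.contDiff.comp hc, fun x v => hχ.periodic x _, R, fun x v hv => hR _ _ ?_⟩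
    simpa [flip, Prod.norm_def] using hv
  have h1 := hh _ hχf
  simp only [F.transport_comp_flip (hχ.contDiff.differentiable (by simp))] at h1
  rw [← F.integral_comp_flip, ← F.integral_comp_flip fun z => w z * χ (flip z)] at h1
  simp only [flip_flip] at h1
  have e1 : ∫ z, F.refl h z * F.transport χ z ∂F.base
      = -∫ z, h (flip z) * -F.transport χ z ∂F.base := by
    rw [← integral_neg]
    refine integral_congr_ae ?_
    filter_upwards [F.base_ac_measW.ae_le (F.refl_coeFn h)] with z hz
    rw [hz]; ring
  have e2 : ∫ z, (-F.refl w : F.L2W) z * χ z ∂F.base = -∫ z, w (flip z) * χ z ∂F.base := by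
    rw [← integral_neg]
    refine integral_congr_ae ?_
    filter_upwards [F.base_ac_measW.ae_le (F.refl_coeFn w),
      F.base_ac_measW.ae_le (Lp.coeFn_neg (F.refl w))] with z hz hz'
    rw [hz', Pi.neg_apply, hz]; ring
  simp only []
  rw [e1, e2, h1]

/-! ### The projection onto the kernel -/

lemma mem_kerD_iff {h : F.L2W} : h ∈ F.kerD ↔ (h, 0) ∈ F.transportGraph := Iff.rfl

lemma proj_mem (h : F.L2W) : F.proj h ∈ F.kerD := F.kerD.starProjection_apply_mem h

lemma inner_proj (h k : F.L2W) : inner ℝ (F.proj h) k = inner ℝ h (F.proj k) :=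
  F.kerD.inner_starProjection_left_eq_right h k

lemma proj_eq_self {h : F.L2W} (hh : h ∈ F.kerD) : F.proj h = h :=
  F.kerD.starProjection_eq_self_iff.2 hh

lemma proj_proj (h : F.L2W) : F.proj (F.proj h) = F.proj h := F.proj_eq_self (F.proj_mem h)

lemma proj_eq_zero_iff {h : F.L2W} : F.proj h = 0 ↔ ∀ k ∈ F.kerD, inner ℝ h k = 0 := by
  refine ⟨fun h0 k hk => ?_, fun H => ?_⟩
  · rw [← F.proj_eq_self hk, ← inner_proj, h0, inner_zero_left]
  · have := H _ (F.proj_mem h)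
    rwa [← proj_proj, ← inner_proj, inner_self_eq_zero] at this

/-- For a skew operator the range is orthogonal to the kernel. -/
lemma proj_of_mem_transportGraph {h w : F.L2W} (hh : (h, w) ∈ F.transportGraph) :
    F.proj w = 0 := by
  rw [proj_eq_zero_iff]
  intro k hk
  have := F.inner_add_inner_of_mem_transportGraph hh (F.mem_kerD_iff.1 hk)
  rwa [inner_zero_right, add_zero] at this

lemma refl_mem_kerD {h : F.L2W} (hh : h ∈ F.kerD) : F.refl h ∈ F.kerD := by
  have := F.refl_mem_transportGraph (F.mem_kerD_iff.1 hh)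
  rwa [map_zero, neg_zero] at this

lemma proj_refl (h : F.L2W) : F.proj (F.refl h) = F.refl (F.proj h) := by
  refine Submodule.eq_starProjection_of_mem_orthogonal (F.refl_mem_kerD (F.proj_mem h)) ?_
  rw [← map_sub, Submodule.mem_orthogonal']
  intro k hk
  rw [inner_refl, inner_sub_left, inner_proj, F.proj_eq_self (F.refl_mem_kerD hk), sub_self]

end Equilibrium
end VlasovMaxwell

namespace VlasovMaxwell
namespace Equilibrium

variable (F : Equilibrium)

/-! ### The function `v₁` is not in the range of the transport operator -/

/-- A smooth approximation of the sign function. -/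
def smoothSign (y : ℝ) : ℝ := 2 * Real.smoothTransition ((y + 1) / 2) - 1

lemma contDiff_smoothSign : ContDiff ℝ (⊤ : ℕ∞) smoothSign := by
  have : ContDiff ℝ (⊤ : ℕ∞) fun y : ℝ => Real.smoothTransition ((y + 1) / 2) :=
    Real.smoothTransition.contDiff.comp (by fun_prop)
  unfold smoothSign
  fun_prop

lemma smoothSign_of_one_le {y : ℝ} (h : 1 ≤ y) : smoothSign y = 1 := by
  rw [smoothSign, Real.smoothTransition.one_of_one_le (by linarith)]; norm_num

lemma smoothSign_of_le_neg_one {y : ℝ} (h : y ≤ -1) : smoothSign y = -1 := by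
  rw [smoothSign, Real.smoothTransition.zero_of_nonpos (by linarith)]; norm_num

/-- An invariant function that is positive for `v₁ > 0` and negative for `v₁ < 0`. -/
lemma exists_invariant : ∃ h : ℝ × ℝ × ℝ → ℝ, F.IsC1Test h ∧ (∀ z, F.transport h z = 0) ∧
    (∀ z, 0 ≤ z.2.1 * h z) ∧ ∃ z : ℝ × ℝ × ℝ, z.1 ∈ Ioo 0 F.P ∧ 0 < z.2.1 * h z := by
  obtain ⟨A, hA, ha⟩ := F.exists_bound_of_periodic' F.φ₀_contDiff.continuous F.φ₀_periodic
  obtain ⟨B, hB, hb⟩ := F.exists_bound_of_periodic' F.ψ₀_contDiff.continuous F.ψ₀_periodic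
  -- For `|e - T| < 1` and `|p| < 1` one gets `v₁² = 2(e + φ⁰) - v₂² ≥ 2(T - 1 - A) - (B + 1)² > 1`.
  -- Such orbits never turn, so `smoothSign` is locally the constant sign of `v₁` where `ρ(e, p) ≠
  -- 0`.
  set T := A + (B + 1) ^ 2 + 3 with hT
  set ρ : ℝ × ℝ → ℝ := fun y => cutoff (y.1 - T) * cutoff y.2 with hρ
  have hρc : ContDiff ℝ 1 ρ := by
    have h1 : ContDiff ℝ 1 cutoff := contDiff_cutoff.of_le (by exact_mod_cast le_top)
    exact (h1.comp (contDiff_fst.sub contDiff_const)).mul (h1.comp contDiff_snd)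
  have hρ0 : ∀ y, 0 ≤ ρ y := fun y => mul_nonneg (cutoff_nonneg _) (cutoff_nonneg _)
  have hsup : ∀ z, ρ (F.inv z) ≠ 0 → 1 < |z.2.1| ∧ energy F.φ₀ z.1 z.2 ≤ T + 1 := fun z hz => by
    simp only [hρ, mul_ne_zero_iff] at hz
    have h1 : |energy F.φ₀ z.1 z.2 - T| < 1 := by
      by_contra! h; exact hz.1 (cutoff_eq_zero h)
    have h2 : |momentum F.ψ₀ z.1 z.2| < 1 := by
      by_contra! h; exact hz.2 (cutoff_eq_zero h)
    rw [abs_lt] at h1 h2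
    refine ⟨?_, by linarith⟩
    have h3 := abs_le.1 (ha z.1)
    have h4 := abs_le.1 (hb z.1)
    unfold energy momentum at *
    have h5 : z.2.2 ^ 2 ≤ (B + 1) ^ 2 := sq_le_sq' (by linarith) (by linarith)
    have h6 : 1 < z.2.1 ^ 2 := by nlinarith
    exact (one_lt_sq_iff_one_lt_abs _).1 h6
  set s : ℝ × ℝ × ℝ → ℝ := fun z => smoothSign z.2.1 with hs
  have hsc : ContDiff ℝ 1 s :=
    (contDiff_smoothSign.of_le (by exact_mod_cast le_top)).comp contDiff_snd.fst
  have hmul : ∀ z, ρ (F.inv z) ≠ 0 → z.2.1 * s z = |z.2.1| := fun z hz => by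
    have h1 := (hsup z hz).1
    rcases lt_abs.1 h1 with h | h
    · simp only [hs]
      rw [smoothSign_of_one_le h.le, abs_of_pos (by linarith), mul_one]
    · simp only [hs]
      rw [smoothSign_of_le_neg_one (by linarith), abs_of_neg (by linarith)]; ring
  refine ⟨fun z => ρ (F.inv z) * s z, ⟨(hρc.comp F.contDiff_inv).mul hsc, fun x v => ?_, ?_⟩,
    fun z => ?_, fun z => ?_, ?_⟩
  · simp only [inv_periodic, hs]
  · obtain ⟨R, hR⟩ := F.exists_norm_le_of_energy_le (T + 1)
    refine ⟨R, fun x v hv => ?_⟩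
    by_contra hne
    exact (hR x v hv).not_ge (hsup (x, v) (left_ne_zero_of_mul hne)).2
  · rw [F.transport_inv_mul hρc (hsc.differentiable (by norm_num) z)]
    by_cases hz : ρ (F.inv z) = 0
    · rw [hz, zero_mul]
    · have h1 := (hsup z hz).1
      have h2 : s =ᶠ[nhds z] fun _ => s z := by
        rcases lt_abs.1 h1 with h | h
        · have : ∀ᶠ y : ℝ × ℝ × ℝ in nhds z, 1 < y.2.1 :=
            continuous_snd.fst.continuousAt.eventually_const_lt h
          filter_upwards [this] with y hy
          simp only [hs]
          rw [smoothSign_of_one_le hy.le, smoothSign_of_one_le h.le]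
        · have : ∀ᶠ y : ℝ × ℝ × ℝ in nhds z, 1 < -y.2.1 :=
            continuous_snd.fst.neg.continuousAt.eventually_const_lt h
          filter_upwards [this] with y hy
          simp only [hs]
          rw [smoothSign_of_le_neg_one (by linarith), smoothSign_of_le_neg_one (by linarith)]
      rw [transport_eq, h2.fderiv_eq]
      simp
  · by_cases hz : ρ (F.inv z) = 0
    · simp [hz]
    · rw [mul_left_comm, hmul z hz]
      exact mul_nonneg (hρ0 _) (abs_nonneg _)
  · have hP := F.P_pos
    have h3 := abs_le.1 (ha (F.P / 2))
    have h4 := abs_le.1 (hb (F.P / 2))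
    -- This speed gives the point with `v₂ = ψ⁰` the invariants `(T, 0)`, where both cutoffs equal
    -- `1`.
    set y := Real.sqrt (2 * (T + F.φ₀ (F.P / 2)) - F.ψ₀ (F.P / 2) ^ 2) with hy
    have h5 : F.ψ₀ (F.P / 2) ^ 2 ≤ B ^ 2 := sq_le_sq' (by linarith) (by linarith)
    have h6 : y ^ 2 = 2 * (T + F.φ₀ (F.P / 2)) - F.ψ₀ (F.P / 2) ^ 2 :=
      Real.sq_sqrt (by nlinarith)
    have h7 : F.inv (F.P / 2, y, F.ψ₀ (F.P / 2)) = (T, 0) := by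
      simp only [inv, energy, momentum, h6]
      ext <;> simp
    have h8 : ρ (T, 0) = 1 := by
      simp only [hρ, sub_self]
      rw [cutoff_eq_one (by norm_num), mul_one]
    have h9 : ρ (F.inv (F.P / 2, y, F.ψ₀ (F.P / 2))) ≠ 0 := by rw [h7, h8]; exact one_ne_zero
    refine ⟨(F.P / 2, y, F.ψ₀ (F.P / 2)), ⟨by simpa using hP, by simpa using hP⟩, ?_⟩
    rw [mul_left_comm, hmul _ h9, h7, h8, one_mul]
    exact one_pos.trans (hsup _ h9).1

lemma base_restrict_eq : F.base.restrict (Ioo 0 F.P ×ˢ univ)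
    = (volume : Measure (ℝ × ℝ × ℝ)).restrict (Ioo 0 F.P ×ˢ univ) := by
  have h : F.base = (volume : Measure (ℝ × ℝ × ℝ)).restrict (Ioc 0 F.P ×ˢ univ) := by
    rw [Measure.volume_eq_prod ℝ (ℝ × ℝ), ← Measure.prod_restrict, Measure.restrict_univ]
  rw [h, Measure.restrict_restrict_of_subset]
  exact prod_mono Ioo_subset_Ioc_self subset_rfl

/-- An element of the range of `D` is orthogonal to `ker D`, but `v₁` has a strictly positive
product with the invariant function of `exists_invariant`. -/
lemma eq_zero_of_smul_mem_transportGraph {k : F.L2W} {c : ℝ}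
    (h : (k, c • F.lift (fun v => v.1) isWeight_fst F.one) ∈ F.transportGraph) : c = 0 := by
  obtain ⟨u, hu, hu0, hun, z₀, hz₀, hup⟩ := F.exists_invariant
  obtain ⟨m, hm⟩ := F.exists_coeFn_eq hu.contDiff.continuous hu.support
  have hmk : (m, 0) ∈ F.transportGraph := fun χ hχ => by
    have h1 := hu.isWeakTransport.eq χ hχ.isC1Test
    simp only [hu0, zero_mul, integral_zero] at h1
    have h2 : ∫ z, (0 : F.L2W) z * χ z ∂F.base = 0 := by
      refine integral_eq_zero_of_ae ?_
      filter_upwards [F.base_ac_measW.ae_le (Lp.coeFn_zero ℝ 2 F.measW)] with z hz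
      rw [hz]; simp
    simp only []
    rw [h2, ← h1]
    refine integral_congr_ae ?_
    filter_upwards [F.base_ac_measW.ae_le hm] with z hz
    rw [hz]
  have h1 := F.inner_add_inner_of_mem_transportGraph h hmk
  rw [inner_zero_right, add_zero, real_inner_smul_left] at h1
  refine (mul_eq_zero.1 h1).resolve_right fun h2 => ?_
  have h1x : ∀ᵐ z ∂F.base, F.one z.1 = 1 :=
    Measure.quasiMeasurePreserving_fst.ae F.one_coeFn
  have e : ∀ᵐ z ∂F.base, |F.μe z.1 z.2| * (F.lift (fun v => v.1) isWeight_fst F.one z * m z)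
      = |F.μe z.1 z.2| * (z.2.1 * u z) := by
    filter_upwards [F.base_ac_measW.ae_le hm, h1x,
      F.base_ac_measW.ae_le (F.lift_coeFn _ isWeight_fst F.one)] with z e1 e2 e3
    rw [e1, e3, e2, mul_one]
  rw [F.inner_L2W, integral_congr_ae e] at h2
  have hc : Continuous fun z : ℝ × ℝ × ℝ => |F.μe z.1 z.2| * (z.2.1 * u z) :=
    F.continuous_μe.abs.mul (continuous_snd.fst.mul hu.contDiff.continuous)
  obtain ⟨R, hR⟩ := hu.support
  have h3 := (integral_eq_zero_iff_of_nonneg (fun z => mul_nonneg (abs_nonneg _) (hun z))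
    (F.integrable_of_continuous hc ⟨R, fun x v hv => by simp [hR x v hv]⟩)).1 h2
  have h4 : (fun z : ℝ × ℝ × ℝ => |F.μe z.1 z.2| * (z.2.1 * u z))
      =ᵐ[F.base.restrict (Ioo 0 F.P ×ˢ univ)] fun _ => 0 := ae_restrict_of_ae h3
  rw [base_restrict_eq] at h4
  have h5 := Measure.eqOn_open_of_ae_eq h4 (isOpen_Ioo.prod isOpen_univ) hc.continuousOn
    continuousOn_const (show z₀ ∈ Ioo 0 F.P ×ˢ univ from ⟨hz₀, mem_univ _⟩)
  have h6 : 0 < |F.μe z₀.1 z₀.2| := abs_pos.2 (F.μe_lt _ _).ne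
  exact (mul_pos h6 hup).ne' h5

end Equilibrium
end VlasovMaxwell

namespace VlasovMaxwell
namespace Equilibrium

variable (F : Equilibrium)

/-! ### The maps `h ↦ q(v) h` and their adjoints -/

/-- `h ↦ h`, from `L²_P` to `L²_{|μ_e|}`. -/
def lift₀ : F.L2P →ₗ[ℝ] F.L2W := F.lift (fun _ => 1) isWeight_one

/-- `h ↦ v₁ h`, from `L²_P` to `L²_{|μ_e|}`. -/
def lift₁ : F.L2P →ₗ[ℝ] F.L2W := F.lift (fun v => v.1) isWeight_fst

/-- `h ↦ v₂ h`, from `L²_P` to `L²_{|μ_e|}`. -/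
def lift₂ : F.L2P →ₗ[ℝ] F.L2W := F.lift (fun v => v.2) isWeight_snd

/-- The adjoint of `lift₀`. -/
def adj₀ : F.L2W →ₗ[ℝ] F.L2P := -F.avg (fun _ => 1) isWeight_one

/-- The adjoint of `lift₁`. -/
def adj₁ : F.L2W →ₗ[ℝ] F.L2P := -F.avg (fun v => v.1) isWeight_fst

/-- The adjoint of `lift₂`. -/
def adj₂ : F.L2W →ₗ[ℝ] F.L2P := -F.avg (fun v => v.2) isWeight_snd

lemma inner_adj₀ (w : F.L2W) (f : F.L2P) : inner ℝ (F.adj₀ w) f = inner ℝ w (F.lift₀ f) := by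
  rw [adj₀, LinearMap.neg_apply, inner_neg_left, inner_avg, neg_neg, lift₀]

lemma inner_adj₁ (w : F.L2W) (f : F.L2P) : inner ℝ (F.adj₁ w) f = inner ℝ w (F.lift₁ f) := by
  rw [adj₁, LinearMap.neg_apply, inner_neg_left, inner_avg, neg_neg, lift₁]

lemma inner_adj₂ (w : F.L2W) (f : F.L2P) : inner ℝ (F.adj₂ w) f = inner ℝ w (F.lift₂ f) := by
  rw [adj₂, LinearMap.neg_apply, inner_neg_left, inner_avg, neg_neg, lift₂]

lemma continuous_adj₀ : Continuous F.adj₀ := (F.continuous_avg _ isWeight_one).neg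

lemma refl_lift₀ (f : F.L2P) : F.refl (F.lift₀ f) = F.lift₀ f :=
  F.refl_lift _ isWeight_one (fun _ => rfl) f

lemma refl_lift₁ (f : F.L2P) : F.refl (F.lift₁ f) = -F.lift₁ f := F.refl_lift_fst f

lemma refl_lift₂ (f : F.L2P) : F.refl (F.lift₂ f) = F.lift₂ f :=
  F.refl_lift _ isWeight_snd (fun _ => rfl) f

lemma IsWeakDeriv.lift_mem {f w : F.L2P} (h : F.IsWeakDeriv f w) :
    (F.lift₀ f, F.lift₁ w) ∈ F.transportGraph := F.lift_mem_transportGraph h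

/-- The continuity equation. It is the dual of `D f = v₁ f'`, by skew-adjointness of `D` and of the
weak derivative. -/
lemma isWeakDeriv_adj {h w : F.L2W} (hh : (h, w) ∈ F.transportGraph) :
    F.IsWeakDeriv (F.adj₁ h) (F.adj₀ w) := by
  refine F.isWeakDeriv_of_forall fun g z hg => ?_
  rw [inner_adj₀, inner_adj₁]
  exact F.inner_add_inner_of_mem_transportGraph hh (hg.lift_mem F)

/-! ### The closure of the range of `B` -/

/-- `g / μ_e`, for the component `g` of an element of `X`. -/
def γComp : F.X →ₗ[ℝ] F.L2W :=
  (F.mulμeEquiv.symm.toLinearEquiv : F.L2Inv →ₗ[ℝ] F.L2W) ∘ₗ F.gComp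

/-- `g / μ_e + v₂ ψ`, for an element `(g, E₁, ψ)` of `X`. -/
def δComp : F.X →ₗ[ℝ] F.L2W := F.γComp + F.lift₂ ∘ₗ F.ψComp

lemma mulμe_γComp (u : F.X) : F.mulμe (F.γComp u) = F.gComp u :=
  F.mulμeEquiv.apply_symm_apply _

lemma γComp_eq_iff {u : F.X} {w : F.L2W} : F.γComp u = w ↔ F.gComp u = F.mulμe w :=
  F.mulμeEquiv.symm_apply_eq

lemma δComp_apply (u : F.X) : F.δComp u = F.γComp u + F.lift₂ (F.ψComp u) := rfl

lemma refl_γComp (u : F.X) : F.refl (F.γComp u) = F.γComp u := by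
  rw [← mulμe_mem_Xev_iff, mulμe_γComp]
  exact u.1.2

lemma refl_δComp (u : F.X) : F.refl (F.δComp u) = F.δComp u := by
  rw [δComp_apply, map_add, refl_γComp, refl_lift₂]

lemma continuous_gComp : Continuous F.gComp := continuous_subtype_val.comp continuous_fst

lemma continuous_EComp : Continuous F.EComp := continuous_fst.comp continuous_snd

lemma continuous_ψComp : Continuous F.ψComp :=
  continuous_fst.comp (continuous_subtype_val.comp (continuous_snd.comp continuous_snd))

lemma continuous_δComp : Continuous F.δComp :=
  (F.mulμeEquiv.symm.continuous.comp F.continuous_gComp).add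
    ((F.continuous_lift _ isWeight_snd).comp F.continuous_ψComp)

lemma isClosed_isWeakDeriv : IsClosed {u : F.L2P × F.L2P | F.IsWeakDeriv u.1 u.2} := by
  have : {u : F.L2P × F.L2P | F.IsWeakDeriv u.1 u.2} = ⋂ z : F.H1P,
      {u : F.L2P × F.L2P | inner ℝ u.2 z.1.1 + inner ℝ u.1 z.1.2 = 0} := by
    ext u
    simp only [mem_iInter, mem_ofPred_eq]
    exact ⟨fun h z => h.inner_add_inner F z.2, fun h => F.isWeakDeriv_of_forall
      fun g z hg => h ⟨(g, z), hg⟩⟩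
  rw [this]
  exact isClosed_iInter fun z => isClosed_eq (by fun_prop) continuous_const

/-- The candidate for the closure of the range of `B`. -/
def rangeSpace : Submodule ℝ F.X where
  carrier := {u | F.proj (F.δComp u) = 0 ∧ F.IsWeakDeriv (F.EComp u) (F.adj₀ (F.δComp u))}
  zero_mem' := ⟨by simp, by simpa using IsWeakDeriv.zero F⟩
  add_mem' := fun {a b} ha hb => by
    refine ⟨?_, ?_⟩
    · rw [map_add, map_add, ha.1, hb.1, add_zero]
    · rw [map_add, map_add, map_add]; exact ha.2.add hb.2
  smul_mem' := fun c a ha => by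
    refine ⟨?_, ?_⟩
    · rw [map_smul, map_smul, ha.1, smul_zero]
    · rw [map_smul, map_smul, map_smul]; exact ha.2.smul c

lemma mem_rangeSpace {u : F.X} : u ∈ F.rangeSpace ↔
    F.proj (F.δComp u) = 0 ∧ F.IsWeakDeriv (F.EComp u) (F.adj₀ (F.δComp u)) := Iff.rfl

lemma isClosed_rangeSpace : IsClosed (F.rangeSpace : Set F.X) := by
  have h1 : IsClosed {u | F.proj (F.δComp u) = 0} :=
    isClosed_eq ((F.kerD.starProjection : F.L2W →L[ℝ] F.L2W).continuous.comp F.continuous_δComp)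
      continuous_const
  have h2 := F.isClosed_isWeakDeriv.preimage
    (F.continuous_EComp.prodMk (F.continuous_adj₀.comp F.continuous_δComp))
  exact h1.inter h2

/-- For `u = B(h, E)` the term `v₂ E` cancels in `δ`, which leaves `δ = D h`; the two conditions are
orthogonality to `ker D` and the continuity equation. -/
lemma range_le_rangeSpace : F.graphB.map (LinearMap.snd ℝ F.YDual F.X) ≤ F.rangeSpace := by
  rintro _ ⟨z, ⟨w, h1, h2, h3, h4⟩, rfl⟩
  have e : F.δComp z.2 = w := by
    have : F.γComp z.2 = w + F.lift₂ z.1.2 := by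
      rw [γComp_eq_iff, h2, map_add]; rfl
    rw [δComp_apply, this, h4, map_neg, add_neg_cancel_right]
  refine F.mem_rangeSpace.2 ⟨?_, ?_⟩
  · exact e ▸ F.proj_of_mem_transportGraph h1
  · have h5 : F.EComp z.2 = F.adj₁ z.1.1 := h3
    have := F.isWeakDeriv_adj h1
    rw [← h5, ← e] at this
    exact this

/-- The pairs `(D h, -∫ μ_e v₁ h dv)`, for `h` odd and `D h` even in `v₁`. -/
def oddRange : Submodule ℝ (F.L2W × F.L2P) where
  carrier := {z | ∃ h, (h, z.1) ∈ F.transportGraph ∧ h ∈ F.XodDual ∧ F.refl z.1 = z.1 ∧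
    F.adj₁ h = z.2}
  zero_mem' := ⟨0, F.transportGraph.zero_mem, F.XodDual.zero_mem, map_zero _, map_zero _⟩
  add_mem' := by
    rintro a b ⟨h, h1, h2, h3, h4⟩ ⟨h', h1', h2', h3', h4'⟩
    exact ⟨h + h', F.transportGraph.add_mem h1 h1', F.XodDual.add_mem h2 h2',
      by rw [Prod.fst_add, map_add, h3, h3'], by rw [map_add, h4, h4', Prod.snd_add]⟩
  smul_mem' := by
    rintro c a ⟨h, h1, h2, h3, h4⟩
    exact ⟨c • h, F.transportGraph.smul_mem c h1, F.XodDual.smul_mem c h2,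
      by rw [Prod.smul_fst, map_smul, h3], by rw [map_smul, h4, Prod.smul_snd]⟩

lemma mem_oddRange {w : F.L2W} {e : F.L2P} : (w, e) ∈ F.oddRange ↔
    ∃ h, (h, w) ∈ F.transportGraph ∧ h ∈ F.XodDual ∧ F.refl w = w ∧ F.adj₁ h = e := Iff.rfl

/-- The annihilator of `oddRange`. -/
lemma inner_add_inner_eq_zero {k w : F.L2W} {e f : F.L2P}
    (hk : ∀ w e', (w, e') ∈ F.oddRange → inner ℝ k w + inner ℝ e e' = 0)
    (hw : F.refl w = w) (hp : F.proj w = 0) (hf : F.IsWeakDeriv f (F.adj₀ w)) :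
    inner ℝ k w + inner ℝ e f = 0 := by
  -- Only pairings with even functions occur, so `k` may be replaced by its even part.
  set k' : F.L2W := (2 : ℝ)⁻¹ • (k + F.refl k) with hk'
  have hev : ∀ y, F.refl y = y → inner ℝ k' y = inner ℝ k y := fun y hy => by
    rw [hk', real_inner_smul_left, inner_add_left, inner_refl, hy]; ring
  -- The equation `D k' = v₁ e` by skew-adjointness: for any `(h, l)` in the graph, the odd part of
  -- `h` and the even part of `l` again form a pair in the graph, and the pairings with `k'` and `v₁
  -- e` see only these parts.
  have h1 : (k', F.lift₁ e) ∈ F.transportGraph := by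
    rw [mem_transportGraph_iff]
    intro h l hl
    have hr := F.refl_mem_transportGraph hl
    have h2 := F.transportGraph.smul_mem (2 : ℝ)⁻¹ (F.transportGraph.sub_mem hl hr)
    have h3 : (2 : ℝ)⁻¹ • (h - F.refl h) ∈ F.XodDual := by
      rw [mem_XodDual_iff, map_smul, map_sub, refl_refl, ← smul_neg, neg_sub]
    have h3' : F.refl ((2 : ℝ)⁻¹ • (l - -F.refl l)) = (2 : ℝ)⁻¹ • (l - -F.refl l) := by
      rw [map_smul, map_sub, map_neg, refl_refl, sub_neg_eq_add, sub_neg_eq_add, add_comm]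
    have h4 : inner ℝ k ((2 : ℝ)⁻¹ • (l - -F.refl l))
        + inner ℝ e (F.adj₁ ((2 : ℝ)⁻¹ • (h - F.refl h))) = 0 :=
      hk _ _ (F.mem_oddRange.2 ⟨_, h2, h3, h3', rfl⟩)
    rw [real_inner_comm _ e, inner_adj₁, real_inner_comm (F.lift₁ e)] at h4
    have h5 : inner ℝ k ((2 : ℝ)⁻¹ • (l - -F.refl l)) = inner ℝ k' l := by
      rw [sub_neg_eq_add, hk', real_inner_smul_right, real_inner_smul_left, inner_add_right,
        inner_add_left, inner_refl]
    have h6 : inner ℝ (F.lift₁ e) ((2 : ℝ)⁻¹ • (h - F.refl h)) = inner ℝ (F.lift₁ e) h := by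
      rw [real_inner_smul_right, inner_sub_right, ← inner_refl, refl_lift₁, inner_neg_left]
      ring
    linarith
  set e' := e - F.mean e with he'
  have hm : inner ℝ e' F.one = 0 := by
    rw [he', inner_sub_left, inner_mean_one, sub_self]
  have h2 := F.isWeakDeriv_antideriv hm
  have h3 := F.transportGraph.sub_mem h1 (h2.lift_mem F)
  have h4 : F.lift₁ e - F.lift₁ e' = (F.P⁻¹ * inner ℝ F.one e) • F.lift₁ F.one := by
    rw [← map_sub, he', sub_sub_cancel, mean_apply, map_smul]
  -- After the primitive of `e - mean e` is subtracted, `mean e` times `v₁` is left in the range of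
  -- `D`, so the mean vanishes.
  have h5 : F.P⁻¹ * inner ℝ F.one e = 0 := by
    refine F.eq_zero_of_smul_mem_transportGraph (k := k' - F.lift₀ (F.antideriv e')) ?_
    have : (k' - F.lift₀ (F.antideriv e'), F.lift₁ e - F.lift₁ e') ∈ F.transportGraph := h3
    rw [h4] at this
    exact this
  have h6 : e' = e := by rw [he', mean_apply, h5, zero_smul, sub_zero]
  have h7 : k' - F.lift₀ (F.antideriv e') ∈ F.kerD := by
    have : (k' - F.lift₀ (F.antideriv e'), F.lift₁ e - F.lift₁ e') ∈ F.transportGraph := h3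
    rw [h6, sub_self] at this
    rw [h6]
    exact F.mem_kerD_iff.2 this
  -- Modulo `ker D`, to which `w` is orthogonal, `k'` is a primitive of `e`, and the pairing becomes
  -- an integration by parts in `x`.
  have h8 := F.proj_eq_zero_iff.1 hp _ h7
  rw [inner_sub_right, ← inner_adj₀, sub_eq_zero] at h8
  have h9 := hf.inner_add_inner F h2
  rw [← h8, h6] at h9
  rw [← hev w hw, real_inner_comm, real_inner_comm f]
  exact h9

/-- Double orthogonal complement. The product has the maximum norm, so the argument runs in the
Hilbert product `WithLp 2`, whose topology is the same. -/
lemma mem_closure_oddRange {w : F.L2W} {f : F.L2P} (hw : F.refl w = w) (hp : F.proj w = 0)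
    (hf : F.IsWeakDeriv f (F.adj₀ w)) : (w, f) ∈ closure (F.oddRange : Set (F.L2W × F.L2P)) := by
  set V : Submodule ℝ (WithLp 2 (F.L2W × F.L2P)) :=
    F.oddRange.comap (WithLp.linearEquiv 2 ℝ (F.L2W × F.L2P)).toLinearMap with hV
  have h1 : WithLp.toLp 2 (w, f) ∈ V.topologicalClosure := by
    rw [← Submodule.orthogonal_orthogonal_eq_closure, Submodule.mem_orthogonal]
    intro u hu
    rw [Submodule.mem_orthogonal'] at hu
    have := F.inner_add_inner_eq_zero (k := u.fst) (e := u.snd) (w := w) (f := f)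
      (fun w' e' hwe => by
        have := hu (WithLp.toLp 2 (w', e')) hwe
        rwa [WithLp.prod_inner_apply] at this) hw hp hf
    rw [WithLp.prod_inner_apply]
    exact this
  exact map_mem_closure (f := fun z : WithLp 2 (F.L2W × F.L2P) => z.ofLp) (WithLp.prod_continuous_ofLp 2 F.L2W F.L2P) h1 fun u hu => hu

/-- The component `ψ` is matched exactly by `E = -ψ`, so only `(δ, E₁)` has to be approximated by
pairs in `oddRange`; multiplication by `μ_e` is an isometry. -/
lemma closureRangeB_eq : F.closureRangeB = F.rangeSpace := by
  refine le_antisymm (Submodule.topologicalClosure_minimal _ F.range_le_rangeSpace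
    F.isClosed_rangeSpace) fun u hu => ?_
  rw [mem_rangeSpace] at hu
  have h1 := F.mem_closure_oddRange (F.refl_δComp u) hu.1 hu.2
  change u ∈ closure _
  rw [Metric.mem_closure_iff] at h1 ⊢
  intro ε hε
  obtain ⟨⟨w, e⟩, hwe, hd⟩ := h1 ε hε
  obtain ⟨h, hh, ho, hwr, he⟩ := F.mem_oddRange.1 hwe
  have hev : F.mulμe (w - F.lift₂ (F.ψComp u)) ∈ F.Xev := by
    rw [mulμe_mem_Xev_iff, map_sub, hwr, refl_lift₂]
  refine ⟨(⟨_, hev⟩, e, u.2.2), ⟨((⟨h, ho⟩, -F.ψComp u), _), ⟨w, hh, ?_, ?_, ?_⟩, rfl⟩, ?_⟩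
  · change F.mulμe (w - F.lift₂ (F.ψComp u)) = F.mulμe w + F.mulμe (F.lift₂ (-F.ψComp u))
    rw [← map_add, map_neg, sub_eq_add_neg]
  · exact he.symm
  · exact (neg_neg _).symm
  · rw [Prod.dist_eq] at hd ⊢
    have hd := max_lt_iff.1 hd
    refine max_lt ?_ (max_lt hd.2 (by rw [dist_self]; exact hε))
    have e1 : dist (F.gComp u) (F.mulμe (w - F.lift₂ (F.ψComp u))) = dist (F.δComp u) w := by
      rw [← mulμe_γComp, ← mulμeEquiv_apply, ← mulμeEquiv_apply, F.mulμeEquiv.dist_map,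
        δComp_apply, dist_eq_norm, dist_eq_norm]
      congr 1
      abel
    change dist (F.gComp u) (F.mulμe (w - F.lift₂ (F.ψComp u))) < ε
    rw [e1]
    exact hd.1

end Equilibrium
end VlasovMaxwell

namespace VlasovMaxwell
namespace Equilibrium

variable (F : Equilibrium)

/-! ### The operators on functions of `x` in terms of projections -/

/-- The orthogonal projection onto the complement of `ker D`. -/
def coproj : F.L2W →ₗ[ℝ] F.L2W := LinearMap.id - F.proj

lemma coproj_apply (h : F.L2W) : F.coproj h = h - F.proj h := rfl

lemma inner_coproj (h k : F.L2W) : inner ℝ (F.coproj h) k = inner ℝ h (F.coproj k) := by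
  rw [coproj_apply, coproj_apply, inner_sub_left, inner_sub_right, inner_proj]

lemma proj_coproj (h : F.L2W) : F.proj (F.coproj h) = 0 := by
  rw [coproj_apply, map_sub, proj_proj, sub_self]

lemma coproj_of_mem {h : F.L2W} (hh : h ∈ F.kerD) : F.coproj h = 0 := by
  rw [coproj_apply, F.proj_eq_self hh, sub_self]

lemma coproj_of_proj_eq_zero {h : F.L2W} (hh : F.proj h = 0) : F.coproj h = h := by
  rw [coproj_apply, hh, sub_zero]

lemma coproj_coproj (h : F.L2W) : F.coproj (F.coproj h) = F.coproj h :=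
  F.coproj_of_proj_eq_zero (F.proj_coproj h)

lemma refl_coproj (h : F.L2W) : F.refl (F.coproj h) = F.coproj (F.refl h) := by
  rw [coproj_apply, coproj_apply, map_sub, proj_refl]

/-- The zeroth order part of `𝒜₁⁰`. -/
def K1 : F.L2P →ₗ[ℝ] F.L2P := F.adj₀ ∘ₗ F.coproj ∘ₗ F.lift₀

lemma K1_apply (f : F.L2P) : F.K1 f = F.adj₀ (F.coproj (F.lift₀ f)) := rfl

lemma inner_K1 (f g : F.L2P) :
    inner ℝ (F.K1 f) g = inner ℝ (F.coproj (F.lift₀ f)) (F.coproj (F.lift₀ g)) := by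
  rw [K1_apply, inner_adj₀, ← inner_coproj, coproj_coproj]

lemma continuous_K1 : Continuous F.K1 :=
  continuous_of_formal_adjoint _ F.K1 fun x y => by
    rw [inner_K1, real_inner_comm (F.K1 y), inner_K1, real_inner_comm]

lemma lift₀_one_mem : F.lift₀ F.one ∈ F.kerD := by
  have := F.isWeakDeriv_one.lift_mem F
  rw [map_zero] at this
  exact F.mem_kerD_iff.2 this

/-- Constants lie in `ker D`. This supplies the solvability condition for `𝒜₁⁰` with right side
`ℬ⁰ψ`. -/
lemma inner_adj₀_coproj_one (h : F.L2W) : inner ℝ (F.adj₀ (F.coproj h)) F.one = 0 := by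
  rw [inner_adj₀, inner_coproj, F.coproj_of_mem F.lift₀_one_mem, inner_zero_right]

/-- The first derivative `H²_P → L²_P`. -/
def deriv1 : F.H2P →ₗ[ℝ] F.L2P :=
  LinearMap.fst ℝ _ _ ∘ₗ LinearMap.snd ℝ _ _ ∘ₗ F.H2P.subtype

lemma isWeakDeriv_deriv1 (φ : F.H2P) : F.IsWeakDeriv (F.toL2 φ) (F.deriv1 φ) := φ.2.1

lemma isWeakDeriv_deriv2 (φ : F.H2P) : F.IsWeakDeriv (F.deriv1 φ) (F.deriv2 φ) := φ.2.2

/-- The two terms of order zero combine into `K1`, which is nonnegative by `inner_K1`. -/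
lemma A1_apply (φ : F.H2P) : F.A1 φ = -F.deriv2 φ + F.K1 (F.toL2 φ) := by
  have := F.avg_one_lift_one (F.toL2 φ)
  simp only [A1, LinearMap.add_apply, LinearMap.sub_apply, LinearMap.neg_apply,
    LinearMap.comp_apply, ← this, K1_apply, coproj_apply, adj₀, lift₀, map_sub]
  abel

/-- The moment identity `avg_one_lift_snd` turns multiplication by `∫ μ_p dv` into the identity part
of `1 - 𝒫`. -/
lemma B0_apply (f : F.L2P) : F.B0 f = F.adj₀ (F.coproj (F.lift₂ f)) := by
  have : F.mulOp F.intμp F.measurable_intμp F.bounded_intμp f = _ :=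
    (neg_eq_iff_eq_neg.2 (F.avg_one_lift_snd f)).symm
  simp only [B0, LinearMap.add_apply, LinearMap.neg_apply,
    LinearMap.comp_apply, this, coproj_apply, adj₀, lift₂, map_sub]
  abel

lemma B0star_apply (f : F.L2P) : F.B0star f = F.adj₂ (F.coproj (F.lift₀ f)) := by
  have : F.mulOp F.intμp F.measurable_intμp F.bounded_intμp f = _ :=
    (neg_eq_iff_eq_neg.2 (F.avg_snd_lift_one f)).symm
  simp only [B0star, LinearMap.add_apply, LinearMap.neg_apply,
    LinearMap.comp_apply, this, coproj_apply, adj₂, lift₀, map_sub]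
  abel

lemma inner_B0star (f g : F.L2P) : inner ℝ (F.B0star f) g = inner ℝ f (F.B0 g) := by
  rw [B0star_apply, B0_apply, inner_adj₂, real_inner_comm (F.adj₀ _), inner_adj₀, inner_coproj,
    real_inner_comm]

/-- Multiplication by `∫ v₂ μ_p dv`. -/
def mulCurrent : F.L2P →ₗ[ℝ] F.L2P := F.mulOp F.intv₂μp F.measurable_intv₂μp F.bounded_intv₂μp

lemma A2_apply (φ : F.H2P) : F.A2 φ = -F.deriv2 φ - F.mulCurrent (F.toL2 φ)
    + F.adj₂ (F.proj (F.lift₂ (F.toL2 φ))) := by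
  simp only [A2, LinearMap.sub_apply, LinearMap.neg_apply,
    LinearMap.comp_apply, adj₂, lift₂, mulCurrent]
  abel

/-! ### The inverse of `𝒜₁⁰` -/

lemma IsWeakDeriv.eq_zero {w : F.L2P} (h : F.IsWeakDeriv 0 w) : w = 0 := by
  refine F.eq_zero_of_inner_smooth w fun χ hχ hp => ?_
  have := (F.isWeakDeriv_iff _ _).1 h χ hχ hp
  rw [inner_zero_left] at this
  linarith

lemma inner_A1 (φ η : F.H2P) : inner ℝ (F.A1 φ) (F.toL2 η)
    = inner ℝ (F.deriv1 φ) (F.deriv1 η)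
      + inner ℝ (F.coproj (F.lift₀ (F.toL2 φ))) (F.coproj (F.lift₀ (F.toL2 η))) := by
  have := (F.isWeakDeriv_deriv2 φ).inner_add_inner F (F.isWeakDeriv_deriv1 η)
  rw [A1_apply, inner_add_left, inner_neg_left, inner_K1]
  linarith

/-- With `b = φ'` the equation becomes `b - ∂⁻¹ K1 ∂⁻¹ b = -∂⁻¹ k`. Since `∂⁻¹` is skew and `K1 ≥
0`, the operator on the left is at least `1`, and no spectral theory is needed. -/
lemma exists_isA1Inv {k : F.L2P} (hk : inner ℝ k F.one = 0) : ∃ φ, F.IsA1Inv k φ := by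
  set K : F.L2P →L[ℝ] F.L2P := ⟨F.K1, F.continuous_K1⟩ with hK
  obtain ⟨e, he⟩ := exists_inverse_of_le_inner (1 - F.antideriv.comp (K.comp F.antideriv))
    fun f => by
      have h1 : inner ℝ (F.antideriv (F.K1 (F.antideriv f))) f
          = -inner ℝ (F.coproj (F.lift₀ (F.antideriv f))) (F.coproj (F.lift₀ (F.antideriv f))) := by
        rw [inner_antideriv, inner_K1]
      have h2 : (1 - F.antideriv.comp (K.comp F.antideriv)) f
          = f - F.antideriv (F.K1 (F.antideriv f)) := rfl
      rw [h2, inner_sub_left, h1, real_inner_self_eq_norm_sq, real_inner_self_eq_norm_sq]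
      nlinarith [sq_nonneg ‖F.coproj (F.lift₀ (F.antideriv f))‖]
  set b := e.symm (-F.antideriv k) with hb
  have h3 : b - F.antideriv (F.K1 (F.antideriv b)) = -F.antideriv k := by
    have h4 := he b
    rw [hb, e.apply_symm_apply, ← hb] at h4
    exact h4.symm
  set w := F.K1 (F.antideriv b) - k with hw
  have hwb : F.antideriv w = b := by
    rw [hw, map_sub, sub_eq_add_neg, ← h3]; abel
  have hw1 : inner ℝ w F.one = 0 := by
    rw [hw, inner_sub_left, hk, K1_apply, inner_adj₀_coproj_one, sub_zero]
  have hb1 : inner ℝ b F.one = 0 := by rw [← hwb, inner_antideriv_one]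
  have d1 := F.isWeakDeriv_antideriv hb1
  have d2 := F.isWeakDeriv_antideriv hw1
  rw [hwb] at d2
  refine ⟨⟨(F.antideriv b, b, w), d1, d2⟩, ?_, ?_⟩
  · rw [perInt_eq]
    exact F.inner_antideriv_one b
  · rw [A1_apply]
    change -w + F.K1 (F.antideriv b) = k
    rw [hw]; abel

/-- Pairing `𝒜₁⁰ ζ = 0` with `ζ` gives `ζ' = 0`, so `ζ` is constant, and its mean is zero. -/
lemma isA1Inv_unique {k : F.L2P} {φ η : F.H2P} (hφ : F.IsA1Inv k φ) (hη : F.IsA1Inv k η) :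
    φ = η := by
  rw [← sub_eq_zero]
  set ζ := φ - η with hζ
  have h1 : F.A1 ζ = 0 := by rw [hζ, map_sub, hφ.2, hη.2, sub_self]
  have h2 : inner ℝ (F.toL2 ζ) F.one = 0 := by
    rw [← perInt_eq, hζ, map_sub, map_sub, hφ.1, hη.1, sub_self]
  have h3 := F.inner_A1 ζ ζ
  rw [h1, inner_zero_left, real_inner_self_eq_norm_sq, real_inner_self_eq_norm_sq] at h3
  have h4 : F.deriv1 ζ = 0 := by
    rw [← norm_eq_zero, ← sq_eq_zero_iff]
    nlinarith [sq_nonneg ‖F.deriv1 ζ‖, sq_nonneg ‖F.coproj (F.lift₀ (F.toL2 ζ))‖]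
  have h5 : F.toL2 ζ = 0 := by
    have := (F.isWeakDeriv_deriv1 ζ).eq_add_antideriv
    rwa [F.mean_eq_zero h2, h4, map_zero, add_zero] at this
  have h6 : F.deriv2 ζ = 0 := by
    rw [A1_apply, h5, map_zero, add_zero, neg_eq_zero] at h1
    exact h1
  exact Subtype.ext (Prod.ext h5 (Prod.ext h4 h6))

lemma existsUnique_isA1Inv (f : F.L2P) : ∃! φ, F.IsA1Inv (F.B0 f) φ := by
  obtain ⟨φ, hφ⟩ := F.exists_isA1Inv (k := F.B0 f) (by
    rw [B0_apply, inner_adj₀_coproj_one])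
  exact ⟨φ, hφ, fun η hη => F.isA1Inv_unique hη hφ⟩

/-- `(𝒜₁⁰)⁻¹ ℬ⁰` -/
def potential : F.L2P →ₗ[ℝ] F.H2P where
  toFun f := (F.existsUnique_isA1Inv f).choose
  map_add' f g := by
    have hf := (F.existsUnique_isA1Inv f).choose_spec.1
    have hg := (F.existsUnique_isA1Inv g).choose_spec.1
    exact F.isA1Inv_unique (F.existsUnique_isA1Inv (f + g)).choose_spec.1
      ⟨by rw [map_add, map_add, hf.1, hg.1, add_zero], by rw [map_add, map_add, hf.2, hg.2]⟩
  map_smul' c f := by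
    have hf := (F.existsUnique_isA1Inv f).choose_spec.1
    exact F.isA1Inv_unique (F.existsUnique_isA1Inv (c • f)).choose_spec.1
      ⟨by rw [map_smul, RingHom.id_apply, map_smul, hf.1, smul_zero],
        by rw [map_smul, RingHom.id_apply, map_smul, hf.2]⟩

lemma isA1Inv_potential (f : F.L2P) : F.IsA1Inv (F.B0 f) (F.potential f) :=
  (F.existsUnique_isA1Inv f).choose_spec.1

lemma A1_potential (f : F.L2P) : F.A1 (F.potential f) = F.B0 f := (F.isA1Inv_potential f).2

lemma eq_potential {f : F.L2P} {φ : F.H2P} (h : F.IsA1Inv (F.B0 f) φ) : φ = F.potential f :=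
  F.isA1Inv_unique h (F.isA1Inv_potential f)

/-- The potential as an element of `L²_P`. -/
def pot : F.L2P →ₗ[ℝ] F.L2P := F.toL2 ∘ₗ F.potential

/-- The derivative of the potential. -/
def pot' : F.L2P →ₗ[ℝ] F.L2P := F.deriv1 ∘ₗ F.potential

lemma isWeakDeriv_pot (f : F.L2P) : F.IsWeakDeriv (F.pot f) (F.pot' f) :=
  F.isWeakDeriv_deriv1 _

lemma isWeakDeriv_pot' (f : F.L2P) : F.IsWeakDeriv (F.pot' f) (F.K1 (F.pot f) - F.B0 f) := by
  have h1 := F.A1_potential f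
  rw [A1_apply] at h1
  have h2 : F.K1 (F.pot f) - F.B0 f = F.deriv2 (F.potential f) := by
    rw [← h1, pot, LinearMap.comp_apply]; abel
  rw [h2]
  exact F.isWeakDeriv_deriv2 _

lemma inner_B0_pot (f g : F.L2P) : inner ℝ (F.B0 f) (F.pot g) = inner ℝ (F.pot' f) (F.pot' g)
    + inner ℝ (F.coproj (F.lift₀ (F.pot f))) (F.coproj (F.lift₀ (F.pot g))) := by
  rw [← A1_potential]
  exact F.inner_A1 _ _

/-! ### The reduced form -/

/-- The zeroth order part of `ℒ⁰`. -/
def K0 : F.L2P →ₗ[ℝ] F.L2P :=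
  -F.mulCurrent + F.adj₂ ∘ₗ F.proj ∘ₗ F.lift₂ + F.B0star ∘ₗ F.pot

/-- Apart from the current term, the part of `ℒ⁰` of order zero is the energy of the minimizer: its
kinetic components in and orthogonal to `ker D`, and its electric field. -/
lemma inner_K0 (f g : F.L2P) : inner ℝ (F.K0 f) g = -inner ℝ (F.mulCurrent f) g
    + inner ℝ (F.proj (F.lift₂ f)) (F.proj (F.lift₂ g)) + inner ℝ (F.pot' f) (F.pot' g)
    + inner ℝ (F.coproj (F.lift₀ (F.pot f))) (F.coproj (F.lift₀ (F.pot g))) := by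
  have h1 : F.K0 f = -F.mulCurrent f + F.adj₂ (F.proj (F.lift₂ f)) + F.B0star (F.pot f) := rfl
  have h2 := F.inner_B0_pot g f
  rw [h1, inner_add_left, inner_add_left, inner_neg_left, inner_adj₂, ← F.proj_proj (F.lift₂ f),
    inner_proj, proj_proj, inner_B0star,
    real_inner_comm (F.B0 g), h2, real_inner_comm (F.pot' f),
    real_inner_comm (F.coproj (F.lift₀ (F.pot f)))]
  ring

lemma inner_K0_comm (f g : F.L2P) : inner ℝ (F.K0 f) g = inner ℝ f (F.K0 g) := by
  rw [real_inner_comm (F.K0 g), inner_K0, inner_K0, mulCurrent, inner_mulOp,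
    real_inner_comm _ (F.proj (F.lift₂ f)), real_inner_comm _ (F.pot' f),
    real_inner_comm _ (F.coproj (F.lift₀ (F.pot f))), real_inner_comm f]

/-- `K0` as a bounded operator. -/
def K0L : F.L2P →L[ℝ] F.L2P :=
  ⟨F.K0, continuous_of_formal_adjoint _ F.K0 F.inner_K0_comm⟩

/-- The isomorphism `ψ' + mean ψ ↦ ψ` from `L²_P` onto `H¹_P`. -/
def primitive : F.L2P →L[ℝ] F.L2P := F.antideriv + F.mean

lemma primitive_apply (f : F.L2P) : F.primitive f = F.antideriv f + F.mean f := rfl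

lemma isWeakDeriv_primitive (f : F.L2P) : F.IsWeakDeriv (F.primitive f) (f - F.mean f) := by
  have h1 := (F.isWeakDeriv_antideriv (F.inner_sub_mean_one f)).add
    (F.isWeakDeriv_one.smul (F.P⁻¹ * inner ℝ F.one f))
  rw [map_sub, antideriv_mean, sub_zero, smul_zero, add_zero, ← mean_apply] at h1
  exact h1

lemma mean_primitive (f : F.L2P) : F.mean (F.primitive f) = F.mean f := by
  rw [primitive_apply, map_add, mean_antideriv, mean_mean, zero_add]

lemma IsWeakDeriv.primitive_eq {f w : F.L2P} (h : F.IsWeakDeriv f w) :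
    F.primitive (w + F.mean f) = f ∧ w + F.mean f - F.mean (w + F.mean f) = w := by
  have h1 := F.mean_eq_zero h.inner_one
  refine ⟨?_, ?_⟩
  · rw [primitive_apply, map_add, map_add, antideriv_mean, h1, mean_mean, add_zero, zero_add,
      add_comm]
    exact (h.eq_add_antideriv).symm
  · rw [map_add, h1, mean_mean, zero_add, add_sub_cancel_right]

lemma injective_primitive : Function.Injective F.primitive := by
  rw [injective_iff_map_eq_zero]
  intro f hf
  have h1 := F.mean_primitive f
  have h2 := F.isWeakDeriv_primitive f
  rw [hf, map_zero] at h1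
  rw [hf, ← h1, sub_zero] at h2
  exact h2.eq_zero F

lemma isCompactOperator_primitive : IsCompactOperator F.primitive := by
  refine F.isCompactOperator_antideriv.add ?_
  have h : IsCompactOperator (ContinuousLinearMap.toSpanSingleton ℝ F.one) :=
    isCompactOperator_of_locallyCompactSpace_rng _
  exact (h.comp_clm (innerSL ℝ F.one)).smul F.P⁻¹

/-- The reduced quadratic form, in terms of `ψ' + mean ψ`. -/
def redOp : F.L2P →L[ℝ] F.L2P :=
  1 - F.mean + F.primitive.adjoint.comp (F.K0L.comp F.primitive)

lemma inner_redOp (f g : F.L2P) : inner ℝ (F.redOp f) g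
    = inner ℝ (f - F.mean f) (g - F.mean g) + inner ℝ (F.K0 (F.primitive f)) (F.primitive g) := by
  have h1 : F.redOp f = f - F.mean f + F.primitive.adjoint (F.K0 (F.primitive f)) := rfl
  have h2 : inner ℝ (f - F.mean f) (F.mean g) = 0 := by
    rw [← inner_mean, map_sub, mean_mean, sub_self, inner_zero_left]
  rw [h1, inner_add_left, ContinuousLinearMap.adjoint_inner_left, inner_sub_right, h2, sub_zero]

lemma isSymmetric_redOp : (F.redOp : F.L2P →ₗ[ℝ] F.L2P).IsSymmetric := fun f g => by
  change inner ℝ (F.redOp f) g = inner ℝ f (F.redOp g)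
  rw [real_inner_comm (F.redOp g), inner_redOp, inner_redOp, inner_K0_comm,
    real_inner_comm (f - F.mean f), real_inner_comm (F.primitive f)]

/-- Gårding's inequality: `‖f‖² = ‖f - mean f‖² + ‖mean f‖²`, the mean is controlled by `primitive
f` since both have the same mean, and `K0` is bounded. -/
lemma norm_sq_le_redOp (f : F.L2P) :
    ‖f‖ ^ 2 ≤ inner ℝ (F.redOp f) f + (‖F.K0L‖ + 1) * ‖F.primitive f‖ ^ 2 := by
  have h0 : ∀ f g, inner ℝ (F.mean f) (F.mean g) = inner ℝ (F.mean f) g := fun f g => by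
    rw [← inner_mean, mean_mean]
  have h1 : ‖F.mean f‖ ≤ ‖F.primitive f‖ := by
    have h2 : ‖F.mean f‖ ^ 2 ≤ ‖F.mean f‖ * ‖F.primitive f‖ := by
      rw [← real_inner_self_eq_norm_sq]
      nth_rw 2 [← mean_primitive]
      rw [h0]
      exact real_inner_le_norm _ _
    by_contra! h3
    nlinarith [norm_nonneg (F.primitive f)]
  have h4 : inner ℝ (f - F.mean f) (f - F.mean f) = ‖f‖ ^ 2 - ‖F.mean f‖ ^ 2 := by
    rw [← real_inner_self_eq_norm_sq, ← real_inner_self_eq_norm_sq, inner_sub_left,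
      inner_sub_right, inner_sub_right, h0, real_inner_comm f (F.mean f)]
    ring
  have h5 : |inner ℝ (F.K0 (F.primitive f)) (F.primitive f)| ≤ ‖F.K0L‖ * ‖F.primitive f‖ ^ 2 := by
    refine (abs_real_inner_le_norm _ _).trans ?_
    rw [pow_two, ← mul_assoc]
    exact mul_le_mul_of_nonneg_right (F.K0L.le_opNorm _) (norm_nonneg _)
  rw [inner_redOp, h4]
  have h6 := (abs_le.1 h5).1
  have h7 : ‖F.mean f‖ ^ 2 ≤ ‖F.primitive f‖ ^ 2 := pow_le_pow_left₀ (norm_nonneg _) h1 2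
  linarith

end Equilibrium
end VlasovMaxwell

namespace VlasovMaxwell
namespace Equilibrium

variable (F : Equilibrium)

/-! ### The form `L` on the closure of the range of `B` -/

/-- The coordinate `ψ' + mean ψ` on `X`. -/
def coord : F.X →ₗ[ℝ] F.L2P := F.ψComp' + (F.mean : F.L2P →ₗ[ℝ] F.L2P) ∘ₗ F.ψComp

lemma isWeakDeriv_ψComp (u : F.X) : F.IsWeakDeriv (F.ψComp u) (F.ψComp' u) := u.2.2.2

lemma primitive_coord (u : F.X) : F.primitive (F.coord u) = F.ψComp u :=
  ((F.isWeakDeriv_ψComp u).primitive_eq F).1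

lemma coord_sub_mean (u : F.X) : F.coord u - F.mean (F.coord u) = F.ψComp' u :=
  ((F.isWeakDeriv_ψComp u).primitive_eq F).2

/-- The deviation of `g / μ_e` from its value at the minimizer. -/
def γDev : F.X →ₗ[ℝ] F.L2W :=
  F.γComp + (F.proj ∘ₗ F.lift₂ + F.coproj ∘ₗ F.lift₀ ∘ₗ F.pot) ∘ₗ F.ψComp

/-- The deviation of `E₁` from its value at the minimizer. -/
def EDev : F.X →ₗ[ℝ] F.L2P := F.EComp + F.pot' ∘ₗ F.ψComp

lemma γDev_apply (u : F.X) : F.γDev u = F.γComp u + (F.proj (F.lift₂ (F.ψComp u))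
    + F.coproj (F.lift₀ (F.pot (F.ψComp u)))) := rfl

lemma EDev_apply (u : F.X) : F.EDev u = F.EComp u + F.pot' (F.ψComp u) := rfl

lemma γDev_eq (u : F.X) : F.γDev u = F.δComp u - F.coproj (F.lift₂ (F.ψComp u))
    + F.coproj (F.lift₀ (F.pot (F.ψComp u))) := by
  rw [γDev_apply, δComp_apply, F.coproj_apply (F.lift₂ _)]
  abel

lemma proj_γDev {u : F.X} (hu : u ∈ F.rangeSpace) : F.proj (F.γDev u) = 0 := by
  rw [γDev_eq, map_add, map_sub, proj_coproj, proj_coproj, hu.1, sub_zero, add_zero]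

/-- Together with `proj_γDev` this says that deviations satisfy the constraints with `ψ = 0`; the
equation for the potential is what makes the inhomogeneous terms cancel. -/
lemma isWeakDeriv_EDev {u : F.X} (hu : u ∈ F.rangeSpace) :
    F.IsWeakDeriv (F.EDev u) (F.adj₀ (F.γDev u)) := by
  have h := hu.2.add (F.isWeakDeriv_pot' (F.ψComp u))
  have e : F.adj₀ (F.γDev u) = F.adj₀ (F.δComp u)
      + (F.K1 (F.pot (F.ψComp u)) - F.B0 (F.ψComp u)) := by
    rw [γDev_eq, map_add, map_sub, B0_apply, K1_apply]
    abel
  rw [e]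
  exact h

lemma formL_apply (u w : F.X) : F.formL u w = inner ℝ (F.γComp u) (F.γComp w)
    + inner ℝ (F.EComp u) (F.EComp w) + inner ℝ (F.ψComp' u) (F.ψComp' w)
    - inner ℝ (F.mulCurrent (F.ψComp u)) (F.ψComp w) := by
  have h : inner ℝ (F.gComp u) (F.gComp w) = inner ℝ (F.γComp u) (F.γComp w) :=
    (F.mulμeEquiv.symm.inner_map_map _ _).symm
  rw [← h]
  rfl

/-- Decomposition of the form `L` on the closure of the range of `B`. -/
lemma formL_eq {u w : F.X} (hu : u ∈ F.rangeSpace) (hw : w ∈ F.rangeSpace) :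
    F.formL u w = inner ℝ (F.redOp (F.coord u)) (F.coord w) + inner ℝ (F.γDev u) (F.γDev w)
      + inner ℝ (F.EDev u) (F.EDev w) := by
  -- The Euler-Lagrange equation: the minimizer is orthogonal to every admissible deviation. Its
  -- part in `ker D` drops out by `𝒫 γDev = 0`, the rest cancels against the electric term by
  -- integration by parts.
  have cross : ∀ {u w : F.X}, w ∈ F.rangeSpace →
      inner ℝ (F.proj (F.lift₂ (F.ψComp u)) + F.coproj (F.lift₀ (F.pot (F.ψComp u)))) (F.γDev w)
        + inner ℝ (F.pot' (F.ψComp u)) (F.EDev w) = 0 := fun {u w} hw => by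
    have h1 := (F.isWeakDeriv_EDev hw).inner_add_inner F (F.isWeakDeriv_pot (F.ψComp u))
    rw [inner_add_left, inner_proj, F.proj_γDev hw, inner_zero_right, inner_coproj,
      F.coproj_of_proj_eq_zero (F.proj_γDev hw), zero_add, real_inner_comm, ← inner_adj₀,
      real_inner_comm (F.EDev w)]
    exact h1
  have c1 := cross (u := u) hw
  have c2 := cross (u := w) hu
  have orth : ∀ a b : F.L2W, inner ℝ (F.proj a) (F.coproj b) = 0 := fun a b => by
    rw [inner_proj, proj_coproj, inner_zero_right]
  have orth' : ∀ a b : F.L2W, inner ℝ (F.coproj b) (F.proj a) = 0 := fun a b => by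
    rw [real_inner_comm, orth]
  have e1 : ∀ u, F.γComp u = F.γDev u - (F.proj (F.lift₂ (F.ψComp u))
    + F.coproj (F.lift₀ (F.pot (F.ψComp u)))) := fun u => by rw [γDev_apply, add_sub_cancel_right]
  have e2 : ∀ u, F.EComp u = F.EDev u - F.pot' (F.ψComp u) := fun u => by
    rw [EDev_apply, add_sub_cancel_right]
  rw [formL_apply, inner_redOp, primitive_coord, primitive_coord, coord_sub_mean, coord_sub_mean,
    inner_K0, e1 u, e1 w, e2 u, e2 w]
  simp only [inner_sub_left, inner_sub_right]
  rw [real_inner_comm (F.proj (F.lift₂ (F.ψComp w)) + F.coproj (F.lift₀ (F.pot (F.ψComp w))))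
    (F.γDev u), real_inner_comm (F.pot' (F.ψComp w)) (F.EDev u)]
  have e3 : inner ℝ (F.proj (F.lift₂ (F.ψComp u)) + F.coproj (F.lift₀ (F.pot (F.ψComp u))))
      (F.proj (F.lift₂ (F.ψComp w)) + F.coproj (F.lift₀ (F.pot (F.ψComp w))))
      = inner ℝ (F.proj (F.lift₂ (F.ψComp u))) (F.proj (F.lift₂ (F.ψComp w)))
        + inner ℝ (F.coproj (F.lift₀ (F.pot (F.ψComp u)))) (F.coproj (F.lift₀ (F.pot (F.ψComp w)))) := by
    rw [inner_add_left, inner_add_right, inner_add_right, orth, orth']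
    ring
  rw [e3]
  linarith

/-- The component `g / μ_e` of the minimizer. -/
def minγ : F.L2P →ₗ[ℝ] F.L2W :=
  -((F.proj ∘ₗ F.lift₂ + F.coproj ∘ₗ F.lift₀ ∘ₗ F.pot) ∘ₗ (F.primitive : F.L2P →ₗ[ℝ] F.L2P))

lemma minγ_apply (f : F.L2P) : F.minγ f = -(F.proj (F.lift₂ (F.primitive f))
    + F.coproj (F.lift₀ (F.pot (F.primitive f)))) := rfl

lemma refl_minγ (f : F.L2P) : F.refl (F.minγ f) = F.minγ f := by
  rw [minγ_apply, map_neg, map_add, ← proj_refl, refl_lift₂, refl_coproj, refl_lift₀]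

/-- The minimizer of `⟨L u, u⟩` in the closure of the range of `B`, for given `ψ`. -/
def minimizer : F.L2P →ₗ[ℝ] F.X :=
  ((F.mulμe ∘ₗ F.minγ).codRestrict F.Xev fun f =>
      (F.mulμe_mem_Xev_iff _).2 (F.refl_minγ f)).prod
    ((-(F.pot' ∘ₗ (F.primitive : F.L2P →ₗ[ℝ] F.L2P))).prod
      (((F.primitive : F.L2P →ₗ[ℝ] F.L2P).prod
        (LinearMap.id - (F.mean : F.L2P →ₗ[ℝ] F.L2P))).codRestrict F.H1P
          fun f => by
            rw [LinearMap.prod_apply]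
            exact F.isWeakDeriv_primitive f))

lemma ψComp_minimizer (f : F.L2P) : F.ψComp (F.minimizer f) = F.primitive f := rfl

lemma EComp_minimizer (f : F.L2P) : F.EComp (F.minimizer f) = -F.pot' (F.primitive f) := rfl

lemma γComp_minimizer (f : F.L2P) : F.γComp (F.minimizer f) = F.minγ f :=
  F.γComp_eq_iff.2 rfl

lemma coord_minimizer (f : F.L2P) : F.coord (F.minimizer f) = f := by
  refine F.injective_primitive ?_
  rw [primitive_coord, ψComp_minimizer]

lemma γDev_minimizer (f : F.L2P) : F.γDev (F.minimizer f) = 0 := by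
  rw [γDev_apply, γComp_minimizer, ψComp_minimizer, minγ_apply, neg_add_cancel]

lemma EDev_minimizer (f : F.L2P) : F.EDev (F.minimizer f) = 0 := by
  rw [EDev_apply, EComp_minimizer, ψComp_minimizer, neg_add_cancel]

lemma minimizer_mem (f : F.L2P) : F.minimizer f ∈ F.rangeSpace := by
  have e : F.δComp (F.minimizer f) = F.coproj (F.lift₂ (F.primitive f))
      - F.coproj (F.lift₀ (F.pot (F.primitive f))) := by
    have := F.γDev_eq (F.minimizer f)
    rw [γDev_minimizer, ψComp_minimizer] at this
    rw [eq_sub_iff_add_eq, ← sub_eq_zero, this]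
    abel
  refine F.mem_rangeSpace.2 ⟨?_, ?_⟩
  · rw [e, map_sub, proj_coproj, proj_coproj, sub_zero]
  · rw [e, EComp_minimizer, map_sub, ← B0_apply, ← K1_apply]
    have := (F.isWeakDeriv_pot' (F.primitive f)).smul (-1)
    rwa [neg_one_smul, neg_one_smul, neg_sub] at this

lemma formL_minimizer (f : F.L2P) {w : F.X} (hw : w ∈ F.rangeSpace) :
    F.formL (F.minimizer f) w = inner ℝ (F.redOp f) (F.coord w) := by
  rw [F.formL_eq (F.minimizer_mem f) hw, coord_minimizer, γDev_minimizer, EDev_minimizer,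
    inner_zero_left, inner_zero_left, add_zero, add_zero]

/-- For `ψ = 0` the form is a sum of squares of the deviations, which then equal `γ` and `E₁`. -/
lemma eq_zero_of_formL {u : F.X} (hu : u ∈ F.rangeSpace) (h0 : F.coord u = 0)
    (h : F.formL u u = 0) : u = 0 := by
  have h1 := F.formL_eq hu hu
  rw [h, h0, map_zero, inner_zero_left, real_inner_self_eq_norm_sq,
    real_inner_self_eq_norm_sq] at h1
  have hγ : F.γDev u = 0 := by
    rw [← norm_eq_zero, ← sq_eq_zero_iff]
    nlinarith [sq_nonneg ‖F.γDev u‖, sq_nonneg ‖F.EDev u‖]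
  have hE : F.EDev u = 0 := by
    rw [← norm_eq_zero, ← sq_eq_zero_iff]
    nlinarith [sq_nonneg ‖F.γDev u‖, sq_nonneg ‖F.EDev u‖]
  have hψ : F.ψComp u = 0 := by rw [← primitive_coord, h0, map_zero]
  have hψ' : F.ψComp' u = 0 := by rw [← coord_sub_mean, h0, map_zero, sub_zero]
  rw [γDev_apply, hψ] at hγ
  rw [EDev_apply, hψ, map_zero, add_zero] at hE
  simp only [map_zero, add_zero] at hγ
  have hg : F.gComp u = 0 := by rw [← mulμe_γComp, hγ, map_zero]
  exact Prod.ext (Subtype.ext hg) (Prod.ext hE (Subtype.ext (Prod.ext hψ hψ')))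

/-- Passing to `coord` discards nonnegative squares and can only lower the form; conversely
`minimizer` realizes the reduced form exactly. -/
lemma negIndex_formL : negIndex F.closureRangeB (fun u => F.formL u u)
    = negIndex ⊤ (fun f => inner ℝ (F.redOp f) f) := by
  rw [closureRangeB_eq]
  refine le_antisymm (negIndex_le_negIndex F.coord (fun _ _ => trivial) (fun u hu => ?_)
    fun u hu h0 => ?_) (negIndex_le_negIndex F.minimizer (fun f _ => F.minimizer_mem f)
    (fun f _ => ?_) fun f _ h0 => ?_)
  · rw [F.formL_eq hu hu]
    have h1 : 0 ≤ inner ℝ (F.γDev u) (F.γDev u) := real_inner_self_nonneg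
    have h2 : 0 ≤ inner ℝ (F.EDev u) (F.EDev u) := real_inner_self_nonneg
    linarith
  · rw [F.formL_eq hu hu, h0, inner_zero_right, zero_add]
    exact add_nonneg real_inner_self_nonneg real_inner_self_nonneg
  · rw [F.formL_minimizer f (F.minimizer_mem f), coord_minimizer]
  · rw [← F.coord_minimizer f, h0, map_zero, inner_zero_right]

/-! ### The operator `ℒ⁰` -/

/-- `ℒ⁰ ψ` -/
def L0 : F.H2P →ₗ[ℝ] F.L2P := -F.deriv2 + F.K0 ∘ₗ F.toL2

lemma mem_graphL0_iff {z : F.H2P × F.L2P} : z ∈ F.graphL0 ↔ z.2 = F.L0 z.1 := by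
  have e : F.B0star (F.toL2 (F.potential (F.toL2 z.1))) + F.A2 z.1 = F.L0 z.1 := by
    rw [A2_apply]
    simp only [L0, K0, pot, LinearMap.add_apply, LinearMap.neg_apply, LinearMap.comp_apply]
    abel
  constructor
  · rintro ⟨φ, h1, h2⟩
    rw [h2, F.eq_potential h1, e]
  · intro h
    exact ⟨_, F.isA1Inv_potential _, h.trans e.symm⟩

/-- The map `ψ ↦ ψ' + mean ψ` on `H²_P`. -/
def coordH2 : F.H2P →ₗ[ℝ] F.L2P := F.deriv1 + (F.mean : F.L2P →ₗ[ℝ] F.L2P) ∘ₗ F.toL2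

lemma primitive_coordH2 (z : F.H2P) : F.primitive (F.coordH2 z) = F.toL2 z :=
  ((F.isWeakDeriv_deriv1 z).primitive_eq F).1

lemma coordH2_sub_mean (z : F.H2P) : F.coordH2 z - F.mean (F.coordH2 z) = F.deriv1 z :=
  ((F.isWeakDeriv_deriv1 z).primitive_eq F).2

lemma inner_redOp_coordH2 (z : F.H2P) (g : F.L2P) :
    inner ℝ (F.redOp (F.coordH2 z)) g = inner ℝ (F.L0 z) (F.primitive g) := by
  have h1 := (F.isWeakDeriv_deriv2 z).inner_add_inner F (F.isWeakDeriv_primitive g)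
  have h2 : F.L0 z = -F.deriv2 z + F.K0 (F.toL2 z) := rfl
  rw [inner_redOp, primitive_coordH2, coordH2_sub_mean, h2, inner_add_left, inner_neg_left]
  linarith

lemma toL2_eq_zero {z : F.H2P} (hz : F.toL2 z = 0) : z = 0 := by
  have h1 := F.isWeakDeriv_deriv1 z
  rw [hz] at h1
  have h2 := F.isWeakDeriv_deriv2 z
  rw [h1.eq_zero F] at h2
  exact Subtype.ext (Prod.ext hz (Prod.ext (h1.eq_zero F) (h2.eq_zero F)))

lemma coordH2_eq_zero {z : F.H2P} (hz : F.coordH2 z = 0) : z = 0 :=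
  F.toL2_eq_zero (by rw [← primitive_coordH2, hz, map_zero])

/-- Elliptic regularity: the weak eigenvalue equation states that `ψ'` has a weak derivative in
`L²_P`, so weak eigenvectors in `H¹_P` belong to `H²_P`. -/
lemma map_eigenspaceL0 (lam : ℝ) : (F.eigenspaceL0 lam).map F.coordH2
    = pencilEigenspace (opForm F.redOp)
      ((innerₗ F.L2P).compl₁₂ (F.primitive : F.L2P →ₗ[ℝ] F.L2P) F.primitive) lam := by
  have hs : ∀ f g : F.L2P, (innerₗ F.L2P).compl₁₂ (F.primitive : F.L2P →ₗ[ℝ] F.L2P)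
    (F.primitive : F.L2P →ₗ[ℝ] F.L2P) f g = inner ℝ (F.primitive f) (F.primitive g) :=
    fun f g => rfl
  ext f
  rw [mem_pencilEigenspace]
  simp only [opForm_apply, hs]
  constructor
  · rintro ⟨z, hz, rfl⟩ g
    have h1 : lam • F.toL2 z = F.L0 z := F.mem_graphL0_iff.1 hz
    rw [inner_redOp_coordH2, ← h1, real_inner_smul_left, primitive_coordH2]
  · intro h
    have h1 : F.IsWeakDeriv (f - F.mean f) (F.K0 (F.primitive f) - lam • F.primitive f) := by
      refine F.isWeakDeriv_of_forall fun g w hg => ?_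
      have h2 := h (w + F.mean g)
      rw [inner_redOp, (hg.primitive_eq F).1, (hg.primitive_eq F).2] at h2
      rw [inner_sub_left, real_inner_smul_left]
      linarith
    set z : F.H2P := ⟨(F.primitive f, f - F.mean f, F.K0 (F.primitive f) - lam • F.primitive f),
      F.isWeakDeriv_primitive f, h1⟩ with hz
    refine ⟨z, F.mem_graphL0_iff.2 ?_, ?_⟩
    · change lam • F.primitive f
        = -(F.K0 (F.primitive f) - lam • F.primitive f) + F.K0 (F.primitive f)
      abel
    · change f - F.mean f + F.mean (F.primitive f) = f
      rw [mean_primitive, sub_add_cancel]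

lemma map_iSup_eigenspaceL0 :
    (⨆ lam : {t : ℝ // t < 0}, F.eigenspaceL0 lam : Submodule ℝ F.H2P).map F.coordH2
      = negPencilSpace F.redOp F.primitive := by
  rw [Submodule.map_iSup, negPencilSpace]
  exact iSup_congr fun lam => F.map_eigenspaceL0 lam

lemma negIndex_redOp :
    negIndex ⊤ (fun f => inner ℝ (F.redOp f) f) = F.negEigenvalueCount := by
  rw [negIndex_opForm_eq F.isSymmetric_redOp F.isCompactOperator_primitive F.injective_primitive
    (by positivity) F.norm_sq_le_redOp, ← map_iSup_eigenspaceL0,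
    toENat_rank_map_of_injOn _ _ fun u _ hu => F.coordH2_eq_zero hu]
  rfl

/-- Restriction of the form from `H¹_P` to `H²_P` cannot raise the index, and the eigenfunctions
that attain it already lie in `H²_P`. -/
lemma negIndex_graphL0 : negIndex F.graphL0 (fun z => inner ℝ z.2 (F.toL2 z.1))
    = negIndex ⊤ (fun f => inner ℝ (F.redOp f) f) := by
  refine le_antisymm (negIndex_le_negIndex (F.coordH2 ∘ₗ LinearMap.fst ℝ F.H2P F.L2P)
    (fun _ _ => trivial) (fun z hz => ?_) fun z _ hz => ?_) ?_
  · rw [F.mem_graphL0_iff.1 hz, ← primitive_coordH2, ← inner_redOp_coordH2]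
    rfl
  · have h0 : z.1 = 0 := F.coordH2_eq_zero hz
    rw [h0, map_zero, inner_zero_right]
  · rw [negIndex_redOp, negEigenvalueCount,
      ← toENat_rank_map_of_injOn (LinearMap.id.prod F.L0) _ fun u _ hu => congrArg Prod.fst hu]
    refine le_negIndex ?_ ?_
    · rintro _ ⟨z, _, rfl⟩
      exact F.mem_graphL0_iff.2 rfl
    · rintro _ ⟨z, hz, rfl⟩ hne
      have hz0 : z ≠ 0 := fun h => hne (by rw [h, map_zero])
      change inner ℝ (F.L0 z) (F.toL2 z) < 0
      rw [← primitive_coordH2, ← inner_redOp_coordH2]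
      refine inner_neg_of_mem_negPencilSpace F.isSymmetric_redOp F.injective_primitive ?_
        fun h => hz0 (F.coordH2_eq_zero h)
      rw [← map_iSup_eigenspaceL0]
      exact Submodule.mem_map_of_mem hz

/-! ### Kernels -/

lemma rank_map_of_injOn {E E' : Type} [AddCommGroup E] [Module ℝ E] [AddCommGroup E']
    [Module ℝ E'] (f : E →ₗ[ℝ] E') (S : Submodule ℝ E) (hf : ∀ u ∈ S, f u = 0 → u = 0) :
    Module.rank ℝ (S.map f) = Module.rank ℝ S := by
  have hinj : Function.Injective (f.submoduleMap S) := by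
    rw [injective_iff_map_eq_zero]
    exact fun u hu => Subtype.ext (hf u u.2 (congrArg Subtype.val hu))
  exact (LinearEquiv.ofBijective _ ⟨hinj, f.submoduleMap_surjective S⟩).rank_eq.symm

/-- A kernel element pairs to zero with all minimizers, which sees only the reduced form; conversely
the minimizer over a null vector of the reduced form annihilates the whole space by
`formL_minimizer`. -/
lemma map_formKer : (formKer F.closureRangeB F.formL).map F.coord
    = (F.eigenspaceL0 0).map F.coordH2 := by
  rw [map_eigenspaceL0, closureRangeB_eq]
  ext f
  rw [mem_pencilEigenspace]
  simp only [opForm_apply, zero_mul]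
  constructor
  · rintro ⟨u, ⟨hu, h⟩, rfl⟩ g
    have h1 := h _ (F.minimizer_mem g)
    rwa [F.formL_eq hu (F.minimizer_mem g), coord_minimizer, γDev_minimizer, EDev_minimizer,
      inner_zero_right, inner_zero_right, add_zero, add_zero] at h1
  · intro h
    exact ⟨F.minimizer f, ⟨F.minimizer_mem f, fun w hw => by rw [F.formL_minimizer f hw, h]⟩,
      F.coord_minimizer f⟩

lemma rank_formKer : Module.rank ℝ (formKer F.closureRangeB F.formL)
    = Module.rank ℝ (F.eigenspaceL0 0) := by
  rw [← rank_map_of_injOn F.coord _ fun u hu h0 => ?_, map_formKer,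
    rank_map_of_injOn F.coordH2 _ fun z _ hz => F.coordH2_eq_zero hz]
  exact F.eq_zero_of_formL (F.closureRangeB_eq ▸ hu.1) h0 (hu.2 u hu.1)

end Equilibrium
end VlasovMaxwell

end

theorem mainTheorem3 (F : VlasovMaxwell.Equilibrium) :
    -- `ℒ⁰ = (ℬ⁰)* (𝒜₁⁰)⁻¹ ℬ⁰ + 𝒜₂⁰` is well defined on `H²_P`
    (∀ ψ : F.H2P, ∃! φ : F.H2P, F.IsA1Inv (F.B0 (F.toL2 ψ)) φ) ∧
    -- `n⁻(L|_{closure of R(B)}) = n⁻(ℒ⁰)`, with `n⁻(ℒ⁰)` as the number of negative eigenvalues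
    -- of `ℒ⁰` and as the negative index of the quadratic form `(ℒ⁰ ψ, ψ)`
    VlasovMaxwell.negIndex F.closureRangeB (fun u => F.formL u u) = F.negEigenvalueCount ∧
    VlasovMaxwell.negIndex F.closureRangeB (fun u => F.formL u u)
      = VlasovMaxwell.negIndex F.graphL0 (fun z => inner ℝ z.2 (F.toL2 z.1)) ∧
    -- `dim ker L|_{closure of R(B)} = dim ker ℒ⁰`
    Module.rank ℝ (VlasovMaxwell.formKer F.closureRangeB F.formL)
      = Module.rank ℝ (F.eigenspaceL0 0) :=
  ⟨fun ψ => F.existsUnique_isA1Inv (F.toL2 ψ), F.negIndex_formL.trans F.negIndex_redOp,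
    F.negIndex_formL.trans F.negIndex_graphL0.symm, F.rank_formKer⟩
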